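/- A group is called quasicyclic (a Prüfer group) if it is an infinite locally cyclic $p$-group for some prime $p$. Let $G$ be a group and let $A$, $B$ be subgroups of $G$ with $G=AB=\{ab \mid a\in A,\ b\in B\}$, such that each of $A$ and $B$ is either abelian or has a quasicyclic subgroup of index $2$. Then $G$ is soluble of derived length at most $3$. Moreover, if $B$ is non-abelian and $X$ is its quasicyclic subgroup, then $AX=XA$ is a metabelian subgroup of $G$ of index at most $2$; more precisely, $AX$ has index $2$ in $G$ if $A\cap B\le X$, and $AX=G$ otherwise. -/

import Mathlib

open scoped Pointwise

/-- A quasicyclic (Prüfer) group: an infinite locally cyclic `p`-group for some prime `p`, where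
locally cyclic means that every finitely generated subgroup is cyclic. -/
def IsQuasicyclic (H : Type*) [Group H] : Prop :=
  ∃ p : ℕ, p.Prime ∧ IsPGroup p H ∧ Infinite H ∧ ∀ K : Subgroup H, K.FG → IsCyclic K

/-- The group `H` is abelian or has a quasicyclic subgroup of index `2`. -/
def IsAbelianOrQuasicyclicIndexTwo (H : Type*) [Group H] : Prop :=
  IsMulCommutative H ∨ ∃ X : Subgroup H, IsQuasicyclic X ∧ X.index = 2

/-- A metabelian group: a group whose second derived subgroup is trivial. -/
def IsMetabelian (H : Type*) [Group H] : Prop :=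
  derivedSeries H 2 = ⊥

/-! Let `B` be nonabelian with quasicyclic subgroup `X` of index two. Since `X` is divisible and its
subgroups form a chain, the elements of `B \ X` invert `X` (`DihLike.of_quasi`), and they share one
square `z`, with `z² = 1`. The type is dihedral if `z = 1` and quaternion otherwise. The heart of
the theorem is that `XA ⊆ AX` unless `A` meets `B \ X`, in which case `AX = G` anyway
(`good_of_abelian`, `goodPair_of_dihLike`). The statements about the index then follow from `B = X ∪
Xy`.

To prove this, divide by a normal subgroup `N` maximal with `AN ∩ B ⊆ X` (when `A` is nonabelian
too: with this or its mirror image). In the quotient, unless the claim is immediate, `A ∩ B = 1` and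
every nontrivial normal subgroup times `A` meets `B \ X` (`AbelianCore`, `DihedralCore`). This
richness forces normalizers in `A` of suitable finite subgroups of `X` to be very small.

In the dihedral type a counting argument finishes (`DihedralFactorization.good`). Call an element
bad if its `B`-part lies outside `X`. As elements of `B \ X` are involutions, given three elements
`e` of `A` in distinct cosets of a finite subgroup, almost no `x` in `X` makes all three `xe` bad.
Badness changes like a parity under right multiplication by `B`. Together these show that the
badness of `wc`, as `w` runs over `X`, is almost constant, then almost always false, and finally
always false.

The quaternion type cannot occur opposite an abelian `A`: the commutators of `A` with `z` would
generate a finite abelian normal subgroup inverted by `z`. Nor can two quaternion types occur: their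
central involutions generate a finite dihedral group which leads to a contradiction. If just one of
two nonabelian factors is dihedral, `GoodPair.swap` exchanges the roles.

For abelian `A`, the group `AX` is metabelian by Itô's theorem. Otherwise `A` has a quasicyclic
subgroup `Y` of index two; the abelian case applied to `X` and `A` makes `XY` a subgroup containing
the commutators of `AX`, and a product of two quasicyclic groups is abelian
(`Quasi.commute_of_fac`). Commutators of `G` lie in `AX`, which bounds the derived length by three.
-/

/-- The properties of a quasicyclic subgroup which are used below: it is an infinite torsion
abelian group whose cyclic subgroups form a chain. -/
structure Quasi {G : Type*} [Group G] (X : Subgroup G) : Prop where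
  comm : ∀ x ∈ X, ∀ y ∈ X, x * y = y * x
  tors : ∀ x ∈ X, IsOfFinOrder x
  inf : (X : Set G).Infinite
  chain : ∀ x ∈ X, ∀ y ∈ X, x ∈ Subgroup.zpowers y ∨ y ∈ Subgroup.zpowers x

/-! ### Quasicyclic groups: chain of subgroups, divisibility, action on finite normal subgroups -/

section Quasi

variable {G : Type*} [Group G] {X : Subgroup G}

/-- Two elements lie in a common finite cyclic `p`-group. There divisibility of orders decides
inclusion of cyclic subgroups, and powers of `p` are totally ordered by divisibility. -/
theorem IsQuasicyclic.quasi (h : IsQuasicyclic X) : Quasi X := by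
  obtain ⟨p, hp, hpg, hinf, hcyc⟩ := h
  have key : ∀ x y : X, (x * y = y * x) ∧
      (x ∈ Subgroup.zpowers y ∨ y ∈ Subgroup.zpowers x) := by
    intro x y
    obtain ⟨⟨g, hg⟩, hgen⟩ := (hcyc (Subgroup.closure {x, y})
      ((Subgroup.fg_iff _).2 ⟨{x, y}, rfl, by simp⟩)).exists_generator
    have hx : x ∈ Subgroup.zpowers g := by
      obtain ⟨k, hk⟩ := hgen ⟨x, Subgroup.subset_closure (by simp)⟩
      exact ⟨k, by simpa using congrArg Subtype.val hk⟩
    have hy : y ∈ Subgroup.zpowers g := by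
      obtain ⟨k, hk⟩ := hgen ⟨y, Subgroup.subset_closure (by simp)⟩
      exact ⟨k, by simpa using congrArg Subtype.val hk⟩
    obtain ⟨k, rfl⟩ := hx
    obtain ⟨l, rfl⟩ := hy
    refine ⟨by simp [← zpow_add, add_comm], ?_⟩
    obtain ⟨n, hn⟩ := hpg g
    have hfin : IsOfFinOrder g := isOfFinOrder_iff_pow_eq_one.2 ⟨p ^ n, pow_pos hp.pos n, hn⟩
    obtain ⟨m, -, hm⟩ := (Nat.dvd_prime_pow hp).1 (orderOf_dvd_of_pow_eq_one hn)
    have : Finite (Subgroup.zpowers g) := hfin.finite_zpowers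
    have hcard : Nat.card (Subgroup.zpowers g) = p ^ m := by rw [Nat.card_zpowers, hm]
    have mem : ∀ a b : ℤ, orderOf (g ^ a) ∣ orderOf (g ^ b) → g ^ a ∈ Subgroup.zpowers (g ^ b) := by
      intro a b hab
      let u : Subgroup.zpowers g := ⟨g ^ a, a, rfl⟩
      let v : Subgroup.zpowers g := ⟨g ^ b, b, rfl⟩
      have hu : orderOf u = orderOf (g ^ a) := Subgroup.orderOf_mk _ _
      have hv : orderOf v = orderOf (g ^ b) := Subgroup.orderOf_mk _ _
      have hle : Subgroup.zpowers u ≤ Subgroup.zpowers v := by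
        classical
        have := Fintype.ofFinite (Subgroup.zpowers g)
        have hpos : 0 < orderOf v := orderOf_pos v
        have hsub : (Subgroup.zpowers v : Set (Subgroup.zpowers g)).toFinset ⊆
            Finset.univ.filter (fun t : Subgroup.zpowers g => t ^ orderOf v = 1) := by
          intro t ht
          simp only [Set.mem_toFinset, SetLike.mem_coe] at ht
          simpa using orderOf_dvd_iff_pow_eq_one.1 (orderOf_dvd_of_mem_zpowers ht)
        -- A cyclic group has at most `n` solutions of `t ^ n = 1`, and `⟨v⟩` already supplies `n =
        -- orderOf v` of them.
        have heq := Finset.eq_of_subset_of_card_le hsub (by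
          refine (IsCyclic.card_pow_eq_one_le hpos).trans ?_
          rw [Set.toFinset_card, ← Nat.card_eq_fintype_card]
          exact (Nat.card_zpowers v).ge)
        rw [Subgroup.zpowers_le]
        have : u ∈ (Subgroup.zpowers v : Set (Subgroup.zpowers g)).toFinset := by
          rw [heq]
          simpa using orderOf_dvd_iff_pow_eq_one.1 (hu ▸ hv ▸ hab : orderOf u ∣ orderOf v)
        simpa using this
      obtain ⟨k, hk⟩ := hle (Subgroup.mem_zpowers u)
      exact ⟨k, by simpa [u, v] using congrArg Subtype.val hk⟩
    obtain ⟨i, -, hi⟩ := (Nat.dvd_prime_pow hp).1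
      ((orderOf_dvd_of_mem_zpowers (show g ^ k ∈ Subgroup.zpowers g from ⟨k, rfl⟩)).trans hm.dvd)
    obtain ⟨j, -, hj⟩ := (Nat.dvd_prime_pow hp).1
      ((orderOf_dvd_of_mem_zpowers (show g ^ l ∈ Subgroup.zpowers g from ⟨l, rfl⟩)).trans hm.dvd)
    rcases le_total i j with hij | hij
    · exact Or.inl (mem _ _ (by rw [hi, hj]; exact pow_dvd_pow _ hij))
    · exact Or.inr (mem _ _ (by rw [hi, hj]; exact pow_dvd_pow _ hij))
  refine ⟨fun x hx y hy => ?_, fun x hx => ?_, ?_, fun x hx y hy => ?_⟩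
  · simpa using congrArg Subtype.val (key ⟨x, hx⟩ ⟨y, hy⟩).1
  · obtain ⟨n, hn⟩ := hpg ⟨x, hx⟩
    exact isOfFinOrder_iff_pow_eq_one.2 ⟨p ^ n, pow_pos hp.pos n,
      by simpa using congrArg Subtype.val hn⟩
  · exact Set.infinite_coe_iff.1 hinf
  · rcases (key ⟨x, hx⟩ ⟨y, hy⟩).2 with ⟨k, hk⟩ | ⟨k, hk⟩
    · exact Or.inl ⟨k, by simpa using congrArg Subtype.val hk⟩
    · exact Or.inr ⟨k, by simpa using congrArg Subtype.val hk⟩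

theorem mem_zpowers_of_orderOf_le {x y : G} (hy : x ∈ Subgroup.zpowers y) (hx : IsOfFinOrder y)
    (h : orderOf y ≤ orderOf x) : y ∈ Subgroup.zpowers x := by
  have hle : Subgroup.zpowers x ≤ Subgroup.zpowers y := by simpa using hy
  have : Finite (Subgroup.zpowers y) := hx.finite_zpowers
  have := Subgroup.eq_of_le_of_card_ge hle (by rwa [Nat.card_zpowers, Nat.card_zpowers])
  rw [this]; exact Subgroup.mem_zpowers y

namespace Quasi

theorem le_total (h : Quasi X) {H K : Subgroup G} (hH : H ≤ X) (hK : K ≤ X) : H ≤ K ∨ K ≤ H := by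
  by_contra! hc
  obtain ⟨x, hx, hxK⟩ := SetLike.not_le_iff_exists.1 hc.1
  obtain ⟨y, hy, hyH⟩ := SetLike.not_le_iff_exists.1 hc.2
  rcases h.chain x (hH hx) y (hK hy) with h1 | h1
  · exact hxK ((Subgroup.zpowers_le.2 hy) h1)
  · exact hyH ((Subgroup.zpowers_le.2 hx) h1)

/-- If `x` is missing from `H`, the chain condition puts all of `H` inside the finite group `⟨x⟩`.
-/
theorem eq_of_infinite (h : Quasi X) {H : Subgroup G} (hH : H ≤ X) (hi : (H : Set G).Infinite) :
    H = X := by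
  refine le_antisymm hH fun x hx => ?_
  by_contra hxH
  refine hi (Set.Finite.subset (s := (Subgroup.zpowers x : Set G)) ?_ fun y hy => ?_)
  · exact (finite_zpowers).2 (h.tors x hx)
  · rcases h.chain x hx y (hH hy) with h1 | h1
    · exact absurd ((Subgroup.zpowers_le.2 hy) h1) hxH
    · exact h1

theorem finite_of_not_mem (h : Quasi X) {H : Subgroup G} (hH : H ≤ X) {x : G} (hx : x ∈ X)
    (hxH : x ∉ H) : (H : Set G).Finite := by
  by_contra hc
  exact hxH (h.eq_of_infinite hH hc ▸ hx)

theorem finite_torsion (h : Quasi X) {n : ℕ} (hn : 0 < n) : {x | x ∈ X ∧ x ^ n = 1}.Finite := by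
  have h1 : ∀ m : ℕ, {x | x ∈ X ∧ orderOf x = m}.Finite := by
    intro m
    rcases Set.eq_empty_or_nonempty {x | x ∈ X ∧ orderOf x = m} with he | ⟨x, hx, hxm⟩
    · rw [he]; exact Set.finite_empty
    · refine Set.Finite.subset (s := (Subgroup.zpowers x : Set G)) ?_ fun y hy => ?_
      · exact (finite_zpowers).2 (h.tors x hx)
      · rcases h.chain y hy.1 x hx with h1 | h1
        · exact h1
        · exact mem_zpowers_of_orderOf_le h1 (h.tors y hy.1) (by rw [hy.2, hxm])
  refine Set.Finite.subset ((Finset.range (n + 1)).finite_toSet.biUnion fun m _ => h1 m) ?_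
  intro x hx
  simp only [Set.mem_iUnion]
  exact ⟨orderOf x, by simpa [Nat.lt_succ_iff] using orderOf_le_of_pow_eq_one hn hx.2, hx.1, rfl⟩

/-- The `n`-th power map on `X` has finite kernel, so its image is an infinite subgroup and
therefore all of `X`. -/
theorem exists_pow_eq (h : Quasi X) {n : ℕ} (hn : 0 < n) {x : G} (hx : x ∈ X) :
    ∃ u ∈ X, u ^ n = x := by
  let H : Subgroup G :=
    { carrier := {g | ∃ u ∈ X, u ^ n = g}
      one_mem' := ⟨1, X.one_mem, one_pow n⟩
      mul_mem' := by
        rintro _ _ ⟨u, hu, rfl⟩ ⟨v, hv, rfl⟩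
        exact ⟨u * v, X.mul_mem hu hv, Commute.mul_pow (h.comm u hu v hv) n⟩
      inv_mem' := by
        rintro _ ⟨u, hu, rfl⟩
        exact ⟨u⁻¹, X.inv_mem hu, inv_pow u n⟩ }
  have hHX : H ≤ X := by
    rintro _ ⟨u, hu, rfl⟩
    exact X.pow_mem hu n
  have hinf : (H : Set G).Infinite := by
    intro hfin
    refine h.inf (Set.Finite.of_finite_fibers (fun u : G => u ^ n) (hfin.subset ?_) ?_)
    · rintro _ ⟨u, hu, rfl⟩
      exact ⟨u, hu, rfl⟩
    · rintro _ ⟨u, hu, rfl⟩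
      refine ((h.finite_torsion hn).image (fun t => t * u)).subset ?_
      rintro v ⟨hv, hvu⟩
      refine ⟨v * u⁻¹, ⟨X.mul_mem hv (X.inv_mem hu), ?_⟩, by simp⟩
      have hc : Commute v u⁻¹ := h.comm v hv _ (X.inv_mem hu)
      rw [hc.mul_pow, inv_pow]
      simpa using congrArg (· * (u ^ n)⁻¹) hvu
  have := h.eq_of_infinite hHX hinf
  rw [← this] at hx
  exact hx

theorem hom_eq_one (h : Quasi X) {F : Type*} [Group F] [Finite F] (f : X →* F) (x : X) :
    f x = 1 := by
  obtain ⟨u, hu, hux⟩ := h.exists_pow_eq (n := Nat.card F) Nat.card_pos x.2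
  have : (⟨u, hu⟩ : X) ^ Nat.card F = x := Subtype.ext hux
  rw [← this, map_pow, pow_card_eq_one']

/-- Conjugation maps the divisible group `X` to the finite group of automorphisms of `M`, hence
trivially. This is how finiteness of a normal subgroup is exploited throughout. -/
theorem commute_of_finite_normal (h : Quasi X) {M : Subgroup G} [M.Normal]
    (hM : (M : Set G).Finite) {x m : G} (hx : x ∈ X) (hm : m ∈ M) : x * m = m * x := by
  have : Finite M := hM
  have : Finite (MulAut M) := Finite.of_injective (fun e : MulAut M => (e : M → M))
    DFunLike.coe_injective
  have h1 := h.hom_eq_one ((MulAut.conjNormal (H := M)).comp X.subtype) ⟨x, hx⟩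
  have h2 := congrArg (fun e : MulAut M => ((e ⟨m, hm⟩ : M) : G)) h1
  simp only [MonoidHom.comp_apply, MulAut.conjNormal_apply, MulAut.one_apply,
    Subgroup.coe_subtype] at h2
  exact mul_inv_eq_iff_eq_mul.1 h2

theorem exists_minimal (h : Quasi X) : ∃ w ∈ X, (orderOf w).Prime ∧
    ∀ x ∈ X, x ≠ 1 → w ∈ Subgroup.zpowers x := by
  obtain ⟨x, hx, hx1⟩ := h.inf.exists_notMem_finset {1}
  have hx1 : x ≠ 1 := by simpa using hx1
  have hn : orderOf x ≠ 1 := by simpa using hx1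
  have hpos : 0 < orderOf x := (h.tors x hx).orderOf_pos
  have hp := Nat.minFac_prime hn
  have ho : orderOf (x ^ (orderOf x / (orderOf x).minFac)) = (orderOf x).minFac := by
    rw [orderOf_pow_orderOf_div hpos.ne' (Nat.minFac_dvd _)]
  refine ⟨_, X.pow_mem hx _, by rw [ho]; exact hp, fun t ht ht1 => ?_⟩
  set w := x ^ (orderOf x / (orderOf x).minFac)
  have hw : w ∈ X := X.pow_mem hx _
  rcases h.chain w hw t ht with h1 | h1
  · exact h1
  · refine mem_zpowers_of_orderOf_le h1 (h.tors w hw) ?_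
    have h2 := orderOf_dvd_of_mem_zpowers h1
    rw [ho] at h2 ⊢
    rcases (Nat.dvd_prime hp).1 h2 with h3 | h3
    · exact absurd (orderOf_eq_one_iff.1 h3) ht1
    · exact h3.ge

theorem map (h : Quasi X) {H : Type*} [Group H] (f : G →* H) {x : G} (hx : x ∈ X) (hfx : f x ≠ 1) :
    Quasi (X.map f) := by
  refine ⟨?_, ?_, ?_, ?_⟩
  · rintro _ ⟨u, hu, rfl⟩ _ ⟨v, hv, rfl⟩
    rw [← map_mul, h.comm u hu v hv, map_mul]
  · rintro _ ⟨u, hu, rfl⟩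
    exact MonoidHom.isOfFinOrder f (h.tors u hu)
  · intro hfin
    have hker : ((X ⊓ f.ker : Subgroup G) : Set G).Finite :=
      h.finite_of_not_mem inf_le_left hx fun hc => hfx hc.2
    refine h.inf (Set.Finite.of_finite_fibers f (hfin.subset ?_) ?_)
    · rintro _ ⟨u, hu, rfl⟩
      exact ⟨u, hu, rfl⟩
    · rintro _ ⟨u, hu, rfl⟩
      refine (hker.image (fun t => t * u)).subset ?_
      rintro v ⟨hv, hvu⟩
      have hvu : f v = f u := hvu
      exact ⟨v * u⁻¹, ⟨X.mul_mem hv (X.inv_mem hu), by simp [hvu]⟩, by simp⟩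
  · rintro _ ⟨u, hu, rfl⟩ _ ⟨v, hv, rfl⟩
    rcases h.chain u hu v hv with ⟨k, rfl⟩ | ⟨k, rfl⟩
    · exact Or.inl ⟨k, by simp⟩
    · exact Or.inr ⟨k, by simp⟩

theorem subgroupOf (h : Quasi X) {H : Subgroup G} (hXH : X ≤ H) : Quasi (X.subgroupOf H) := by
  refine ⟨?_, ?_, ?_, ?_⟩
  · rintro ⟨u, hu'⟩ hu ⟨v, hv'⟩ hv
    exact Subtype.ext (h.comm u hu v hv)
  · rintro ⟨u, hu'⟩ hu
    exact Submonoid.isOfFinOrder_coe.1 (h.tors u hu)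
  · intro hfin
    refine h.inf ((hfin.image Subtype.val).subset fun u hu => ?_)
    exact ⟨⟨u, hXH hu⟩, hu, rfl⟩
  · rintro ⟨u, hu'⟩ hu ⟨v, hv'⟩ hv
    rcases h.chain u hu v hv with ⟨k, hk⟩ | ⟨k, hk⟩
    · exact Or.inl ⟨k, Subtype.ext hk⟩
    · exact Or.inr ⟨k, Subtype.ext hk⟩

end Quasi

end Quasi

/-! ### Groups of dihedral and quaternion type -/

/-- `B` has the quasicyclic subgroup `X` of index two, and the elements of `B \ X` invert `X`. -/
structure DihLike {G : Type*} [Group G] (B X : Subgroup G) : Prop where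
  quasi : Quasi X
  le : X ≤ B
  ne : ∃ y ∈ B, y ∉ X
  mul_mem : ∀ y ∈ B, y ∉ X → ∀ y' ∈ B, y' ∉ X → y * y' ∈ X
  inv : ∀ y ∈ B, y ∉ X → ∀ x ∈ X, y * x * y⁻¹ = x⁻¹

/-- `g` lies in the product `AX`. -/
def Good {G : Type*} [Group G] (A X : Subgroup G) (g : G) : Prop := ∃ a ∈ A, ∃ x ∈ X, g = a * x

/-- `g` lies in the product of `A` and `B \ X`. -/
def Bad {G : Type*} [Group G] (A B X : Subgroup G) (g : G) : Prop :=
  ∃ a ∈ A, ∃ y ∈ B, y ∉ X ∧ g = a * y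

section DihLike

variable {G : Type*} [Group G] {B X : Subgroup G}

theorem inv_notMem {y : G} (hy : y ∉ X) : y⁻¹ ∉ X := fun h => hy (by simpa using X.inv_mem h)

theorem mul_notMem_left {x y : G} (hx : x ∈ X) (hy : y ∉ X) : x * y ∉ X :=
  fun h => hy ((X.mul_mem_cancel_left hx).1 h)

theorem mul_notMem_right {x y : G} (hx : x ∈ X) (hy : y ∉ X) : y * x ∉ X :=
  fun h => hy ((X.mul_mem_cancel_right hx).1 h)

namespace DihLike

/-- The quotient `y' * y⁻¹` lies in `X` and is therefore inverted by `y`. The common square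
separates the dihedral from the quaternion type. -/
theorem mul_self_eq (h : DihLike B X) {y y' : G} (hy : y ∈ B) (hyX : y ∉ X) (hy' : y' ∈ B)
    (hyX' : y' ∉ X) : y * y = y' * y' := by
  have hx : y' * y⁻¹ ∈ X := h.mul_mem y' hy' hyX' y⁻¹ (B.inv_mem hy) (inv_notMem hyX)
  have h1 := h.inv y hy hyX _ hx
  have h2 : y * y' * y⁻¹ = y * y'⁻¹ * y := by
    have : y * (y' * y⁻¹) * y⁻¹ * y = (y' * y⁻¹)⁻¹ * y := by rw [h1]
    calc y * y' * y⁻¹ = y * (y' * y⁻¹) * y⁻¹ * y := by group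
      _ = (y' * y⁻¹)⁻¹ * y := this
      _ = y * y'⁻¹ * y := by group
  have h3 : y' * y⁻¹ = y'⁻¹ * y := by
    apply mul_left_cancel (a := y); simpa [mul_assoc] using h2
  calc y * y = y' * (y'⁻¹ * y) * y := by group
    _ = y' * (y' * y⁻¹) * y := by rw [h3]
    _ = y' * y' := by group

theorem mul_self_mul_self (h : DihLike B X) {y : G} (hy : y ∈ B) (hyX : y ∉ X) :
    (y * y) * (y * y) = 1 := by
  have h1 := h.inv y hy hyX _ (h.mul_mem y hy hyX y hy hyX)
  have h2 : y * (y * y) * y⁻¹ = y * y := by group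
  rw [h2] at h1
  nth_rewrite 1 [h1]
  simp

theorem inv' (h : DihLike B X) {y x : G} (hy : y ∈ B) (hyX : y ∉ X) (hx : x ∈ X) :
    y⁻¹ * x * y = x⁻¹ := by
  simpa using h.inv y⁻¹ (B.inv_mem hy) (inv_notMem hyX) x hx

theorem conj_mem (h : DihLike B X) {b x : G} (hb : b ∈ B) (hx : x ∈ X) : b * x * b⁻¹ ∈ X := by
  by_cases hbX : b ∈ X
  · exact X.mul_mem (X.mul_mem hbX hx) (X.inv_mem hbX)
  · rw [h.inv b hb hbX x hx]; exact X.inv_mem hx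

theorem act (h : DihLike B X) {b : G} (hb : b ∈ B) :
    (∀ x ∈ X, b * x * b⁻¹ = x) ∨ (∀ x ∈ X, b * x * b⁻¹ = x⁻¹) := by
  by_cases hbX : b ∈ X
  · left
    intro x hx
    rw [h.quasi.comm b hbX x hx]; group
  · right
    exact h.inv b hb hbX

theorem map (h : DihLike B X) {H : Type*} [Group H] (f : G →* H) {x : G} (hx : x ∈ X)
    (hfx : f x ≠ 1) (hJ : ∀ y ∈ B, y ∉ X → f y ≠ 1) : DihLike (B.map f) (X.map f) := by
  have hJ' : ∀ y ∈ B, f y ∉ X.map f → y ∉ X := fun y _ hy hyX => hy ⟨y, hyX, rfl⟩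
  refine ⟨h.quasi.map f hx hfx, Subgroup.map_mono h.le, ?_, ?_, ?_⟩
  · obtain ⟨y, hy, hyX⟩ := h.ne
    refine ⟨f y, ⟨y, hy, rfl⟩, ?_⟩
    rintro ⟨u, hu, huy⟩
    refine hJ (u⁻¹ * y) (B.mul_mem (B.inv_mem (h.le hu)) hy)
      (mul_notMem_left (X.inv_mem hu) hyX) ?_
    rw [map_mul, map_inv, huy, inv_mul_cancel]
  · rintro _ ⟨y, hy, rfl⟩ hyX _ ⟨y', hy', rfl⟩ hyX'
    exact ⟨y * y', h.mul_mem y hy (hJ' y hy hyX) y' hy' (hJ' y' hy' hyX'), map_mul f _ _⟩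
  · rintro _ ⟨y, hy, rfl⟩ hyX _ ⟨u, hu, rfl⟩
    rw [← map_mul, ← map_inv, ← map_mul, ← map_inv, h.inv y hy (hJ' y hy hyX) u hu]

theorem subgroupOf (h : DihLike B X) {H : Subgroup G} (hBH : B ≤ H) :
    DihLike (B.subgroupOf H) (X.subgroupOf H) := by
  refine ⟨h.quasi.subgroupOf (h.le.trans hBH), fun x hx => h.le hx, ?_, ?_, ?_⟩
  · obtain ⟨y, hy, hyX⟩ := h.ne
    exact ⟨⟨y, hBH hy⟩, hy, hyX⟩
  · exact fun y hy hyX y' hy' hyX' => h.mul_mem y hy hyX y' hy' hyX'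
  · exact fun y hy hyX x hx => Subtype.ext (h.inv y hy hyX x hx)

/-- A quasicyclic subgroup of `B` is equal to `X`. -/
theorem eq_of_quasi (h : DihLike B X) {X' : Subgroup G} (hX' : Quasi X') (hle : X' ≤ B) :
    X' = X := by
  have h1 : X' ≤ X := by
    intro x hx
    obtain ⟨u, hu, rfl⟩ := hX'.exists_pow_eq (n := 2) (by norm_num) hx
    rw [pow_two]
    by_cases huX : u ∈ X
    · exact X.mul_mem huX huX
    · exact h.mul_mem u (hle hu) huX u (hle hu) huX
  exact h.quasi.eq_of_infinite h1 hX'.inf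

theorem not_comm (h : DihLike B X) : ¬ ∀ x ∈ B, ∀ y ∈ B, x * y = y * x := by
  intro hc
  obtain ⟨y, hy, hyX⟩ := h.ne
  refine h.quasi.inf ((h.quasi.finite_torsion (n := 2) (by norm_num)).subset fun x hx => ⟨hx, ?_⟩)
  have h1 := h.inv y hy hyX x hx
  rw [hc y hy x (h.le hx), mul_inv_cancel_right] at h1
  rw [pow_two]
  nth_rewrite 1 [h1]
  simp

/-- An element `y` outside `X` acts on `X` as an automorphism of order at most two. Up to squares,
`X` is the product of its centralized part `K` and its inverted part `I`. One of the two contains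
the other, and divisibility makes the larger one equal to `X`. If it is `K`, then `B` is abelian. -/
theorem of_quasi (hX : Quasi X) (hle : X ≤ B) (hmul : ∀ y ∈ B, y ∉ X → ∀ y' ∈ B, y' ∉ X → y * y' ∈ X)
    (hnc : ¬ ∀ x ∈ B, ∀ y ∈ B, x * y = y * x) : DihLike B X := by
  have hconj : ∀ y ∈ B, y ∉ X → ∀ x ∈ X, y * x * y⁻¹ ∈ X := fun y hy hyX x hx =>
    hmul _ (B.mul_mem hy (hle hx)) (mul_notMem_right hx hyX) _ (B.inv_mem hy) (inv_notMem hyX)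
  refine ⟨hX, hle, ?_, hmul, ?_⟩
  · by_contra! hc
    exact hnc fun x hx y hy => hX.comm x (hc x hx) y (hc y hy)
  intro y hy hyX
  let K : Subgroup G := X ⊓ Subgroup.centralizer {y}
  let I : Subgroup G :=
    { carrier := {x | x ∈ X ∧ y * x * y⁻¹ = x⁻¹}
      one_mem' := ⟨X.one_mem, by simp⟩
      mul_mem' := by
        rintro u v ⟨hu, hu'⟩ ⟨hv, hv'⟩
        refine ⟨X.mul_mem hu hv, ?_⟩
        calc y * (u * v) * y⁻¹ = (y * u * y⁻¹) * (y * v * y⁻¹) := by group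
          _ = (v * u)⁻¹ := by rw [hu', hv', mul_inv_rev]
          _ = (u * v)⁻¹ := by rw [hX.comm u hu v hv]
      inv_mem' := by
        rintro u ⟨hu, hu'⟩
        refine ⟨X.inv_mem hu, ?_⟩
        rw [inv_inv]
        calc y * u⁻¹ * y⁻¹ = (y * u * y⁻¹)⁻¹ := by group
          _ = u := by rw [hu', inv_inv] }
  -- With `p` the conjugate of `x` by `y`, write `x² = (xp)(xp⁻¹)`; conjugation by `y` swaps `x` and
  -- `p`.
  have hsq : ∀ x ∈ X, ∃ a ∈ K, ∃ b ∈ I, x * x = a * b := by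
    intro x hx
    set p := y * x * y⁻¹ with hp
    have hpX : p ∈ X := hconj y hy hyX x hx
    have hyp : y * p * y⁻¹ = x := by
      calc y * p * y⁻¹ = (y * y) * x * (y * y)⁻¹ := by rw [hp]; group
        _ = x := by rw [hX.comm _ (hmul y hy hyX y hy hyX) x hx]; group
    refine ⟨x * p, ⟨X.mul_mem hx hpX, ?_⟩, x * p⁻¹, ⟨X.mul_mem hx (X.inv_mem hpX), ?_⟩, ?_⟩
    · apply Subgroup.mem_centralizer_singleton_iff.2
      have : y * (x * p) * y⁻¹ = x * p := by
        calc y * (x * p) * y⁻¹ = (y * x * y⁻¹) * (y * p * y⁻¹) := by group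
          _ = p * x := by rw [hyp]
          _ = x * p := hX.comm _ hpX _ hx
      rw [mul_inv_eq_iff_eq_mul] at this
      exact this.symm
    · calc y * (x * p⁻¹) * y⁻¹ = (y * x * y⁻¹) * (y * p * y⁻¹)⁻¹ := by group
        _ = p * x⁻¹ := by rw [hyp]
        _ = (x * p⁻¹)⁻¹ := by group
    · rw [mul_assoc, ← mul_assoc p, hX.comm p hpX x hx]; group
  have hle' : ∀ H : Subgroup G, (∀ x ∈ X, x * x ∈ H) → ∀ x ∈ X, x ∈ H := by
    intro H hH x hx
    obtain ⟨u, hu, rfl⟩ := hX.exists_pow_eq (n := 2) (by norm_num) hx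
    rw [pow_two]; exact hH u hu
  rcases hX.le_total (H := K) (K := I) inf_le_left (fun x hx => hx.1) with hKI | hIK
  · intro x hx
    exact (hle' I (fun x hx => by
      obtain ⟨a, ha, b, hb, hab⟩ := hsq x hx
      rw [hab]; exact I.mul_mem (hKI ha) hb) x hx).2
  · exfalso
    have hc : ∀ x ∈ X, x * y = y * x := by
      intro x hx
      have := Subgroup.mem_centralizer_singleton_iff.1 (hle' K (fun x hx => by
        obtain ⟨a, ha, b, hb, hab⟩ := hsq x hx
        rw [hab]; exact K.mul_mem ha (hIK hb)) x hx).2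
      exact this
    apply hnc
    have hrep : ∀ b ∈ B, ∃ x ∈ X, b = x ∨ b = x * y := by
      intro b hb
      by_cases hbX : b ∈ X
      · exact ⟨b, hbX, Or.inl rfl⟩
      · exact ⟨b * y⁻¹, hmul b hb hbX _ (B.inv_mem hy) (inv_notMem hyX), Or.inr (by group)⟩
    have hCy : ∀ b ∈ B, b * y = y * b := by
      intro b hb
      obtain ⟨x, hx, rfl | rfl⟩ := hrep b hb
      · exact hc _ hx
      · rw [hc x hx, mul_assoc, hc x hx]
    have hCX : ∀ b ∈ B, ∀ x ∈ X, b * x = x * b := by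
      intro b hb x hx
      obtain ⟨u, hu, rfl | rfl⟩ := hrep b hb
      · exact hX.comm _ hu _ hx
      · rw [mul_assoc, ← hc x hx, ← mul_assoc, hX.comm u hu x hx, mul_assoc]
    intro b hb b' hb'
    obtain ⟨u, hu, rfl | rfl⟩ := hrep b' hb'
    · exact hCX b hb _ hu
    · rw [← mul_assoc, hCX b hb u hu, mul_assoc, hCy b hb, mul_assoc]

theorem of_index_two (hX : ∃ X : Subgroup B, IsQuasicyclic X ∧ X.index = 2)
    (hnc : ¬ IsMulCommutative B) : ∃ X : Subgroup G, DihLike B X := by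
  obtain ⟨X, hq, hi⟩ := hX
  have hmem : ∀ b : G, ∀ hb : b ∈ B, b ∈ X.map B.subtype ↔ (⟨b, hb⟩ : B) ∈ X := by
    intro b hb
    constructor
    · rintro ⟨u, hu, rfl⟩; exact hu
    · intro h; exact ⟨⟨b, hb⟩, h, rfl⟩
  refine ⟨X.map B.subtype, of_quasi ?_ (Subgroup.map_subtype_le X) ?_ ?_⟩
  · have hQ := hq.quasi
    obtain ⟨x, hx, hx1⟩ := hQ.inf.exists_notMem_finset {1}
    exact hQ.map B.subtype hx fun h => hx1 (by simpa using h)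
  · intro y hy hyX y' hy' hyX'
    rw [hmem y hy] at hyX
    rw [hmem y' hy'] at hyX'
    rw [hmem _ (B.mul_mem hy hy')]
    have := Subgroup.mul_mem_iff_of_index_two hi (a := ⟨y, hy⟩) (b := ⟨y', hy'⟩)
    exact this.2 (by simp [hyX, hyX'])
  · intro hc
    exact hnc ⟨⟨fun a b => Subtype.ext (hc a a.2 b b.2)⟩⟩

end DihLike

end DihLike

/-! ### The counting argument for dihedral factors -/

/-- A factorization `G = AB` with `A ∩ B = 1`, where `B` is infinite locally dihedral with
quasicyclic subgroup `X`, the group `A` has an abelian subgroup `Y` of index at most two on which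
it acts by `±1`, and almost no element of `X` is centralized by nontrivial elements of `Y` or
conjugated into `B` by elements of `A` outside the finite subgroup `N`. -/
structure DihedralFactorization {G : Type*} [Group G] (A B X Y N : Subgroup G) (S : Set G) :
    Prop where
  fac : ∀ g : G, ∃ a ∈ A, ∃ b ∈ B, g = a * b
  disj : ∀ g ∈ A, g ∈ B → g = 1
  inf : (A : Set G).Infinite
  dih : DihLike B X
  sq : ∀ y ∈ B, y ∉ X → y * y = 1
  mulY : ∀ a ∈ A, a ∉ Y → ∀ a' ∈ A, a' ∉ Y → a * a' ∈ Y
  actY : ∀ a ∈ A, (∀ k ∈ Y, a * k * a⁻¹ = k) ∨ (∀ k ∈ Y, a * k * a⁻¹ = k⁻¹)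
  finN : (N : Set G).Finite
  finS : S.Finite
  cent : ∀ x ∈ X, x ∉ S → ∀ k ∈ Y, x * k = k * x → k = 1
  conj : ∀ x ∈ X, x ∉ S → ∀ a ∈ A, a⁻¹ * x * a ∈ B → a ∈ N

namespace DihedralFactorization

open Filter

variable {G : Type*} [Group G] {A B X Y N : Subgroup G} {S : Set G}

theorem unique (h : DihedralFactorization A B X Y N S) {a a' b b' : G} (ha : a ∈ A) (ha' : a' ∈ A)
    (hb : b ∈ B) (hb' : b' ∈ B) (he : a * b = a' * b') : a = a' ∧ b = b' := by
  have h1 : a'⁻¹ * a = b' * b⁻¹ := by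
    rw [inv_mul_eq_iff_eq_mul, ← mul_assoc, ← he, mul_assoc, mul_inv_cancel, mul_one]
  have h2 : a'⁻¹ * a = 1 := h.disj _ (A.mul_mem (A.inv_mem ha') ha)
    (h1 ▸ B.mul_mem hb' (B.inv_mem hb))
  have h3 : a = a' := (inv_mul_eq_one.1 h2).symm
  exact ⟨h3, by rw [h3] at he; exact mul_left_cancel he⟩

theorem bad_iff (h : DihedralFactorization A B X Y N S) {a b : G} (ha : a ∈ A) (hb : b ∈ B) :
    Bad A B X (a * b) ↔ b ∉ X := by
  constructor
  · rintro ⟨a', ha', y, hy, hyX, he⟩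
    rw [(h.unique ha ha' hb hy he).2]; exact hyX
  · intro hbX
    exact ⟨a, ha, b, hb, hbX, rfl⟩

theorem good_of_not_bad (h : DihedralFactorization A B X Y N S) {g : G} (hg : ¬ Bad A B X g) :
    Good A X g := by
  obtain ⟨a, ha, b, hb, rfl⟩ := h.fac g
  rw [h.bad_iff ha hb, not_not] at hg
  exact ⟨a, ha, b, hg, rfl⟩

theorem bad_mul_left (h : DihedralFactorization A B X Y N S) {a : G} (ha : a ∈ A) (g : G) :
    Bad A B X (a * g) ↔ Bad A B X g := by
  obtain ⟨a', ha', b, hb, rfl⟩ := h.fac g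
  rw [← mul_assoc, h.bad_iff (A.mul_mem ha ha') hb, h.bad_iff ha' hb]

/-- Badness is a parity: right multiplication by an element of `B` flips it exactly when that
element lies outside `X`. -/
theorem bad_mul_right (h : DihedralFactorization A B X Y N S) (g : G) {b : G} (hb : b ∈ B) :
    Bad A B X (g * b) ↔ (Bad A B X g ↔ b ∈ X) := by
  obtain ⟨a, ha, b', hb', rfl⟩ := h.fac g
  rw [mul_assoc, h.bad_iff ha (B.mul_mem hb' hb), h.bad_iff ha hb']
  by_cases h1 : b' ∈ X <;> by_cases h2 : b ∈ X
  · simp [h1, h2, X.mul_mem h1 h2]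
  · simp [h1, h2, mul_notMem_left h1 h2]
  · simp [h1, h2, mul_notMem_right h2 h1]
  · simp [h1, h2, h.dih.mul_mem b' hb' h1 b hb h2]

/-- If `xc = c'y` with `y` an involution, then `xδ⁻¹` is an involution for `δ = c'c⁻¹`. Two such
involutions differ by `k = δδ₁⁻¹` in `Y`, so the first inverts `k`. Since `δ` acts on `Y` by a sign,
so does `x` on `k`; thus `x²` centralizes `k`, and `k = 1`. -/
theorem ratio_eq (h : DihedralFactorization A B X Y N S) {x c c' c₁ c₁' y y₁ : G} (hx : x ∈ X)
    (hxS : x * x ∉ S) (hc : c ∈ A) (hc' : c' ∈ A)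
    (hy : y ∈ B) (hyX : y ∉ X) (hy₁ : y₁ ∈ B) (hyX₁ : y₁ ∉ X) (he : x * c = c' * y)
    (he₁ : x * c₁ = c₁' * y₁) (hk : (c' * c⁻¹) * (c₁' * c₁⁻¹)⁻¹ ∈ Y) :
    c' * c⁻¹ = c₁' * c₁⁻¹ := by
  have ht : (x * (c' * c⁻¹)⁻¹) * (x * (c' * c⁻¹)⁻¹) = 1 := by
    have : x * (c' * c⁻¹)⁻¹ = c' * y * c'⁻¹ := by rw [← he]; group
    rw [this]
    calc c' * y * c'⁻¹ * (c' * y * c'⁻¹) = c' * (y * y) * c'⁻¹ := by group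
      _ = 1 := by rw [h.sq y hy hyX]; group
  have ht₁ : (x * (c₁' * c₁⁻¹)⁻¹) * (x * (c₁' * c₁⁻¹)⁻¹) = 1 := by
    have : x * (c₁' * c₁⁻¹)⁻¹ = c₁' * y₁ * c₁'⁻¹ := by rw [← he₁]; group
    rw [this]
    calc c₁' * y₁ * c₁'⁻¹ * (c₁' * y₁ * c₁'⁻¹) = c₁' * (y₁ * y₁) * c₁'⁻¹ := by group
      _ = 1 := by rw [h.sq y₁ hy₁ hyX₁]; group
  have hδ : c' * c⁻¹ ∈ A := A.mul_mem hc' (A.inv_mem hc)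
  generalize c' * c⁻¹ = δ at *
  generalize c₁' * c₁⁻¹ = δ₁ at *
  set k := δ * δ₁⁻¹ with hkdef
  set t := x * δ⁻¹ with htdef
  have hti : t⁻¹ = t := inv_eq_of_mul_eq_one_left ht
  have hti₁ : (x * δ₁⁻¹)⁻¹ = x * δ₁⁻¹ := inv_eq_of_mul_eq_one_left ht₁
  have htk : t * k * t⁻¹ = k⁻¹ := by
    have e1 : t * k = x * δ₁⁻¹ := by rw [htdef, hkdef]; group
    calc t * k * t⁻¹ = (x * δ₁⁻¹)⁻¹ * t := by rw [e1, hti₁, hti]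
      _ = k⁻¹ := by rw [htdef, hkdef]; group
  have htk' : t * k⁻¹ * t⁻¹ = k := by
    have := congrArg (·⁻¹) htk
    simpa [mul_assoc] using this
  have hxk : x * k * x⁻¹ = k ∨ x * k * x⁻¹ = k⁻¹ := by
    have e2 : x * k * x⁻¹ = t * (δ * k * δ⁻¹) * t⁻¹ := by rw [htdef]; group
    rcases h.actY δ hδ with hc | hc
    · right; rw [e2, hc k hk, htk]
    · left; rw [e2, hc k hk, htk']
  have hxx : (x * x) * k = k * (x * x) := by
    have e3 : x * x * k * (x * x)⁻¹ = x * (x * k * x⁻¹) * x⁻¹ := by group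
    rw [← mul_inv_eq_iff_eq_mul, e3]
    rcases hxk with hc | hc
    · rw [hc, hc]
    · rw [hc]
      have := congrArg (·⁻¹) hc
      simpa [mul_assoc] using this
  exact mul_inv_eq_one.1 (h.cent _ (X.mul_mem hx hx) hxS k hk hxx)

/-- Equality of the ratios `δ` gives `e y e⁻¹ = f y' f⁻¹`, so `e⁻¹f` conjugates `y` into `B`.
Quotients of two such `y` lie in `X` and are also conjugated into `B`, hence lie in `S`. Finally `y`
determines `x`, because `A ∩ B = 1`. -/
theorem finite_pair (h : DihedralFactorization A B X Y N S) {e f : G} (he : e ∈ A) (hf : f ∈ A)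
    (hef : e⁻¹ * f ∉ N) :
    {x | x ∈ X ∧ ∃ δ ∈ A, ∃ y ∈ B, ∃ y' ∈ B, y ∉ X ∧ y' ∉ X ∧ x * e = δ * e * y ∧
      x * f = δ * f * y'}.Finite := by
  set P := {x | x ∈ X ∧ ∃ δ ∈ A, ∃ y ∈ B, ∃ y' ∈ B, y ∉ X ∧ y' ∉ X ∧ x * e = δ * e * y ∧
      x * f = δ * f * y'}
  have key : ∀ x ∈ P, ∃ y, (∃ δ ∈ A, x = δ * (e * y * e⁻¹)) ∧ y ∈ B ∧ y ∉ X ∧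
      (e⁻¹ * f)⁻¹ * y * (e⁻¹ * f) ∈ B ∧ (e⁻¹ * f)⁻¹ * y * (e⁻¹ * f) ∉ X := by
    rintro x ⟨hx, δ, hδ, y, hy, y', hy', hyX, hyX', h1, h2⟩
    have h3 : x = δ * (e * y * e⁻¹) := by
      calc x = x * e * e⁻¹ := by group
        _ = _ := by rw [h1]; group
    have h4 : x = δ * (f * y' * f⁻¹) := by
      calc x = x * f * f⁻¹ := by group
        _ = _ := by rw [h2]; group
    have h5 : (e⁻¹ * f)⁻¹ * y * (e⁻¹ * f) = y' := by
      have : e * y * e⁻¹ = f * y' * f⁻¹ := mul_left_cancel (h3.symm.trans h4)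
      calc (e⁻¹ * f)⁻¹ * y * (e⁻¹ * f) = f⁻¹ * (e * y * e⁻¹) * f := by group
        _ = y' := by rw [this]; group
    exact ⟨y, ⟨δ, hδ, h3⟩, hy, hyX, h5 ▸ hy', h5 ▸ hyX'⟩
  rcases Set.eq_empty_or_nonempty P with hP | ⟨x₁, hx₁⟩
  · rw [hP]; exact Set.finite_empty
  obtain ⟨y₁, -, hy₁, hyX₁, hz₁, hzX₁⟩ := key x₁ hx₁
  choose! φ hφ using key
  refine Set.Finite.of_injOn (f := φ) (t := (fun s => s * y₁) '' S) ?_ ?_ (h.finS.image _)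
  · intro x hx
    obtain ⟨-, hy, hyX, hz, hzX⟩ := hφ x hx
    refine ⟨φ x * y₁⁻¹, ?_, by simp⟩
    by_contra hS
    refine hef (h.conj _ (h.dih.mul_mem _ hy hyX _ (B.inv_mem hy₁) (inv_notMem hyX₁)) hS _
      (A.mul_mem (A.inv_mem he) hf) ?_)
    have : (e⁻¹ * f)⁻¹ * (φ x * y₁⁻¹) * (e⁻¹ * f) =
      ((e⁻¹ * f)⁻¹ * φ x * (e⁻¹ * f)) * ((e⁻¹ * f)⁻¹ * y₁ * (e⁻¹ * f))⁻¹ := by group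
    rw [this]
    exact B.mul_mem hz (B.inv_mem hz₁)
  · intro x hx x' hx' hxx
    obtain ⟨⟨δ, hδ, hd⟩, -⟩ := hφ x hx
    obtain ⟨⟨δ', hδ', hd'⟩, -⟩ := hφ x' hx'
    rw [← hxx] at hd'
    have h1 : x * x'⁻¹ = δ * δ'⁻¹ := by
      nth_rewrite 1 [hd]
      rw [hd']; group
    exact mul_inv_eq_one.1 (h.disj _ (h1 ▸ A.mul_mem hδ (A.inv_mem hδ'))
      (B.mul_mem (h.dih.le hx.1) (B.inv_mem (h.dih.le hx'.1))))

/-- Among three ratios in `A`, two agree modulo `Y`, which has index at most two. They are then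
equal by `ratio_eq`, and `finite_pair` applies. -/
theorem eventually_not_three (h : DihedralFactorization A B X Y N S) {e : ℕ → G} {i j k : ℕ}
    (he : ∀ n, e n ∈ A) (hij : (e i)⁻¹ * e j ∉ N) (hik : (e i)⁻¹ * e k ∉ N)
    (hjk : (e j)⁻¹ * e k ∉ N) :
    ∀ᶠ x : X in cofinite, ¬ (Bad A B X (x * e i) ∧ Bad A B X (x * e j) ∧ Bad A B X (x * e k)) := by
  have hsq : {x | x ∈ X ∧ x * x ∈ S}.Finite := by
    refine Set.Finite.of_finite_fibers (fun x => x * x) (h.finS.subset ?_) ?_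
    · rintro _ ⟨x, hx, rfl⟩; exact hx.2
    · rintro _ ⟨u, hu, rfl⟩
      refine ((h.dih.quasi.finite_torsion (n := 2) (by norm_num)).image (fun t => t * u)).subset ?_
      rintro v ⟨hv, hvu⟩
      refine ⟨v * u⁻¹, ⟨X.mul_mem hv.1 (X.inv_mem hu.1), ?_⟩, by simp⟩
      have hc : Commute v u⁻¹ := h.dih.quasi.comm v hv.1 _ (X.inv_mem hu.1)
      have hvu : v * v = u * u := hvu
      rw [hc.mul_pow, inv_pow, pow_two, pow_two, hvu, mul_inv_cancel]
  rw [eventually_cofinite]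
  simp only [not_not]
  refine Set.Finite.of_finite_image ((hsq.union ((h.finite_pair (he i) (he j) hij).union
    ((h.finite_pair (he i) (he k) hik).union (h.finite_pair (he j) (he k) hjk)))).subset ?_)
    Subtype.val_injective.injOn
  rintro _ ⟨⟨x, hx⟩, ⟨⟨a, ha, y, hy, hyX, e1⟩, ⟨a', ha', y', hy', hyX', e2⟩,
    ⟨a'', ha'', y'', hy'', hyX'', e3⟩⟩, rfl⟩
  simp only at e1 e2 e3 ⊢
  by_cases hxS : x * x ∈ S
  · exact Or.inl ⟨hx, hxS⟩
  right
  have pair : ∀ {m n : ℕ} {a a' y y' : G}, a ∈ A → a' ∈ A → y ∈ B → y' ∈ B → y ∉ X → y' ∉ X →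
      x * e m = a * y → x * e n = a' * y' → (a * (e m)⁻¹) * (a' * (e n)⁻¹)⁻¹ ∈ Y →
      x ∈ {x | x ∈ X ∧ ∃ δ ∈ A, ∃ y ∈ B, ∃ y' ∈ B, y ∉ X ∧ y' ∉ X ∧ x * e m = δ * e m * y ∧
      x * e n = δ * e n * y'} := by
    intro m n a a' y y' ha ha' hy hy' hyX hyX' e1 e2 hY
    have hr := h.ratio_eq hx hxS (he m) ha hy hyX hy' hyX' e1 e2 hY
    refine ⟨hx, a * (e m)⁻¹, A.mul_mem ha (A.inv_mem (he m)), y, hy, y', hy', hyX, hyX', ?_, ?_⟩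
    · rw [e1]; group
    · rw [hr, e2]; group
  have hmul : ∀ {a a' : G}, a ∈ A → a' ∈ A → (a ∈ Y ↔ a' ∈ Y) → a * a'⁻¹ ∈ Y := by
    intro a a' ha ha' hiff
    by_cases haY : a ∈ Y
    · exact Y.mul_mem haY (Y.inv_mem (hiff.1 haY))
    · exact h.mulY a ha haY _ (A.inv_mem ha') (inv_notMem fun hc => haY (hiff.2 hc))
  have hd : a * (e i)⁻¹ ∈ A := A.mul_mem ha (A.inv_mem (he i))
  have hd' : a' * (e j)⁻¹ ∈ A := A.mul_mem ha' (A.inv_mem (he j))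
  have hd'' : a'' * (e k)⁻¹ ∈ A := A.mul_mem ha'' (A.inv_mem (he k))
  by_cases h1 : a * (e i)⁻¹ ∈ Y ↔ a' * (e j)⁻¹ ∈ Y
  · exact Or.inl (pair ha ha' hy hy' hyX hyX' e1 e2 (hmul hd hd' h1))
  by_cases h2 : a * (e i)⁻¹ ∈ Y ↔ a'' * (e k)⁻¹ ∈ Y
  · exact Or.inr (Or.inl (pair ha ha'' hy hy'' hyX hyX'' e1 e3 (hmul hd hd'' h2)))
  · exact Or.inr (Or.inr (pair ha' ha'' hy' hy'' hyX' hyX'' e2 e3 (hmul hd' hd'' (by tauto))))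

/-- Take `r w` to be the `A`-part of `w * c`. Comparing `u * r w` with `(u * w) * c` changes badness
by the parity of the `B`-part of `w * c`. Equal `A`-parts for `w` and `w'` mean that `c` conjugates
`w⁻¹w'` into `B`, which is rare since `c ∉ N`. -/
theorem exists_translates (h : DihedralFactorization A B X Y N S) {c : G} (hcN : c ∉ N)
    (hc : c ∈ A) : ∃ r : X → G, (∀ w, r w ∈ A) ∧
      (∀ u w : X, Bad A B X (u * r w) ↔ (Bad A B X ((u * w : X) * c) ↔ ¬ Bad A B X (w * c))) ∧
      ∀ w, {w' | (r w)⁻¹ * r w' ∈ N}.Finite := by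
  have hf : ∀ w : X, ∃ a ∈ A, ∃ b ∈ B, w * c = a * b := fun w => h.fac _
  choose r hr s hs hrs using hf
  refine ⟨r, hr, fun u w => ?_, fun w => ?_⟩
  · have h1 : (u : G) * r w = ((u * w : X) * c) * (s w)⁻¹ := by
      rw [Subgroup.coe_mul, mul_assoc (u : G), hrs w]; group
    rw [h1, h.bad_mul_right _ (B.inv_mem (hs w)), hrs w, h.bad_iff (hr w) (hs w)]
    simp
  · refine Set.Finite.of_finite_fibers r ((h.finN.image (fun n => r w * n)).subset ?_) ?_
    · rintro _ ⟨w', hw', rfl⟩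
      exact ⟨_, hw', by simp⟩
    · rintro _ ⟨w₁, hw₁, rfl⟩
      refine Set.Finite.of_finite_image (f := Subtype.val)
        ((h.finS.image (fun s => (w₁ : G) * s)).subset ?_) Subtype.val_injective.injOn
      rintro _ ⟨w₂, ⟨-, he⟩, rfl⟩
      have he : r w₂ = r w₁ := he
      refine ⟨(w₁ : G)⁻¹ * w₂, ?_, by simp⟩
      by_contra hS
      refine hcN (h.conj _ (X.mul_mem (X.inv_mem w₁.2) w₂.2) hS c hc ?_)
      have : c⁻¹ * ((w₁ : G)⁻¹ * w₂) * c = (w₁ * c)⁻¹ * (w₂ * c) := by group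
      rw [this, hrs, hrs, he]
      have : (r w₁ * s w₁)⁻¹ * (r w₁ * s w₂) = (s w₁)⁻¹ * s w₂ := by group
      rw [this]
      exact B.mul_mem (B.inv_mem (hs _)) (hs _)

theorem exists_seq_of_finite_classes {α : Type*} {W : Set α} (hW : W.Infinite)
    {R : α → α → Prop} (hR : ∀ w, {w' | R w w'}.Finite) :
    ∃ f : ℕ → α, (∀ n, f n ∈ W) ∧ ∀ m n, m < n → ¬ R (f m) (f n) := by
  refine exists_seq_of_forall_finset_exists (· ∈ W) (fun x y => ¬ R x y) fun s _ => ?_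
  obtain ⟨y, hy, hys⟩ := hW.exists_notMem_finite (s.finite_toSet.biUnion fun x _ => hR x)
  refine ⟨y, hy, fun x hx hxy => hys ?_⟩
  simp only [Set.mem_iUnion]
  exact ⟨x, hx, hxy⟩

theorem infinite_coe (h : DihedralFactorization A B X Y N S) : Infinite X :=
  Set.infinite_coe_iff.2 h.dih.quasi.inf

/-- Otherwise take five exceptional `w` with translates in distinct cosets of `N`. For a suitable
`u`, each of the five makes one of two translates bad, yet each family of five translates has at
most two bad members, and `5 > 2 + 2`. -/
theorem eventually_shift (h : DihedralFactorization A B X Y N S) {c : G} (hcN : c ∉ N)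
    (hc : c ∈ A) (a : X) :
    ∀ᶠ w : X in cofinite, (Bad A B X ((a * w : X) * c) ↔ Bad A B X (w * c)) := by
  obtain ⟨r, hrA, hr, hrf⟩ := h.exists_translates hcN hc
  have := h.infinite_coe
  by_contra hcon
  rw [eventually_cofinite] at hcon
  have hcl : ∀ w : X, {w' : X | (r w)⁻¹ * r w' ∈ N ∨ (r (a * w))⁻¹ * r (a * w') ∈ N}.Finite :=
    fun w => (hrf w).union (Set.Finite.preimage (f := fun w' => a * w')
      (mul_right_injective a).injOn (hrf (a * w)))
  obtain ⟨f, hfW, hfR⟩ := exists_seq_of_finite_classes hcon hcl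
  have ev1 : ∀ i j k : ℕ, i < j → j < k → ∀ᶠ u : X in cofinite, ¬ (Bad A B X (u * r (f i)) ∧
      Bad A B X (u * r (f j)) ∧ Bad A B X (u * r (f k))) := fun i j k hij hjk =>
    h.eventually_not_three (e := fun n => r (f n)) (fun n => hrA _)
      (fun hc => hfR i j hij (Or.inl hc)) (fun hc => hfR i k (hij.trans hjk) (Or.inl hc))
      (fun hc => hfR j k hjk (Or.inl hc))
  have ev2 : ∀ i j k : ℕ, i < j → j < k → ∀ᶠ u : X in cofinite,
      ¬ (Bad A B X ((u * a⁻¹ : X) * r (a * f i)) ∧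
      Bad A B X ((u * a⁻¹ : X) * r (a * f j)) ∧ Bad A B X ((u * a⁻¹ : X) * r (a * f k))) :=
    fun i j k hij hjk => ((mul_left_injective a⁻¹).tendsto_cofinite).eventually
      (h.eventually_not_three (e := fun n => r (a * f n)) (fun n => hrA _)
      (fun hc => hfR i j hij (Or.inr hc)) (fun hc => hfR i k (hij.trans hjk) (Or.inr hc))
      (fun hc => hfR j k hjk (Or.inr hc)))
  have hall : ∀ p : ℕ → ℕ → ℕ → X → Prop, (∀ i j k, i < j → j < k → ∀ᶠ u in cofinite, p i j k u) →
      ∀ᶠ u in cofinite, ∀ i < 5, ∀ j < 5, ∀ k < 5, i < j → j < k → p i j k u := by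
    intro p hp
    have hfin : (Set.Iio 5 : Set ℕ).Finite := Set.finite_Iio 5
    have := (eventually_all_finite hfin (l := cofinite) (p := fun i u =>
      ∀ j < 5, ∀ k < 5, i < j → j < k → p i j k u)).2 fun i _ =>
      (eventually_all_finite hfin).2 fun j _ => (eventually_all_finite hfin).2 fun k _ => by
        by_cases hij : i < j
        · by_cases hjk : j < k
          · filter_upwards [hp i j k hij hjk] with u hu _ _ using hu
          · simp [hjk]
        · simp [hij]
    exact this
  obtain ⟨u, hu1, hu2⟩ := ((hall _ ev1).and (hall _ ev2)).exists
  -- Both conditions compare with the badness of `u * f i * c`, and `f i` was chosen so that the two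
  -- reference parities differ.
  have hex : ∀ i, Bad A B X (u * r (f i)) ∨ Bad A B X ((u * a⁻¹ : X) * r (a * f i)) := by
    intro i
    have h1 := hfW i
    have h2 : u * a⁻¹ * (a * f i) = u * f i := by group
    rw [hr, hr, h2]
    simp only [Set.mem_ofPred_eq] at h1
    tauto
  have h0 := hex 0
  have h1 := hex 1
  have h2 := hex 2
  have h3 := hex 3
  have h4 := hex 4
  generalize hp : (fun i => Bad A B X (u * r (f i))) = p at *
  generalize hq : (fun i => Bad A B X ((u * a⁻¹ : X) * r (a * f i))) = q at *
  have hp' : ∀ i, Bad A B X (u * r (f i)) ↔ p i := fun i => by rw [← hp]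
  have hq' : ∀ i, Bad A B X ((u * a⁻¹ : X) * r (a * f i)) ↔ q i := fun i => by rw [← hq]
  simp only [hp', hq'] at hu1 hu2 h0 h1 h2 h3 h4
  have p1 := hu1 0 (by norm_num) 1 (by norm_num) 2 (by norm_num) (by norm_num) (by norm_num)
  have p2 := hu1 0 (by norm_num) 1 (by norm_num) 3 (by norm_num) (by norm_num) (by norm_num)
  have p3 := hu1 0 (by norm_num) 1 (by norm_num) 4 (by norm_num) (by norm_num) (by norm_num)
  have p4 := hu1 0 (by norm_num) 2 (by norm_num) 3 (by norm_num) (by norm_num) (by norm_num)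
  have p5 := hu1 0 (by norm_num) 2 (by norm_num) 4 (by norm_num) (by norm_num) (by norm_num)
  have p6 := hu1 0 (by norm_num) 3 (by norm_num) 4 (by norm_num) (by norm_num) (by norm_num)
  have p7 := hu1 1 (by norm_num) 2 (by norm_num) 3 (by norm_num) (by norm_num) (by norm_num)
  have p8 := hu1 1 (by norm_num) 2 (by norm_num) 4 (by norm_num) (by norm_num) (by norm_num)
  have p9 := hu1 1 (by norm_num) 3 (by norm_num) 4 (by norm_num) (by norm_num) (by norm_num)
  have p10 := hu1 2 (by norm_num) 3 (by norm_num) 4 (by norm_num) (by norm_num) (by norm_num)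
  have q1 := hu2 0 (by norm_num) 1 (by norm_num) 2 (by norm_num) (by norm_num) (by norm_num)
  have q2 := hu2 0 (by norm_num) 1 (by norm_num) 3 (by norm_num) (by norm_num) (by norm_num)
  have q3 := hu2 0 (by norm_num) 1 (by norm_num) 4 (by norm_num) (by norm_num) (by norm_num)
  have q4 := hu2 0 (by norm_num) 2 (by norm_num) 3 (by norm_num) (by norm_num) (by norm_num)
  have q5 := hu2 0 (by norm_num) 2 (by norm_num) 4 (by norm_num) (by norm_num) (by norm_num)
  have q6 := hu2 0 (by norm_num) 3 (by norm_num) 4 (by norm_num) (by norm_num) (by norm_num)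
  have q7 := hu2 1 (by norm_num) 2 (by norm_num) 3 (by norm_num) (by norm_num) (by norm_num)
  have q8 := hu2 1 (by norm_num) 2 (by norm_num) 4 (by norm_num) (by norm_num) (by norm_num)
  have q9 := hu2 1 (by norm_num) 3 (by norm_num) 4 (by norm_num) (by norm_num) (by norm_num)
  have q10 := hu2 2 (by norm_num) 3 (by norm_num) 4 (by norm_num) (by norm_num) (by norm_num)
  clear hp hq hp' hq' hu1 hu2 hex ev1 ev2 hall hcl hrf hr hrA hfW hfR
  grind

/-- Suppose infinitely many `w * c` are not bad, and choose three such `w` with translates in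
distinct cosets. By almost invariance under shifts, a bad `u * c` would, for almost all `u`, make
all three translates bad. -/
theorem eventually_const (h : DihedralFactorization A B X Y N S) {c : G} (hcN : c ∉ N)
    (hc : c ∈ A) : (∀ᶠ w : X in cofinite, Bad A B X (w * c)) ∨
      ∀ᶠ w : X in cofinite, ¬ Bad A B X (w * c) := by
  obtain ⟨r, hrA, hr, hrf⟩ := h.exists_translates hcN hc
  by_contra! hcon
  obtain ⟨h1, h2⟩ := hcon
  have h1 : {w : X | ¬ Bad A B X (w * c)}.Infinite :=
    frequently_cofinite_iff_infinite.1 h1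
  obtain ⟨f, hfW, hfR⟩ := exists_seq_of_finite_classes h1 hrf
  have hfW : ∀ n, ¬ Bad A B X (f n * c) := hfW
  apply h2
  filter_upwards [h.eventually_not_three (e := fun n => r (f n)) (fun n => hrA _)
    (hfR 0 1 (by norm_num)) (hfR 0 2 (by norm_num)) (hfR 1 2 (by norm_num)),
    h.eventually_shift hcN hc (f 0), h.eventually_shift hcN hc (f 1),
    h.eventually_shift hcN hc (f 2)] with u hu h0 h1 h2 hb
  have hcomm : ∀ n, f n * u = u * f n := fun n =>
    Subtype.ext (h.dih.quasi.comm _ (f n).2 _ u.2)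
  rw [hcomm] at h0 h1 h2
  apply hu
  simp only [hr, h0, h1, h2, hb, hfW, not_false_eq_true, and_self]

theorem finite_not_even (h : DihedralFactorization A B X Y N S) :
    {c | c ∈ A ∧ ¬ ∀ᶠ w : X in cofinite, ¬ Bad A B X (w * c)}.Finite := by
  have := h.infinite_coe
  have hodd : {c | c ∈ A ∧ ∀ᶠ w : X in cofinite, Bad A B X (w * c)}.Finite := by
    by_contra hinf
    obtain ⟨f, hf, hfR⟩ := exists_seq_of_finite_classes (R := fun c c' => c⁻¹ * c' ∈ N) hinf
      (fun c => (h.finN.image (fun n => c * n)).subset fun c' hc' => ⟨_, hc', by simp⟩)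
    obtain ⟨u, hu, h0, h1, h2⟩ := ((h.eventually_not_three (e := f) (fun n => (hf n).1)
      (hfR 0 1 (by norm_num)) (hfR 0 2 (by norm_num)) (hfR 1 2 (by norm_num))).and
      ((hf 0).2.and ((hf 1).2.and (hf 2).2))).exists
    exact hu ⟨h0, h1, h2⟩
  refine (h.finN.union hodd).subset ?_
  rintro c ⟨hc, hcE⟩
  by_cases hcN : c ∈ N
  · exact Or.inl hcN
  · exact Or.inr ⟨hc, (h.eventually_const hcN hc).resolve_right hcE⟩

/-- Assuming `w * c` almost always bad, a suitable `e` in `A` gives only finitely many `b` in `B`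
with `b * e` bad. But the `B`-parts of `x * y₀ * e⁻¹`, for `x` in `X`, are infinitely many such `b`.
-/
theorem not_odd (h : DihedralFactorization A B X Y N S) {c : G} (hc : c ∈ A) :
    ¬ ∀ᶠ w : X in cofinite, Bad A B X (w * c) := by
  intro hodd
  have := h.infinite_coe
  obtain ⟨y₀, hy₀, hyX₀⟩ := h.dih.ne
  have hfin : {e | e ∈ A ∧ ∃ n ∈ N, ∃ b ∈ B, y₀ * e = n * b}.Finite := by
    refine (h.finN.biUnion (t := fun n => {e | e ∈ A ∧ ∃ b ∈ B, y₀ * e = n * b})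
      fun n _ => Set.Subsingleton.finite ?_).subset ?_
    · rintro e ⟨he, b, hb, h1⟩ e' ⟨he', b', hb', h2⟩
      refine inv_mul_eq_one.1 (h.disj _ (A.mul_mem (A.inv_mem he) he') ?_)
      have : e⁻¹ * e' = b⁻¹ * b' := by
        calc e⁻¹ * e' = (y₀ * e)⁻¹ * (y₀ * e') := by group
          _ = _ := by rw [h1, h2]; group
      rw [this]
      exact B.mul_mem (B.inv_mem hb) hb'
    · rintro e ⟨he, n, hn, hb⟩
      simp only [Set.mem_iUnion]
      exact ⟨n, hn, he, hb⟩
  -- Avoiding finitely many elements of `A` makes both `e` and `c * e` almost always good, and keeps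
  -- the `A`-part of `y₀ * e` outside `N`.
  obtain ⟨e, he, heF⟩ := h.inf.exists_notMem_finite
    (hfin.union (h.finite_not_even.union (Set.Finite.preimage (f := fun e => c * e)
      (mul_right_injective c).injOn h.finite_not_even)))
  obtain ⟨e₀, he₀, b₀, hb₀, hy₀e⟩ := h.fac (y₀ * e)
  have he₀N : e₀ ∉ N := fun hN => heF (Or.inl ⟨he, e₀, hN, b₀, hb₀, hy₀e⟩)
  have heE : ∀ᶠ w : X in cofinite, ¬ Bad A B X (w * e) := by
    by_contra hE
    exact heF (Or.inr (Or.inl ⟨he, hE⟩))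
  have hceE : ∀ᶠ w : X in cofinite, ¬ Bad A B X (w * (c * e)) := by
    by_contra hE
    exact heF (Or.inr (Or.inr ⟨A.mul_mem hc he, hE⟩))
  have hshift : ∀ x : X, Bad A B X (x * y₀ * e) ↔ (Bad A B X (x * e₀) ↔ b₀ ∈ X) := by
    intro x
    rw [mul_assoc, hy₀e, ← mul_assoc, h.bad_mul_right _ hb₀]
  have hgood : ∀ᶠ x : X in cofinite, ¬ Bad A B X (x * y₀ * e) := by
    have hor : (∀ᶠ x : X in cofinite, Bad A B X (x * y₀ * e)) ∨
        ∀ᶠ x : X in cofinite, ¬ Bad A B X (x * y₀ * e) := by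
      rcases h.eventually_const he₀N he₀ with h1 | h1 <;> by_cases hb : b₀ ∈ X
      · left; filter_upwards [h1] with x hx; simp [hshift, hx, hb]
      · right; filter_upwards [h1] with x hx; simp [hshift, hx, hb]
      · right; filter_upwards [h1] with x hx; simp [hshift, hx, hb]
      · left; filter_upwards [h1] with x hx; simp [hshift, hx, hb]
    -- For almost all `x` the `B`-part `s x` of `x * c` lies outside `X`, while `x * c * e` is good;
    -- so `s x * e` is good with `s x ∈ X * y₀`. Injectivity of `s` contradicts almost constant
    -- badness on `X * y₀ * e`.
    refine hor.resolve_left fun hbad => ?_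
    have hf : ∀ x : X, ∃ a ∈ A, ∃ b ∈ B, x * c = a * b := fun x => h.fac _
    choose r hr s hs hrs using hf
    have hsinj : Function.Injective s := by
      intro x x' hxx
      have h1 : (x : G) * (x' : G)⁻¹ = r x * (r x')⁻¹ := by
        calc (x : G) * (x' : G)⁻¹ = (x * c) * (x' * c)⁻¹ := by group
          _ = _ := by rw [hrs, hrs, hxx]; group
      exact Subtype.ext (mul_inv_eq_one.1 (h.disj _ (h1 ▸ A.mul_mem (hr _) (A.inv_mem (hr _)))
        (B.mul_mem (h.dih.le x.2) (B.inv_mem (h.dih.le x'.2)))))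
    classical
    have hb' : {x | x ∈ X ∧ ¬ Bad A B X (x * y₀ * e)}.Finite := by
      refine ((eventually_cofinite.1 hbad).image Subtype.val).subset ?_
      rintro x ⟨hx, hxb⟩
      exact ⟨⟨x, hx⟩, hxb, rfl⟩
    have hpre : ∀ᶠ x : X in cofinite, s x * y₀⁻¹ ∉ {x | x ∈ X ∧ ¬ Bad A B X (x * y₀ * e)} := by
      rw [eventually_cofinite]
      simp only [not_not]
      exact Set.Finite.preimage (f := fun x => s x * y₀⁻¹)
        ((mul_left_injective y₀⁻¹).comp hsinj).injOn hb'
    obtain ⟨x, h1, h2, h3⟩ := (hpre.and (hodd.and hceE)).exists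
    rw [hrs, h.bad_iff (hr x) (hs x)] at h2
    apply h1
    refine ⟨h.dih.mul_mem _ (hs x) h2 _ (B.inv_mem hy₀) (inv_notMem hyX₀), ?_⟩
    rw [← mul_assoc, hrs, mul_assoc, h.bad_mul_left (hr x)] at h3
    simpa using h3
  have hBfin : {b | b ∈ B ∧ Bad A B X (b * e)}.Finite := by
    refine (((eventually_cofinite.1 heE).image Subtype.val).union
      ((eventually_cofinite.1 hgood).image fun x : X => (x : G) * y₀)).subset ?_
    rintro b ⟨hb, hbe⟩
    by_cases hbX : b ∈ X
    · exact Or.inl ⟨⟨b, hbX⟩, not_not.2 hbe, rfl⟩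
    · exact Or.inr ⟨⟨b * y₀⁻¹, h.dih.mul_mem _ hb hbX _ (B.inv_mem hy₀) (inv_notMem hyX₀)⟩,
        not_not.2 (by simpa using hbe), by simp⟩
  have hf : ∀ x : X, ∃ a ∈ A, ∃ b ∈ B, x * y₀ * e⁻¹ = a * b := fun x => h.fac _
  choose r hr s hs hrs using hf
  have hse : ∀ x : X, s x * e = (r x)⁻¹ * (x * y₀) := by
    intro x
    calc s x * e = (r x)⁻¹ * (r x * s x) * e := by group
      _ = _ := by rw [← hrs]; group
  have hxy : ∀ x : X, (x : G) * y₀ ∈ B := fun x => B.mul_mem (h.dih.le x.2) hy₀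
  refine Set.infinite_of_injective_forall_mem (f := s) (s := {b | b ∈ B ∧ Bad A B X (b * e)})
    ?_ (fun x => ⟨hs x, ?_⟩) hBfin
  · intro x x' hxx
    have h1 := hse x
    rw [hxx, hse x'] at h1
    exact Subtype.ext (mul_right_cancel (h.unique (A.inv_mem (hr _)) (A.inv_mem (hr _)) (hxy x)
      (hxy x') h1.symm).2)
  · rw [hse, h.bad_iff (A.inv_mem (hr x)) (hxy x)]
    exact mul_notMem_left x.2 hyX₀

/-- For `c ∉ N`, a single bad `x * c` would flip the parity, making the translate `r x` almost
always bad, against `not_odd`. Elements of `N` are written as products of two elements of `A`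
outside `N`. -/
theorem good (h : DihedralFactorization A B X Y N S) {x a : G} (hx : x ∈ X) (ha : a ∈ A) :
    Good A X (x * a) := by
  have key : ∀ c ∈ A, c ∉ N → ∀ x ∈ X, Good A X (x * c) := by
    intro c hc hcN x hx
    refine h.good_of_not_bad fun hbad => ?_
    obtain ⟨r, hrA, hr, -⟩ := h.exists_translates hcN hc
    have hev := (h.eventually_const hcN hc).resolve_left (h.not_odd hc)
    refine h.not_odd (hrA ⟨x, hx⟩) ?_
    filter_upwards [((mul_left_injective (⟨x, hx⟩ : X)).tendsto_cofinite).eventually hev] with u hu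
    rw [hr]
    simp only [hbad, not_true_eq_false, iff_false]
    exact hu
  by_cases haN : a ∈ N
  · obtain ⟨e, he, heN⟩ := h.inf.exists_notMem_finite h.finN
    obtain ⟨a₁, ha₁, x₁, hx₁, h1⟩ := key (a * e) (A.mul_mem ha he) (mul_notMem_left haN heN) x hx
    obtain ⟨a₂, ha₂, x₂, hx₂, h2⟩ := key e⁻¹ (A.inv_mem he) (inv_notMem heN) x₁ hx₁
    refine ⟨a₁ * a₂, A.mul_mem ha₁ ha₂, x₂, hx₂, ?_⟩
    calc x * a = x * (a * e) * e⁻¹ := by group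
      _ = _ := by rw [h1, mul_assoc, h2, mul_assoc]
  · exact key a ha haN x hx

end DihedralFactorization

/-! ### Normalizers of cyclic subgroups, maximal normal subgroups and commutator identities -/

section Helpers

variable {G : Type*} [Group G]

theorem normalizes_zpowers {v g u : G} (h : g * v * g⁻¹ ∈ Subgroup.zpowers v)
    (hu : u ∈ Subgroup.zpowers v) : g * u * g⁻¹ ∈ Subgroup.zpowers v := by
  obtain ⟨k, rfl⟩ := hu
  simp only
  rw [← conj_zpow]
  exact Subgroup.zpow_mem _ h k

/-- The normalizer of the finite cyclic subgroup generated by `v`. -/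
def zpowersNormalizer (v : G) (hv : IsOfFinOrder v) : Subgroup G where
  carrier := {g | g * v * g⁻¹ ∈ Subgroup.zpowers v}
  one_mem' := by simp
  mul_mem' := by
    intro a b ha hb
    have : a * b * v * (a * b)⁻¹ = a * (b * v * b⁻¹) * a⁻¹ := by group
    simp only [Set.mem_ofPred_eq]
    rw [this]
    exact normalizes_zpowers ha hb
  inv_mem' := by
    intro a ha
    have ha : a * v * a⁻¹ ∈ Subgroup.zpowers v := ha
    have h1 : v ∈ Subgroup.zpowers (a * v * a⁻¹) := by
      refine mem_zpowers_of_orderOf_le ha hv (le_of_eq ?_)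
      exact ((MulAut.conj a).orderOf_eq v).symm
    obtain ⟨k, hk⟩ := h1
    refine ⟨k, ?_⟩
    simp only at hk ⊢
    rw [conj_zpow] at hk
    nth_rewrite 2 [← hk]
    group

theorem mem_zpowersNormalizer {v g : G} (hv : IsOfFinOrder v) :
    g ∈ zpowersNormalizer v hv ↔ g * v * g⁻¹ ∈ Subgroup.zpowers v := Iff.rfl

/-- The commutator lies in `⟨a⟩ ∩ ⟨b⟩`. If it is nontrivial it generates `⟨a⟩`, of prime order, so
`a` is a power of `b`. -/
theorem commute_of_normalize {a b : G} (ha : (orderOf a).Prime)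
    (h1 : a * b * a⁻¹ ∈ Subgroup.zpowers b) (h2 : b * a * b⁻¹ ∈ Subgroup.zpowers a) :
    a * b = b * a := by
  have hcb : a * b * a⁻¹ * b⁻¹ ∈ Subgroup.zpowers b :=
    Subgroup.mul_mem _ h1 (Subgroup.inv_mem _ (Subgroup.mem_zpowers b))
  have hca : a * b * a⁻¹ * b⁻¹ ∈ Subgroup.zpowers a := by
    have : a * b * a⁻¹ * b⁻¹ = a * (b * a * b⁻¹)⁻¹ := by group
    rw [this]
    exact Subgroup.mul_mem _ (Subgroup.mem_zpowers a) (Subgroup.inv_mem _ h2)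
  by_cases hc : a * b * a⁻¹ * b⁻¹ = 1
  · rw [mul_inv_eq_one, mul_inv_eq_iff_eq_mul] at hc
    exact hc
  · have hfin : IsOfFinOrder a := orderOf_pos_iff.1 ha.pos
    have h3 : a ∈ Subgroup.zpowers (a * b * a⁻¹ * b⁻¹) := by
      refine mem_zpowers_of_orderOf_le hca hfin ?_
      rcases (Nat.dvd_prime ha).1 (orderOf_dvd_of_mem_zpowers hca) with h | h
      · exact absurd (orderOf_eq_one_iff.1 h) hc
      · exact h.ge
    obtain ⟨k, hk⟩ := (Subgroup.zpowers_le.2 hcb) h3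
    simp only at hk
    rw [← hk]
    exact ((Commute.refl b).zpow_left k).eq

theorem Quasi.mem_zpowers_of_orderOf_eq {X : Subgroup G} (h : Quasi X) {u v : G} (hu : u ∈ X)
    (hv : v ∈ X) (ho : orderOf u = orderOf v) : u ∈ Subgroup.zpowers v := by
  rcases h.chain u hu v hv with h1 | h1
  · exact h1
  · exact mem_zpowers_of_orderOf_le h1 (h.tors u hu) ho.le

theorem DihLike.conj_mem_zpowers {B X : Subgroup G} (h : DihLike B X) {b x : G} (hb : b ∈ B)
    (hx : x ∈ X) : b * x * b⁻¹ ∈ Subgroup.zpowers x := by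
  rcases h.act hb with h1 | h1
  · rw [h1 x hx]; exact Subgroup.mem_zpowers x
  · rw [h1 x hx]; exact Subgroup.inv_mem _ (Subgroup.mem_zpowers x)

/-- Every subgroup of `X` is normalized by `B`. -/
theorem DihLike.conj_mem_of_le {B X H : Subgroup G} (h : DihLike B X) (hH : H ≤ X) {b x : G}
    (hb : b ∈ B) (hx : x ∈ H) : b * x * b⁻¹ ∈ H :=
  (Subgroup.zpowers_le.2 hx) (h.conj_mem_zpowers hb (hH hx))

/-- Conditions on pairs of elements survive unions of chains. Two arguments are needed later to
encode a disjunction of two universal conditions. -/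
theorem exists_maximal_normal (R : G → G → Prop) (h1 : R 1 1) :
    ∃ N : Subgroup G, N.Normal ∧ (∀ n ∈ N, ∀ m ∈ N, R n m) ∧
      ∀ M : Subgroup G, M.Normal → N ≤ M → (∀ n ∈ M, ∀ m ∈ M, R n m) → M ≤ N := by
  obtain ⟨N, -, hN⟩ := zorn_le_nonempty₀
    {N : Subgroup G | N.Normal ∧ ∀ n ∈ N, ∀ m ∈ N, R n m} (fun c hc hchain N₀ hN₀ => by
      have hmem : ∀ {g}, g ∈ sSup c ↔ ∃ N ∈ c, g ∈ N :=
        Subgroup.mem_sSup_of_directedOn ⟨N₀, hN₀⟩ hchain.directedOn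
      refine ⟨sSup c, ⟨⟨fun n hn g => ?_⟩, fun n hn m hm => ?_⟩, fun N hN => le_sSup hN⟩
      · obtain ⟨N, hNc, hnN⟩ := hmem.1 hn
        exact hmem.2 ⟨N, hNc, (hc hNc).1.conj_mem n hnN g⟩
      · obtain ⟨N, hNc, hnN⟩ := hmem.1 hn
        obtain ⟨M, hMc, hmM⟩ := hmem.1 hm
        rcases hchain.total hNc hMc with h | h
        · exact (hc hMc).2 n (h hnN) m hmM
        · exact (hc hNc).2 n hnN m (h hmM)) ⊥
    ⟨inferInstance, fun n hn m hm => by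
      rw [Subgroup.mem_bot] at hn hm; rw [hn, hm]; exact h1⟩
  exact ⟨N, hN.prop.1, hN.prop.2, fun M hM hle hR => hN.le_of_ge ⟨hM, hR⟩ hle⟩

theorem conj_commutator_left {A : Subgroup G} (hA : ∀ x ∈ A, ∀ y ∈ A, x * y = y * x)
    {a c x c₁ x₁ : G} (ha : a ∈ A) (hc : c ∈ A) (hc₁ : c₁ ∈ A) (h1 : x * c⁻¹ = c₁ * x₁) :
    c * (a⁻¹ * x⁻¹ * a * x) * c⁻¹ = a⁻¹ * x₁⁻¹ * a * x₁ := by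
  calc c * (a⁻¹ * x⁻¹ * a * x) * c⁻¹ = (c * a⁻¹) * x⁻¹ * a * (x * c⁻¹) := by group
    _ = (a⁻¹ * c) * x⁻¹ * a * (x * c⁻¹) := by rw [hA c hc _ (A.inv_mem ha)]
    _ = a⁻¹ * (x * c⁻¹)⁻¹ * a * (x * c⁻¹) := by group
    _ = a⁻¹ * x₁⁻¹ * c₁⁻¹ * (a * c₁) * x₁ := by rw [h1]; group
    _ = a⁻¹ * x₁⁻¹ * c₁⁻¹ * (c₁ * a) * x₁ := by rw [hA a ha c₁ hc₁]
    _ = _ := by group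

theorem conj_commutator_right {X : Subgroup G} (hX : ∀ x ∈ X, ∀ y ∈ X, x * y = y * x)
    {a x w a₁ w₁ : G} (hx : x ∈ X) (hw : w ∈ X) (hw₁ : w₁ ∈ X) (h2 : w * a⁻¹ = a₁ * w₁) :
    w * (a⁻¹ * x⁻¹ * a * x) * w⁻¹ = a₁ * x⁻¹ * a₁⁻¹ * x := by
  calc w * (a⁻¹ * x⁻¹ * a * x) * w⁻¹ = w * a⁻¹ * x⁻¹ * a * (x * w⁻¹) := by group
    _ = w * a⁻¹ * x⁻¹ * a * (w⁻¹ * x) := by rw [hX x hx _ (X.inv_mem hw)]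
    _ = (w * a⁻¹) * x⁻¹ * (w * a⁻¹)⁻¹ * x := by group
    _ = a₁ * (w₁ * x⁻¹) * w₁⁻¹ * a₁⁻¹ * x := by rw [h2]; group
    _ = a₁ * (x⁻¹ * w₁) * w₁⁻¹ * a₁⁻¹ * x := by rw [hX w₁ hw₁ _ (X.inv_mem hx)]
    _ = _ := by group

theorem closure_comm {T : Set G} (hT : ∀ s ∈ T, ∀ t ∈ T, s * t = t * s) :
    ∀ s ∈ Subgroup.closure T, ∀ t ∈ Subgroup.closure T, s * t = t * s := by
  intro s hs t ht
  have := Subgroup.closure_le_centralizer_centralizer T hs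
  rw [Subgroup.mem_centralizer_iff] at this
  refine (this t ?_).symm
  rw [SetLike.mem_coe, Subgroup.mem_centralizer_iff]
  intro r hr
  induction ht using Subgroup.closure_induction with
  | mem q hq => exact hT r hr q hq
  | one => simp
  | mul x y _ _ hx hy => exact Commute.mul_right hx hy
  | inv x _ hx => exact Commute.inv_right hx

/-- Itô's commutator identity. -/
theorem commutator_commute {A X : Subgroup G} (hA : ∀ x ∈ A, ∀ y ∈ A, x * y = y * x)
    (hX : ∀ x ∈ X, ∀ y ∈ X, x * y = y * x) {a c x w a₁ c₁ x₁ w₁ : G} (ha : a ∈ A) (hc : c ∈ A)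
    (hx : x ∈ X) (hw : w ∈ X) (ha₁ : a₁ ∈ A) (hc₁ : c₁ ∈ A) (hx₁ : x₁ ∈ X) (hw₁ : w₁ ∈ X)
    (h1 : x * c⁻¹ = c₁ * x₁) (h2 : w * a⁻¹ = a₁ * w₁) :
    (a⁻¹ * x⁻¹ * a * x) * (c⁻¹ * w⁻¹ * c * w) = (c⁻¹ * w⁻¹ * c * w) * (a⁻¹ * x⁻¹ * a * x) := by
  have e1 : ∀ a ∈ A, c * (a⁻¹ * x⁻¹ * a * x) * c⁻¹ = a⁻¹ * x₁⁻¹ * a * x₁ :=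
    fun a ha => conj_commutator_left hA ha hc hc₁ h1
  have e2 : ∀ x ∈ X, w * (a⁻¹ * x⁻¹ * a * x) * w⁻¹ = a₁ * x⁻¹ * a₁⁻¹ * x :=
    fun x hx => conj_commutator_right hX hx hw hw₁ h2
  have e3 := e1 a₁⁻¹ (A.inv_mem ha₁)
  rw [inv_inv] at e3
  set g := a⁻¹ * x⁻¹ * a * x
  have e4 : w * (c * g * c⁻¹) * w⁻¹ = c * (w * g * w⁻¹) * c⁻¹ := by
    rw [e1 a ha, e2 x hx, e2 x₁ hx₁, e3]
  calc g * (c⁻¹ * w⁻¹ * c * w) = c⁻¹ * w⁻¹ * (w * (c * g * c⁻¹) * w⁻¹) * c * w := by group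
    _ = c⁻¹ * w⁻¹ * (c * (w * g * w⁻¹) * c⁻¹) * c * w := by rw [e4]
    _ = _ := by group

theorem mem_normalClosure_induction {S : Set G} {p : G → Prop}
    (gen : ∀ s ∈ S, ∀ g, p (g * s * g⁻¹)) (one : p 1)
    (mul : ∀ n ∈ Subgroup.normalClosure S, ∀ m ∈ Subgroup.normalClosure S, p n → p m → p (n * m))
    (inv : ∀ n ∈ Subgroup.normalClosure S, p n → p n⁻¹) {n : G}
    (hn : n ∈ Subgroup.normalClosure S) : p n := by
  induction hn using Subgroup.closure_induction with
  | mem x hx =>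
    obtain ⟨s, hs, hsx⟩ := Group.mem_conjugatesOfSet_iff.1 hx
    obtain ⟨g, rfl⟩ := isConj_iff.1 hsx
    exact gen s hs g
  | one => exact one
  | mul x y hx hy hpx hpy => exact mul x hx y hy hpx hpy
  | inv x hx hpx => exact inv x hx hpx

end Helpers

section

variable {G : Type*} [Group G] {A B X Y : Subgroup G}

/-- Outside the finite exceptional set, `v` is a power of `x`, and `x² ≠ 1`. Hence a conjugate of
`x` in `B` cannot be one of the involutions outside `X`. It lies in `X`, so the conjugating element
normalizes `⟨v⟩`, the only subgroup of `X` of its order. -/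
theorem DihedralFactorization.of_normalizer (fac : ∀ g : G, ∃ a ∈ A, ∃ b ∈ B, g = a * b)
    (disj : ∀ g ∈ A, g ∈ B → g = 1) (inf : (A : Set G).Infinite) (dih : DihLike B X)
    (sq : ∀ y ∈ B, y ∉ X → y * y = 1)
    (mulY : ∀ a ∈ A, a ∉ Y → ∀ a' ∈ A, a' ∉ Y → a * a' ∈ Y)
    (actY : ∀ a ∈ A, (∀ k ∈ Y, a * k * a⁻¹ = k) ∨ (∀ k ∈ Y, a * k * a⁻¹ = k⁻¹))
    {v : G} (hv : v ∈ X)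
    (hY : ∀ k ∈ Y, k * v * k⁻¹ ∈ Subgroup.zpowers v → k = 1)
    (hN : {a | a ∈ A ∧ a * v * a⁻¹ ∈ Subgroup.zpowers v}.Finite) :
    DihedralFactorization A B X Y (A ⊓ zpowersNormalizer v (dih.quasi.tors v hv))
      {x | x ∈ X ∧ (v ∉ Subgroup.zpowers x ∨ x * x = 1)} := by
  have hvf := dih.quasi.tors v hv
  refine ⟨fac, disj, inf, dih, sq, mulY, actY, hN.subset fun a ha => ⟨ha.1, ha.2⟩, ?_, ?_, ?_⟩
  · refine ((finite_zpowers.2 hvf).union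
      (dih.quasi.finite_torsion (n := 2) (by norm_num))).subset ?_
    rintro x ⟨hx, h | h⟩
    · exact Or.inl ((dih.quasi.chain x hx v hv).resolve_right h)
    · exact Or.inr ⟨hx, by rw [pow_two, h]⟩
  · intro x hx hxS k hk hc
    have hxS : v ∈ Subgroup.zpowers x := by
      by_contra hn
      exact hxS ⟨hx, Or.inl hn⟩
    apply hY k hk
    obtain ⟨i, rfl⟩ := hxS
    have hc : Commute k x := hc.symm
    simp only
    rw [(hc.zpow_right i).eq, mul_inv_cancel_right]
    exact Subgroup.mem_zpowers _
  · intro x hx hxS a ha hB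
    have hxS1 : v ∈ Subgroup.zpowers x := by
      by_contra hn
      exact hxS ⟨hx, Or.inl hn⟩
    have hxS2 : x * x ≠ 1 := fun hn => hxS ⟨hx, Or.inr hn⟩
    have hX : a⁻¹ * x * a ∈ X := by
      by_contra hn
      apply hxS2
      have h1 := sq _ hB hn
      calc x * x = a * ((a⁻¹ * x * a) * (a⁻¹ * x * a)) * a⁻¹ := by group
        _ = 1 := by rw [h1]; group
    have hvX : a⁻¹ * v * a ∈ X := by
      obtain ⟨i, rfl⟩ := hxS1
      have := conj_zpow (i := i) (a := a⁻¹) (b := x)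
      rw [inv_inv] at this
      simp only
      rw [← this]
      exact X.zpow_mem hX i
    have ho : orderOf (a⁻¹ * v * a) = orderOf v := by
      simpa using (MulAut.conj a⁻¹).orderOf_eq v
    have h1 : a⁻¹ ∈ zpowersNormalizer v hvf := by
      rw [mem_zpowersNormalizer, inv_inv]
      exact dih.quasi.mem_zpowers_of_orderOf_eq hvX hv ho
    exact ⟨ha, by simpa using Subgroup.inv_mem _ h1⟩

end

/-! ### The reduced situation with an abelian factor -/

/-- A factorization `G = AB` with `A` abelian in which the product of `A` with every nontrivial
normal subgroup of `G` meets `B \ X`. -/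
structure AbelianCore {G : Type*} [Group G] (A B X : Subgroup G) : Prop where
  fac : ∀ g : G, ∃ a ∈ A, ∃ b ∈ B, g = a * b
  comm : ∀ x ∈ A, ∀ y ∈ A, x * y = y * x
  dih : DihLike B X
  le : ∀ g ∈ A, g ∈ B → g ∈ X
  max : ∀ M : Subgroup G, M.Normal → M ≠ ⊥ → ∃ a ∈ A, ∃ m ∈ M, a * m ∈ B ∧ a * m ∉ X

theorem fac_swap {G : Type*} [Group G] {A B : Subgroup G}
    (h : ∀ g : G, ∃ a ∈ A, ∃ b ∈ B, g = a * b) (g : G) : ∃ b ∈ B, ∃ a ∈ A, g = b * a := by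
  obtain ⟨a, ha, b, hb, hg⟩ := h g⁻¹
  exact ⟨b⁻¹, B.inv_mem hb, a⁻¹, A.inv_mem ha, by rw [← mul_inv_rev, ← hg, inv_inv]⟩

/-- A normal subgroup containing an element of `B \ X` contains `B`. -/
theorem DihLike.le_of_mem_normal {G : Type*} [Group G] {B X : Subgroup G} (h : DihLike B X)
    {N : Subgroup G} (hN : N.Normal) {y : G} (hy : y ∈ B) (hyX : y ∉ X) (hyN : y ∈ N) : B ≤ N := by
  have hX : X ≤ N := by
    intro x hx
    obtain ⟨u, hu, rfl⟩ := h.quasi.exists_pow_eq (n := 2) (by norm_num) hx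
    have h1 := h.inv' hy hyX (X.inv_mem hu)
    rw [inv_inv] at h1
    have h2 : u ^ 2 = (u * y⁻¹ * u⁻¹) * y := by
      rw [pow_two]
      nth_rewrite 2 [← h1]
      group
    rw [h2]
    exact N.mul_mem (hN.conj_mem _ (N.inv_mem hyN) u) hyN
  intro b hb
  by_cases hbX : b ∈ X
  · exact hX hbX
  · have := hX (h.mul_mem b hb hbX _ (B.inv_mem hy) (inv_notMem hyX))
    exact (N.mul_mem_cancel_right (N.inv_mem hyN)).1 this

/-- A subgroup of `X` normalized by `A` is normal. -/
theorem DihLike.normal_of_conj_mem {G : Type*} [Group G] {A B X H : Subgroup G} (h : DihLike B X)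
    (fac : ∀ g : G, ∃ a ∈ A, ∃ b ∈ B, g = a * b) (hH : H ≤ X)
    (hA : ∀ a ∈ A, ∀ x ∈ H, a * x * a⁻¹ ∈ H) : H.Normal := by
  refine ⟨fun x hx g => ?_⟩
  obtain ⟨a, ha, b, hb, rfl⟩ := fac g
  have : a * b * x * (a * b)⁻¹ = a * (b * x * b⁻¹) * a⁻¹ := by group
  rw [this]
  exact hA a ha _ (h.conj_mem_of_le hH hb hx)

namespace AbelianCore

variable {G : Type*} [Group G] {A B X : Subgroup G}

/-- The intersection is normalized by `B` because it lies in `X`, and by `A` because `A` is abelian.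
As a nontrivial normal subgroup it would violate `max`. -/
theorem disj (h : AbelianCore A B X) : ∀ g ∈ A, g ∈ B → g = 1 := by
  have hle : A ⊓ B ≤ X := fun g hg => h.le g hg.1 hg.2
  have hn : (A ⊓ B).Normal := h.dih.normal_of_conj_mem h.fac hle fun a ha x hx => by
    rw [h.comm a ha x hx.1, mul_inv_cancel_right]; exact hx
  by_contra! hc
  obtain ⟨g, hgA, hgB, hg⟩ := hc
  obtain ⟨a, ha, m, hm, hB, hX⟩ := h.max _ hn fun hb => hg (by
    have : g ∈ A ⊓ B := ⟨hgA, hgB⟩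
    rwa [hb, Subgroup.mem_bot] at this)
  exact hX (h.le _ (A.mul_mem ha hm.1) hB)

theorem normal_le_eq_bot (h : AbelianCore A B X) {M : Subgroup G} (hM : M.Normal) (hle : M ≤ X) :
    M = ⊥ := by
  by_contra hne
  obtain ⟨a, ha, m, hm, hB, hX⟩ := h.max M hM hne
  have haB : a ∈ B := (B.mul_mem_cancel_right (h.dih.le (hle hm))).1 hB
  exact hX (X.mul_mem (h.le a ha haB) (hle hm))

/-- If a nontrivial element of `A` normalizes `⟨v⟩`, then `B` lies in a normal subgroup whose
elements act on `⟨v⟩` in the same way as their conjugates. -/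
theorem exists_normal_acting (h : AbelianCore A B X) {v : G} (hv : v ∈ X) {a : G} (ha : a ∈ A)
    (hav : a * v * a⁻¹ ∈ Subgroup.zpowers v) (ha1 : a ≠ 1) :
    ∃ N : Subgroup G, N.Normal ∧ B ≤ N ∧ ∀ n ∈ N, ∀ u ∈ Subgroup.zpowers v,
      n * u * n⁻¹ ∈ Subgroup.zpowers v ∧
      ∀ g : G, (g * n * g⁻¹) * u * (g * n * g⁻¹)⁻¹ = n * u * n⁻¹ := by
  have hvf := h.dih.quasi.tors v hv
  have hzX : Subgroup.zpowers v ≤ X := Subgroup.zpowers_le.2 hv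
  set S : Set G := {a | a ∈ A ∧ a * v * a⁻¹ ∈ Subgroup.zpowers v} with hS
  set N := Subgroup.normalClosure S with hNdef
  have hNn : N.Normal := Subgroup.normalClosure_normal
  -- conjugates of elements of `S` act on `⟨v⟩` in the same way
  have hconj : ∀ s ∈ S, ∀ g : G, ∀ u ∈ Subgroup.zpowers v,
      (g * s * g⁻¹) * u * (g * s * g⁻¹)⁻¹ = s * u * s⁻¹ := by
    rintro s ⟨hsA, hsv⟩ g u hu
    obtain ⟨b, hb, c, hc, rfl⟩ := fac_swap h.fac g
    have e1 : b * c * s * (b * c)⁻¹ = b * s * b⁻¹ := by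
      calc b * c * s * (b * c)⁻¹ = b * (c * s) * c⁻¹ * b⁻¹ := by group
        _ = b * (s * c) * c⁻¹ * b⁻¹ := by rw [h.comm c hc s hsA]
        _ = _ := by group
    have hsu : s * u * s⁻¹ ∈ X := hzX (normalizes_zpowers hsv hu)
    have hb' : (∀ x ∈ X, b⁻¹ * x * b = x ∧ b * x * b⁻¹ = x) ∨
        (∀ x ∈ X, b⁻¹ * x * b = x⁻¹ ∧ b * x * b⁻¹ = x⁻¹) := by
      by_cases hbX : b ∈ X
      · left
        intro x hx
        have hc : Commute b x := h.dih.quasi.comm b hbX x hx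
        exact ⟨by rw [mul_assoc, ← hc.eq, inv_mul_cancel_left],
          by rw [hc.eq, mul_inv_cancel_right]⟩
      · right
        exact fun x hx => ⟨h.dih.inv' hb hbX hx, h.dih.inv b hb hbX x hx⟩
    have e2 : b * c * s * (b * c)⁻¹ * u * (b * c * s * (b * c)⁻¹)⁻¹ =
        b * (s * (b⁻¹ * u * b) * s⁻¹) * b⁻¹ := by rw [e1]; group
    rw [e2]
    rcases hb' with hb' | hb'
    · rw [(hb' u (hzX hu)).1, (hb' _ hsu).2]
    · have e3 : s * u⁻¹ * s⁻¹ = (s * u * s⁻¹)⁻¹ := by group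
      rw [(hb' u (hzX hu)).1, e3, (hb' _ (X.inv_mem hsu)).2, inv_inv]
  have hact : ∀ n ∈ N, ∀ u ∈ Subgroup.zpowers v, n * u * n⁻¹ ∈ Subgroup.zpowers v ∧
      ∀ g : G, (g * n * g⁻¹) * u * (g * n * g⁻¹)⁻¹ = n * u * n⁻¹ := by
    intro n hn
    have hnorm : n ∈ zpowersNormalizer v hvf := by
      refine mem_normalClosure_induction (p := fun n => n ∈ zpowersNormalizer v hvf) ?_
        (Subgroup.one_mem _) (fun _ _ _ _ => Subgroup.mul_mem _) (fun _ _ => Subgroup.inv_mem _) hn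
      intro s hs g
      rw [mem_zpowersNormalizer, hconj s hs g v (Subgroup.mem_zpowers v)]
      exact hs.2
    refine (mem_normalClosure_induction (p := fun n => n ∈ zpowersNormalizer v hvf ∧
      ∀ u ∈ Subgroup.zpowers v, n * u * n⁻¹ ∈ Subgroup.zpowers v ∧
      ∀ g : G, (g * n * g⁻¹) * u * (g * n * g⁻¹)⁻¹ = n * u * n⁻¹) ?_ ?_ ?_ ?_ hn).2
    · intro s hs k
      refine ⟨?_, fun u hu => ⟨?_, fun g => ?_⟩⟩
      · rw [mem_zpowersNormalizer, hconj s hs k v (Subgroup.mem_zpowers v)]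
        exact hs.2
      · rw [hconj s hs k u hu]
        exact normalizes_zpowers hs.2 hu
      · have : g * (k * s * k⁻¹) * g⁻¹ = (g * k) * s * (g * k)⁻¹ := by group
        rw [this, hconj s hs _ u hu, hconj s hs _ u hu]
    · exact ⟨Subgroup.one_mem _, fun u hu => ⟨by simpa using hu, fun g => by simp⟩⟩
    · rintro n - m - ⟨hn1, hn2⟩ ⟨hm1, hm2⟩
      refine ⟨Subgroup.mul_mem _ hn1 hm1, fun u hu => ?_⟩
      obtain ⟨q1, q2⟩ := hm2 u hu
      obtain ⟨q3, q4⟩ := hn2 _ q1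
      have e1 : n * m * u * (n * m)⁻¹ = n * (m * u * m⁻¹) * n⁻¹ := by group
      rw [e1]
      refine ⟨q3, fun g => ?_⟩
      rw [← q4 g, ← q2 g]
      group
    · rintro n - ⟨hn1, hn2⟩
      have hn1' := Subgroup.inv_mem _ hn1
      refine ⟨hn1', fun u hu => ?_⟩
      have hu' := normalizes_zpowers ((mem_zpowersNormalizer hvf).1 hn1') hu
      refine ⟨hu', fun g => ?_⟩
      have q := (hn2 _ hu').2 g
      have e1 : n * (n⁻¹ * u * n⁻¹⁻¹) * n⁻¹ = u := by group
      rw [e1] at q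
      calc g * n⁻¹ * g⁻¹ * u * (g * n⁻¹ * g⁻¹)⁻¹ = (g * n * g⁻¹)⁻¹ * u * (g * n * g⁻¹) := by group
        _ = (g * n * g⁻¹)⁻¹ * (g * n * g⁻¹ * (n⁻¹ * u * n⁻¹⁻¹) * (g * n * g⁻¹)⁻¹) *
            (g * n * g⁻¹) := by rw [q]
        _ = _ := by group
  have hvz := Subgroup.mem_zpowers v
  have haN : a ∈ N := Subgroup.subset_normalClosure ⟨ha, hav⟩
  refine ⟨N, hNn, ?_, hact⟩
  · obtain ⟨c, hc, n, hn, hB, hX⟩ := h.max N hNn fun hb => ha1 (by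
      rwa [hb, Subgroup.mem_bot] at haN)
    have h1 : c * n ∈ zpowersNormalizer v hvf := h.dih.conj_mem_zpowers hB hv
    have h2 : n ∈ zpowersNormalizer v hvf := (hact n hn v hvz).1
    have h3 : c ∈ zpowersNormalizer v hvf := (Subgroup.mul_mem_cancel_right _ h2).1 h1
    have hcN : c ∈ N := Subgroup.subset_normalClosure ⟨hc, h3⟩
    exact h.dih.le_of_mem_normal hNn hB hX (N.mul_mem hcN hn)

/-- Otherwise the normal closure `M` of `w = v²` is abelian and centralized by that of `v`. An
element `y = c * m` of `B \ X` inverts every conjugate of `v`, which makes `y` conjugate to `c` in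
`A`. After factoring the conjugating element, a conjugate of `y` lies in `A ∩ B = 1`. -/
theorem eq_one_of_normalize (h : AbelianCore A B X) {v : G} (hv : v ∈ X)
    (hw : (orderOf (v * v)).Prime) {a : G} (ha : a ∈ A)
    (hav : a * v * a⁻¹ ∈ Subgroup.zpowers v) : a = 1 := by
  by_contra ha1
  obtain ⟨N, hNn, hBN, hact⟩ := h.exists_normal_acting hv ha hav ha1
  have hvz := Subgroup.mem_zpowers v
  have hvN : v ∈ N := hBN (h.dih.le hv)
  have hinv : ∀ y ∈ B, y ∉ X → ∀ g : G, y * (g * v * g⁻¹) * y⁻¹ = (g * v * g⁻¹)⁻¹ := by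
    intro y hy hyX g
    have h1 := (hact y (hBN hy) v hvz).2 g⁻¹
    rw [h.dih.inv y hy hyX v hv] at h1
    calc y * (g * v * g⁻¹) * y⁻¹ =
        g * ((g⁻¹ * y * g⁻¹⁻¹) * v * (g⁻¹ * y * g⁻¹⁻¹)⁻¹) * g⁻¹ := by group
      _ = _ := by rw [h1]; group
  set w := v * v with hwdef
  have hw1 : w ≠ 1 := fun hc => hw.ne_one (orderOf_eq_one_iff.2 hc)
  have hwv : ∀ g : G, g * w * g⁻¹ * v = v * (g * w * g⁻¹) := by
    intro g
    have ho : orderOf (g * w * g⁻¹) = orderOf w := by simpa using (MulAut.conj g).orderOf_eq w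
    refine commute_of_normalize (ho ▸ hw) ?_ ?_
    · exact (hact _ (hNn.conj_mem _ (N.mul_mem hvN hvN) g) v hvz).1
    · have h1 := (hact _ (hNn.conj_mem _ hvN g⁻¹) v hvz).1
      obtain ⟨k, hk⟩ := h1
      simp only [inv_inv] at hk
      refine ⟨k, ?_⟩
      simp only
      have e1 : (g * w * g⁻¹) ^ k = g * w ^ k * g⁻¹ := conj_zpow
      have e2 : w ^ k = v ^ k * v ^ k := by rw [hwdef, (Commute.refl v).mul_zpow]
      rw [e1, e2, hk, hwdef]
      group
  set M := Subgroup.normalClosure {w} with hM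
  have hMn : M.Normal := Subgroup.normalClosure_normal
  set K := Subgroup.normalClosure {v} with hK
  have hKn : K.Normal := Subgroup.normalClosure_normal
  have hvK : v ∈ K := Subgroup.subset_normalClosure (Set.mem_singleton v)
  have hMK : M ≤ K := Subgroup.normalClosure_le_normal (by simpa using K.mul_mem hvK hvK)
  have hcomm : ∀ m ∈ M, ∀ k ∈ K, m * k = k * m := by
    have h1 : ∀ k ∈ K, ∀ g : G, g * w * g⁻¹ * k = k * (g * w * g⁻¹) := by
      intro k hk
      refine mem_normalClosure_induction
        (p := fun k => ∀ g : G, Commute (g * w * g⁻¹) k) ?_ ?_ ?_ ?_ hk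
      · intro s hs g' g
        rw [Set.mem_singleton_iff.1 hs]
        have h2 := hwv (g'⁻¹ * g)
        rw [commute_iff_eq]
        calc g * w * g⁻¹ * (g' * v * g'⁻¹) =
            g' * ((g'⁻¹ * g) * w * (g'⁻¹ * g)⁻¹ * v) * g'⁻¹ := by group
          _ = _ := by rw [h2]; group
      · exact fun g => Commute.one_right _
      · exact fun n _ m _ hn hm g => (hn g).mul_right (hm g)
      · exact fun n _ hn g => (hn g).inv_right
    intro m hm k hk
    refine mem_normalClosure_induction (p := fun m => Commute m k) ?_ (Commute.one_left _)
      (fun n _ m _ hn hm => hn.mul_left hm) (fun n _ hn => hn.inv_left) hm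
    intro s hs g
    rw [Set.mem_singleton_iff.1 hs]
    exact h1 k hk g
  obtain ⟨c, hc, m, hm, hB, hX⟩ := h.max M hMn fun hb => hw1 (by
    have : w ∈ M := Subgroup.subset_normalClosure rfl
    rwa [hb, Subgroup.mem_bot] at this)
  set y := c * m with hy
  -- For `k` a conjugate of `v`, inversion by `y` gives `k⁻¹yk = yk²`, and `k²` is a conjugate of
  -- `w`. This is why a square root `v` of `w` is used.
  have hconjy : ∀ m ∈ M, ∃ k ∈ K, k⁻¹ * y * k = y * m := by
    intro m hm
    refine mem_normalClosure_induction (p := fun m => ∃ k ∈ K, k⁻¹ * y * k = y * m) ?_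
      ⟨1, K.one_mem, by simp⟩ ?_ ?_ hm
    · intro s hs g
      rw [Set.mem_singleton_iff.1 hs]
      have hk : g * v * g⁻¹ ∈ K := hKn.conj_mem v hvK g
      refine ⟨_, hk, ?_⟩
      rw [← hinv y hB hX g, hwdef]
      group
    · rintro n hn m hm ⟨k, hk, e⟩ ⟨l, hl, e'⟩
      refine ⟨k * l, K.mul_mem hk hl, ?_⟩
      calc (k * l)⁻¹ * y * (k * l) = l⁻¹ * (k⁻¹ * y * k) * l := by group
        _ = l⁻¹ * y * (n * l) := by rw [e]; group
        _ = (l⁻¹ * y * l) * n := by rw [hcomm n hn l hl]; group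
        _ = y * (m * n) := by rw [e', mul_assoc]
        _ = y * (n * m) := by rw [hcomm n hn m (hMK hm)]
    · rintro n hn ⟨k, hk, e⟩
      refine ⟨k⁻¹, K.inv_mem hk, ?_⟩
      rw [inv_inv]
      have : k * y * k⁻¹ * n = y := by
        calc k * y * k⁻¹ * n = k * y * (n⁻¹ * k)⁻¹ := by group
          _ = k * y * (k * n⁻¹)⁻¹ := by rw [hcomm _ (M.inv_mem hn) k hk]
          _ = k * (y * n) * k⁻¹ := by group
          _ = y := by rw [← e]; group
      exact eq_mul_inv_of_mul_eq this
  obtain ⟨k, hk, e⟩ := hconjy m⁻¹ (M.inv_mem hm)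
  obtain ⟨b, hb, a', ha', rfl⟩ := fac_swap h.fac k
  have e1 : y * m⁻¹ = c := by rw [hy]; group
  rw [e1] at e
  have e2 : a' * c * a'⁻¹ = b⁻¹ * y * b := by rw [← e]; group
  have e3 := h.disj (b⁻¹ * y * b) (e2 ▸ A.mul_mem (A.mul_mem ha' hc) (A.inv_mem ha'))
    (B.mul_mem (B.mul_mem (B.inv_mem hb) hB) hb)
  apply hX
  have e4 : y = b * (b⁻¹ * y * b) * b⁻¹ := by group
  rw [e4, e3]
  simp

end AbelianCore

theorem ne_one_of_orderOf_prime {G : Type*} [Group G] {w : G} (hw : (orderOf w).Prime) : w ≠ 1 :=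
  fun hc => hw.ne_one (orderOf_eq_one_iff.2 hc)

namespace AbelianCore

variable {G : Type*} [Group G] {A B X : Subgroup G}

theorem not_normal (h : AbelianCore A B X) : ¬ X.Normal := by
  intro hn
  refine h.dih.quasi.inf ?_
  rw [h.normal_le_eq_bot hn le_rfl]
  simp

/-- If `A` is finite, then `X` has finite index, so its normal core is an infinite subgroup of `X`,
hence equal to `X`, which would be normal. -/
theorem infinite (h : AbelianCore A B X) : (A : Set G).Infinite := by
  intro hfin
  apply h.not_normal
  have hA : Finite A := hfin
  obtain ⟨y, hy, hyX⟩ := h.dih.ne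
  have hq : Finite (G ⧸ X) := by
    refine Finite.of_surjective
      (fun p : A × Bool => ((p.1 * (if p.2 then y else 1) : G) : G ⧸ X)) ?_
    intro q
    obtain ⟨g, rfl⟩ := QuotientGroup.mk_surjective q
    obtain ⟨a, ha, b, hb, rfl⟩ := h.fac g
    by_cases hbX : b ∈ X
    · exact ⟨(⟨a, ha⟩, false), by simpa [QuotientGroup.eq] using hbX⟩
    · refine ⟨(⟨a, ha⟩, true), ?_⟩
      simp only [if_true, QuotientGroup.eq]
      have : (a * y)⁻¹ * (a * b) = y⁻¹ * b := by group
      rw [this]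
      exact h.dih.mul_mem _ (B.inv_mem hy) (inv_notMem hyX) _ hb hbX
  have hfi : X.FiniteIndex := Subgroup.finiteIndex_of_finite_quotient
  have hXi : Infinite X := Set.infinite_coe_iff.2 h.dih.quasi.inf
  have hinf : Infinite G := Infinite.of_injective (Subtype.val : X → G) Subtype.val_injective
  have hcore : X.normalCore = X := by
    refine h.dih.quasi.eq_of_infinite X.normalCore_le fun hf => ?_
    have : Finite X.normalCore := hf
    have hi : X.normalCore.index ≠ 0 := Subgroup.FiniteIndex.index_ne_zero
    have := Subgroup.card_mul_index X.normalCore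
    rw [Nat.card_eq_zero_of_infinite (α := G)] at this
    rcases Nat.mul_eq_zero.1 this with h1 | h1
    · exact Nat.card_pos.ne' h1
    · exact hi h1
  rw [← hcore]
  exact X.normalCore_normal

theorem good_of_dihedral (h : AbelianCore A B X) (hsq : ∀ y ∈ B, y ∉ X → y * y = 1) {x a : G}
    (hx : x ∈ X) (ha : a ∈ A) : Good A X (x * a) := by
  obtain ⟨w, hw, hwp, -⟩ := h.dih.quasi.exists_minimal
  obtain ⟨v, hv, hvw⟩ := h.dih.quasi.exists_pow_eq (n := 2) (by norm_num) hw
  rw [← hvw, pow_two] at hwp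
  refine (DihedralFactorization.of_normalizer (Y := A) h.fac h.disj h.infinite h.dih hsq
    (fun a ha haA => absurd ha haA) (fun a ha => Or.inl fun k hk => ?_) hv
    (fun k hk hkv => h.eq_one_of_normalize hv hwp hk hkv) ?_).good hx ha
  · rw [h.comm a ha k hk, mul_inv_cancel_right]
  · refine (Set.finite_singleton (1 : G)).subset ?_
    rintro k ⟨hk, hkv⟩
    exact h.eq_one_of_normalize hv hwp hk hkv

section Quaternion

theorem central (h : AbelianCore A B X) {z : G} (hzX : z ∈ X) (hz2 : z * z = 1) {b : G}
    (hb : b ∈ B) : b * z = z * b := by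
  rcases h.dih.act hb with h1 | h1
  · exact mul_inv_eq_iff_eq_mul.1 (h1 z hzX)
  · have h2 := h1 z hzX
    rw [inv_eq_of_mul_eq_one_left hz2] at h2
    exact mul_inv_eq_iff_eq_mul.1 h2

/-- If not, the normal closure of the centralizer of `z` in `A` contains `B` and centralizes the
normal closure `M` of `z`, a group of exponent two. Writing an element of `B \ X` as `c * m` then
gives `c² = z`, so `z ∈ A ∩ B`. -/
theorem eq_one_of_commute (h : AbelianCore A B X) {z : G} (hz : z ≠ 1)
    (hsq : ∀ y ∈ B, y ∉ X → y * y = z) (hzX : z ∈ X) (hz2 : z * z = 1) {a : G} (ha : a ∈ A)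
    (haz : a * z = z * a) : a = 1 := by
  by_contra ha1
  set S : Set G := {a | a ∈ A ∧ a * z = z * a} with hS
  set N := Subgroup.normalClosure S with hNdef
  have hNn : N.Normal := Subgroup.normalClosure_normal
  have hNz : ∀ n ∈ N, Commute n z := by
    intro n hn
    refine mem_normalClosure_induction (p := fun n => Commute n z) ?_ (Commute.one_left z)
      (fun n _ m _ hn hm => hn.mul_left hm) (fun n _ hn => hn.inv_left) hn
    rintro s ⟨hsA, hsz⟩ g
    obtain ⟨b, hb, c, hc, rfl⟩ := fac_swap h.fac g
    have e1 : b * c * s * (b * c)⁻¹ = b * s * b⁻¹ := by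
      calc b * c * s * (b * c)⁻¹ = b * (c * s) * c⁻¹ * b⁻¹ := by group
        _ = b * (s * c) * c⁻¹ * b⁻¹ := by rw [h.comm c hc s hsA]
        _ = _ := by group
    rw [e1]
    have hbz : Commute b z := h.central hzX hz2 hb
    exact (hbz.mul_left hsz).mul_left hbz.inv_left
  have hBN : B ≤ N := by
    have haN : a ∈ N := Subgroup.subset_normalClosure ⟨ha, haz⟩
    obtain ⟨c, hc, n, hn, hB, hX⟩ := h.max N hNn fun hb => ha1 (by
      rwa [hb, Subgroup.mem_bot] at haN)
    have h1 : Commute (c * n) z := h.central hzX hz2 hB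
    have h3 : Commute c z := by
      have := h1.mul_left (hNz n hn).inv_left
      rwa [mul_inv_cancel_right] at this
    exact h.dih.le_of_mem_normal hNn hB hX (N.mul_mem (Subgroup.subset_normalClosure ⟨hc, h3⟩) hn)
  set M := Subgroup.normalClosure {z} with hM
  have hMn : M.Normal := Subgroup.normalClosure_normal
  have hzM : z ∈ M := Subgroup.subset_normalClosure (Set.mem_singleton z)
  have hMN : M ≤ N := Subgroup.normalClosure_le_normal (by simpa using hBN (h.dih.le hzX))
  have hMc : ∀ m ∈ M, ∀ n ∈ N, Commute m n := by
    intro m hm n hn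
    refine mem_normalClosure_induction (p := fun m => Commute m n) ?_ (Commute.one_left _)
      (fun n _ m _ hn hm => hn.mul_left hm) (fun n _ hn => hn.inv_left) hm
    intro s hs g
    rw [Set.mem_singleton_iff.1 hs, commute_iff_eq]
    have h2 := (hNz _ (hNn.conj_mem n hn g⁻¹)).eq
    calc g * z * g⁻¹ * n = g * (z * (g⁻¹ * n * g⁻¹⁻¹)) * g⁻¹ := by group
      _ = _ := by rw [← h2]; group
  have hM2 : ∀ m ∈ M, m * m = 1 := by
    intro m hm
    refine mem_normalClosure_induction (p := fun m => m * m = 1) ?_ (by simp) ?_ ?_ hm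
    · intro s hs g
      rw [Set.mem_singleton_iff.1 hs]
      calc g * z * g⁻¹ * (g * z * g⁻¹) = g * (z * z) * g⁻¹ := by group
        _ = 1 := by rw [hz2]; group
    · intro n hn m hm hn2 hm2
      rw [(hMc m hm n (hMN hn)).mul_mul_mul_comm, hn2, hm2, one_mul]
    · intro n _ hn2
      rw [← mul_inv_rev, hn2, inv_one]
  obtain ⟨c, hc, m, hm, hB, hX⟩ := h.max M hMn fun hb => hz (by
    rwa [hb, Subgroup.mem_bot] at hzM)
  have h1 : c * c = z := by
    have e1 : c = (c * m) * m⁻¹ := by group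
    have e2 : Commute m⁻¹ (c * m) := hMc _ (M.inv_mem hm) _ (hBN hB)
    rw [e1, e2.mul_mul_mul_comm, hsq _ hB hX, hM2 _ (M.inv_mem hm), mul_one]
  exact hz (h.disj z (h1 ▸ A.mul_mem hc hc) (h.dih.le hzX))

/-- If the `B`-part `y` of `z * c` lay outside `X`, then `y * z = y⁻¹`, and the resulting relations
put a conjugate of `y` by an element of `B` into `A ∩ B = 1`. -/
theorem good_involution (h : AbelianCore A B X) {z : G}
    (hsq : ∀ y ∈ B, y ∉ X → y * y = z) (hz2 : z * z = 1) {c : G}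
    (hc : c ∈ A) : ∃ c' ∈ A, ∃ x ∈ X, z * c = c' * x := by
  obtain ⟨c', hc', y, hy, e⟩ := h.fac (z * c)
  by_cases hyX : y ∈ X
  · exact ⟨c', hc', y, hyX, e⟩
  exfalso
  obtain ⟨d, hd, b, hb, e'⟩ := h.fac (y⁻¹ * c)
  have hyz : y * z = y⁻¹ := by
    apply eq_inv_of_mul_eq_one_left
    have : y * z * y = y * y * (y * y) := by rw [← hsq y hy hyX]; group
    rw [this, hsq y hy hyX, hz2]
  have e1 : c' = z * c * y⁻¹ := by rw [e]; group
  have e2 : z * c' = c * y⁻¹ := by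
    rw [e1, ← mul_assoc, ← mul_assoc, hz2, one_mul]
  have e3 : c' * y * c' = c * y⁻¹ * c := by
    rw [← e, mul_assoc, h.comm c hc c' hc', ← mul_assoc, e2]
  have e4 : y * c' = y⁻¹ * c * y⁻¹ := by
    rw [e1, ← mul_assoc, ← mul_assoc, hyz]
  have e5 : c' = c * (d * b) * y * (d * b)⁻¹ := by
    rw [← e']
    have : c * (y⁻¹ * c) * y * (y⁻¹ * c)⁻¹ = (c * y⁻¹ * c) * (y * (c⁻¹ * y)) := by group
    rw [this, ← e3]
    have : c' * y * c' * (y * (c⁻¹ * y)) = c' * (y * c') * (y * (c⁻¹ * y)) := by group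
    rw [this, e4]
    group
  have e6 : (c * d)⁻¹ * c' * d = b * y * b⁻¹ := by
    nth_rewrite 1 [e5]; group
  have e7 := h.disj (b * y * b⁻¹) (e6 ▸ A.mul_mem (A.mul_mem (A.inv_mem (A.mul_mem hc hd)) hc') hd)
    (B.mul_mem (B.mul_mem hb hy) (B.inv_mem hb))
  apply hyX
  have e8 : y = b⁻¹ * (b * y * b⁻¹) * b := by group
  rw [e8, e7]
  simp

/-- The commutators of `A` with `z` generate an abelian normal subgroup `N` by Itô's argument, for
which `good_involution` suffices, and `z` inverts `N`. It turns out that `N` is finite, so `X` and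
in particular `z` centralizes it. Then `N` has exponent two, hence is trivial, although `X` is not
normal. -/
theorem false_of_quaternion (h : AbelianCore A B X) {z : G} (hz : z ≠ 1)
    (hsq : ∀ y ∈ B, y ∉ X → y * y = z) (hzX : z ∈ X) (hz2 : z * z = 1) : False := by
  have hzi : z⁻¹ = z := inv_eq_of_mul_eq_one_left hz2
  have hCA : ∀ a ∈ A, a * z = z * a → a = 1 := fun a ha => h.eq_one_of_commute hz hsq hzX hz2 ha
  have hcB : ∀ b ∈ B, b * z = z * b := fun b => h.central hzX hz2
  have hCG : ∀ g, g * z = z * g → g ∈ B := by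
    intro g hg
    obtain ⟨a, ha, b, hb, rfl⟩ := h.fac g
    have hg : Commute (a * b) z := hg
    have hb' : Commute b z := hcB b hb
    have := hg.mul_left hb'.inv_left
    rw [mul_inv_cancel_right] at this
    rw [hCA a ha this, one_mul]
    exact hb
  set T : Set G := {t | ∃ a ∈ A, t = a⁻¹ * z⁻¹ * a * z} with hT
  have hTg : ∀ g : G, g⁻¹ * z⁻¹ * g * z ∈ T := by
    intro g
    obtain ⟨b, hb, a, ha, rfl⟩ := fac_swap h.fac g
    refine ⟨a, ha, ?_⟩
    have : b⁻¹ * z⁻¹ * b = z⁻¹ := by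
      have : Commute b z⁻¹ := Commute.inv_right (hcB b hb)
      rw [mul_assoc, ← this.eq, inv_mul_cancel_left]
    calc (b * a)⁻¹ * z⁻¹ * (b * a) * z = a⁻¹ * (b⁻¹ * z⁻¹ * b) * a * z := by group
      _ = _ := by rw [this]
  set N := Subgroup.closure T with hN
  have hTN : ∀ g : G, g⁻¹ * z⁻¹ * g * z ∈ N := fun g => Subgroup.subset_closure (hTg g)
  have hNn : N.Normal := by
    refine ⟨fun n hn g => ?_⟩
    induction hn using Subgroup.closure_induction with
    | mem t ht =>
      obtain ⟨a, ha, rfl⟩ := ht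
      have : g * (a⁻¹ * z⁻¹ * a * z) * g⁻¹ = ((a * g⁻¹)⁻¹ * z⁻¹ * (a * g⁻¹) * z) *
        (g⁻¹⁻¹ * z⁻¹ * g⁻¹ * z)⁻¹ := by group
      rw [this]
      exact N.mul_mem (hTN _) (N.inv_mem (hTN _))
    | one => simp
    | mul x y _ _ hx hy =>
      have : g * (x * y) * g⁻¹ = (g * x * g⁻¹) * (g * y * g⁻¹) := by group
      rw [this]; exact N.mul_mem hx hy
    | inv x _ hx =>
      have : g * x⁻¹ * g⁻¹ = (g * x * g⁻¹)⁻¹ := by group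
      rw [this]; exact N.inv_mem hx
  have hTc : ∀ s ∈ T, ∀ t ∈ T, s * t = t * s := by
    rintro _ ⟨a, ha, rfl⟩ _ ⟨c, hc, rfl⟩
    obtain ⟨c₁, hc₁, x₁, hx₁, e1⟩ := h.good_involution hsq hz2 (A.inv_mem hc)
    obtain ⟨a₁, ha₁, w₁, hw₁, e2⟩ := h.good_involution hsq hz2 (A.inv_mem ha)
    exact commutator_commute h.comm h.dih.quasi.comm ha hc hzX hzX ha₁ hc₁ hx₁ hw₁ e1 e2
  have hNc : ∀ s ∈ N, ∀ t ∈ N, Commute s t := closure_comm hTc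
  have hinv : ∀ n ∈ N, z * n * z⁻¹ = n⁻¹ := by
    intro n hn
    induction hn using Subgroup.closure_induction with
    | mem t ht =>
      obtain ⟨a, ha, rfl⟩ := ht
      rw [hzi]
      calc z * (a⁻¹ * z * a * z) * z = z * a⁻¹ * z * a * (z * z) := by group
        _ = z⁻¹ * a⁻¹ * z⁻¹ * a := by rw [hz2, hzi, mul_one]
        _ = (a⁻¹ * z * a * z)⁻¹ := by group
    | one => simp
    | mul x y hx hy ihx ihy =>
      have : z * (x * y) * z⁻¹ = (z * x * z⁻¹) * (z * y * z⁻¹) := by group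
      rw [this, ihx, ihy, ← mul_inv_rev, (hNc x hx y hy).eq]
    | inv x _ hx =>
      have : z * x⁻¹ * z⁻¹ = (z * x * z⁻¹)⁻¹ := by group
      rw [this, hx]
  have hNz : ∀ n ∈ N, n * z = z * n → n * n = 1 := by
    intro n hn hc
    have h1 := hinv n hn
    rw [← hc, mul_inv_cancel_right] at h1
    nth_rewrite 1 [h1]
    simp
  have hNbot : N ≠ ⊥ := by
    intro hb
    apply h.not_normal
    refine ⟨fun x hx g => ?_⟩
    obtain ⟨a, ha, b, hbB, rfl⟩ := h.fac g
    have h1 := hTN a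
    rw [hb, Subgroup.mem_bot] at h1
    have h2 : a * z = z * a := by
      calc a * z = z * a * (a⁻¹ * z⁻¹ * a * z) := by group
        _ = z * a := by rw [h1, mul_one]
    rw [hCA a ha h2, one_mul]
    exact h.dih.conj_mem hbB hx
  obtain ⟨c, hc, m, hm, hB, hX⟩ := h.max N hNn hNbot
  have hzN : z ∉ N := by
    intro hzN
    have h1 : Commute (c * m) z := hcB _ hB
    have h2 : Commute m z := hNc m hm z hzN
    have h3 := h1.mul_left h2.inv_left
    rw [mul_inv_cancel_right] at h3
    have h4 := hCA c hc h3
    have h5 := hsq _ hB hX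
    rw [h4, one_mul, hNz m hm h2] at h5
    exact hz h5.symm
  have hNB : ∀ n ∈ N, n ∈ B → n = 1 := by
    intro n hn hnB
    by_contra hn1
    have h2 := hNz n hn (hcB n hnB)
    by_cases hnX : n ∈ X
    · have ho : ∀ t : G, t ≠ 1 → t * t = 1 → orderOf t = 2 := fun t ht1 ht2 =>
        orderOf_eq_prime (by rw [pow_two, ht2]) ht1
      have := h.dih.quasi.mem_zpowers_of_orderOf_eq hzX hnX
        ((ho z hz hz2).trans (ho n hn1 h2).symm)
      exact hzN ((Subgroup.zpowers_le.2 hn) this)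
    · exact hz ((hsq n hnB hnX).symm.trans h2)
  have hN2 : ∀ n ∈ N, n * n = 1 → n = 1 := by
    intro n hn hn2
    refine hNB n hn (hCG n ?_)
    have := hinv n hn
    rw [inv_eq_of_mul_eq_one_left hn2, mul_inv_eq_iff_eq_mul] at this
    exact this.symm
  set y := c * m with hy
  -- The `B`-part of `n` commutes with `y` modulo `N`, since `A` is abelian and `y ≡ c`, and then
  -- exactly because `N ∩ B = 1`. The centralizer of `y` in `B` is finite, since `y` inverts `X`;
  -- and the `B`-part determines `n`.
  have hfinN : (N : Set G).Finite := by
    have hex : ∀ n : G, ∃ b, n ∈ N → b ∈ B ∧ ∃ a ∈ A, n = a * b := by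
      intro n
      obtain ⟨a, ha, b, hb, e⟩ := h.fac n
      exact ⟨b, fun _ => ⟨hb, a, ha, e⟩⟩
    choose β hβ using hex
    have hF := h.dih.quasi.finite_torsion (n := 2) (by norm_num)
    refine Set.Finite.of_injOn (f := β) (t := {x | x ∈ X ∧ x ^ 2 = 1} ∪
      (fun x => x * y) '' {x | x ∈ X ∧ x ^ 2 = 1}) ?_ ?_ (hF.union (hF.image _))
    · intro n hn
      obtain ⟨hb, a, ha, e⟩ := hβ n hn
      set b := β n
      have hcomm : b * y * b⁻¹ * y⁻¹ ∈ N := by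
        have h1 : (a : G ⧸ N) = (b : G ⧸ N)⁻¹ := by
          rw [← QuotientGroup.mk_inv, QuotientGroup.eq, ← mul_inv_rev]
          have := N.inv_mem (hNn.conj_mem n hn b)
          rw [e] at this
          simpa [mul_assoc] using this
        have h2 : (y : G ⧸ N) = (c : G ⧸ N) := by
          rw [QuotientGroup.eq, hy]
          simpa [mul_assoc] using N.inv_mem hm
        have h3 : (a : G ⧸ N) * c = c * a := by
          rw [← QuotientGroup.mk_mul, h.comm a ha c hc, QuotientGroup.mk_mul]
        rw [← QuotientGroup.eq_one_iff]
        simp only [QuotientGroup.mk_mul, QuotientGroup.mk_inv]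
        rw [h2]
        have h4 : (b : G ⧸ N) = (a : G ⧸ N)⁻¹ := by rw [h1, inv_inv]
        have h5 : Commute (a : G ⧸ N) c := h3
        rw [h4, (h5.inv_left).eq]
        group
      have h1 := hNB _ hcomm (B.mul_mem (B.mul_mem (B.mul_mem hb hB) (B.inv_mem hb)) (B.inv_mem hB))
      have h2 : Commute y b := by
        rw [mul_inv_eq_one, mul_inv_eq_iff_eq_mul] at h1
        exact h1.symm
      have key : ∀ x ∈ X, Commute y x → x ^ 2 = 1 := by
        intro x hx hyx
        have := h.dih.inv y hB hX x hx
        rw [hyx.eq, mul_inv_cancel_right] at this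
        rw [pow_two]
        nth_rewrite 1 [this]
        simp
      by_cases hbX : b ∈ X
      · exact Or.inl ⟨hbX, key b hbX h2⟩
      · have h3 := h.dih.mul_mem b hb hbX _ (B.inv_mem hB) (inv_notMem hX)
        exact Or.inr ⟨b * y⁻¹, ⟨h3, key _ h3 (h2.mul_right (Commute.refl y).inv_right)⟩, by simp⟩
    · intro n hn n' hn' hnn
      obtain ⟨hb, a, ha, e⟩ := hβ n hn
      obtain ⟨hb', a', ha', e'⟩ := hβ n' hn'
      have e1 : n * n'⁻¹ = a * a'⁻¹ := by
        rw [e, e', hnn]; group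
      have hqN : n * n'⁻¹ ∈ N := N.mul_mem hn (N.inv_mem hn')
      have hqA : n * n'⁻¹ ∈ A := e1 ▸ A.mul_mem ha (A.inv_mem ha')
      have hqc : Commute (n * n'⁻¹) c := h.comm _ hqA c hc
      have hqy : Commute (n * n'⁻¹) y := hqc.mul_right (hNc _ hqN m hm)
      have hqz : Commute (n * n'⁻¹) z := by
        rw [← hsq y hB hX]; exact hqy.mul_right hqy
      exact mul_inv_eq_one.1 (hN2 _ hqN (hNz _ hqN hqz))
  apply hNbot
  rw [Subgroup.eq_bot_iff_forall]
  intro n hn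
  exact hN2 n hn (hNz n hn (h.dih.quasi.commute_of_finite_normal hfinN hzX hn).symm)

end Quaternion

theorem good (h : AbelianCore A B X) {x a : G} (hx : x ∈ X) (ha : a ∈ A) : Good A X (x * a) := by
  obtain ⟨y, hy, hyX⟩ := h.dih.ne
  have hsq : ∀ y' ∈ B, y' ∉ X → y' * y' = y * y := fun y' hy' hyX' =>
    h.dih.mul_self_eq hy' hyX' hy hyX
  by_cases hz : y * y = 1
  · exact h.good_of_dihedral (fun y' hy' hyX' => (hsq y' hy' hyX').trans hz) hx ha
  · exact (h.false_of_quaternion hz hsq (h.dih.mul_mem y hy hyX y hy hyX)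
      (h.dih.mul_self_mul_self hy hyX)).elim

end AbelianCore

/-! ### Reduction to the core when `A` is abelian -/

section Quotient

variable {G : Type*} [Group G] {A B X : Subgroup G}

theorem fac_map {H : Type*} [Group H] {f : G →* H} (hf : Function.Surjective f)
    (fac : ∀ g : G, ∃ a ∈ A, ∃ b ∈ B, g = a * b) (g : H) :
    ∃ a ∈ A.map f, ∃ b ∈ B.map f, g = a * b := by
  obtain ⟨g, rfl⟩ := hf g
  obtain ⟨a, ha, b, hb, rfl⟩ := fac g
  exact ⟨f a, ⟨a, ha, rfl⟩, f b, ⟨b, hb, rfl⟩, map_mul f a b⟩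

theorem good_of_le {N : Subgroup G} (hN : N.Normal) (fac : ∀ g : G, ∃ a ∈ A, ∃ b ∈ B, g = a * b)
    (hNX : ∀ a ∈ A, ∀ n ∈ N, a * n ∈ B → a * n ∈ X) (hX : X ≤ N) {x a : G} (hx : x ∈ X)
    (ha : a ∈ A) : Good A X (x * a) := by
  obtain ⟨c, hc, b, hb, e⟩ := fac (x * a)
  have e1 : b = (c⁻¹ * a) * (a⁻¹ * x * a⁻¹⁻¹) := by
    calc b = c⁻¹ * (c * b) := by group
      _ = _ := by rw [← e]; group
  refine ⟨c, hc, b, ?_, e⟩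
  rw [e1] at hb ⊢
  exact hNX _ (A.mul_mem (A.inv_mem hc) ha) _ (hN.conj_mem x (hX hx) a⁻¹) hb

theorem good_of_quotient {N : Subgroup G} [hN : N.Normal]
    (fac : ∀ g : G, ∃ a ∈ A, ∃ b ∈ B, g = a * b) (hXB : X ≤ B)
    (hNX : ∀ a ∈ A, ∀ n ∈ N, a * n ∈ B → a * n ∈ X) {x a : G}
    (hg : Good (A.map (QuotientGroup.mk' N)) (X.map (QuotientGroup.mk' N))
      (QuotientGroup.mk' N (x * a))) : Good A X (x * a) := by
  obtain ⟨_, ⟨a', ha', rfl⟩, _, ⟨x', hx', rfl⟩, e⟩ := hg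
  obtain ⟨c, hc, b, hb, e'⟩ := fac (x * a)
  rw [e', ← map_mul, QuotientGroup.mk'_apply, QuotientGroup.mk'_apply, eq_comm,
    QuotientGroup.eq] at e
  refine ⟨c, hc, b, ?_, e'⟩
  have e2 : b * x'⁻¹ = (c⁻¹ * a') * (x' * ((a' * x')⁻¹ * (c * b)) * x'⁻¹) := by group
  have h1 := hNX _ (A.mul_mem (A.inv_mem hc) ha') _ (hN.conj_mem _ e x')
    (e2 ▸ B.mul_mem hb (B.inv_mem (hXB hx')))
  rw [← e2] at h1
  exact (X.mul_mem_cancel_right (X.inv_mem hx')).1 h1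

/-- If `N ∩ B ≤ X`, then membership in `X` of elements of `B` can be tested modulo `N`. -/
theorem mem_map_of_quotient {N : Subgroup G} [N.Normal] (hXB : X ≤ B)
    (hNX : ∀ n ∈ N, n ∈ B → n ∈ X) {b : G} (hb : b ∈ B) :
    QuotientGroup.mk' N b ∈ X.map (QuotientGroup.mk' N) ↔ b ∈ X := by
  constructor
  · rintro ⟨x, hx, e⟩
    rw [QuotientGroup.mk'_apply, QuotientGroup.mk'_apply, QuotientGroup.eq] at e
    have := hNX _ e (B.mul_mem (B.inv_mem (hXB hx)) hb)
    exact (X.mul_mem_cancel_left (X.inv_mem hx)).1 this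
  · exact fun h => ⟨b, h, rfl⟩

/-- If `G = AB` with `A` abelian, then `AX` is a subgroup or `A` meets `B \ X`. -/
theorem good_of_abelian (fac : ∀ g : G, ∃ a ∈ A, ∃ b ∈ B, g = a * b)
    (comm : ∀ x ∈ A, ∀ y ∈ A, x * y = y * x) (dih : DihLike B X) :
    (∃ a ∈ A, a ∈ B ∧ a ∉ X) ∨ ∀ x ∈ X, ∀ a ∈ A, Good A X (x * a) := by
  by_cases h0 : ∃ a ∈ A, a ∈ B ∧ a ∉ X
  · exact Or.inl h0
  right
  push Not at h0
  -- The condition is `AN ∩ B ⊆ X`. Under it, membership of `B`-parts in `X` can be read off in the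
  -- quotient.
  obtain ⟨N, hN, hNX, hmax⟩ := exists_maximal_normal
    (fun n _ : G => ∀ a ∈ A, a * n ∈ B → a * n ∈ X) (fun a ha haB => by
      rw [mul_one] at haB ⊢; exact h0 a ha haB)
  have hNX : ∀ a ∈ A, ∀ n ∈ N, a * n ∈ B → a * n ∈ X := fun a ha n hn => hNX n hn n hn a ha
  have hNX' : ∀ n ∈ N, n ∈ B → n ∈ X := fun n hn hnB => by
    simpa using hNX 1 A.one_mem n hn (by simpa using hnB)
  intro x hx a ha
  by_cases hXN : X ≤ N
  · exact good_of_le hN fac hNX hXN hx ha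
  obtain ⟨x₀, hx₀, hx₀N⟩ := SetLike.not_le_iff_exists.1 hXN
  refine good_of_quotient (N := N) fac dih.le hNX ?_
  rw [map_mul]
  refine AbelianCore.good (B := B.map (QuotientGroup.mk' N)) ⟨?_, ?_, ?_, ?_, ?_⟩ ⟨x, hx, rfl⟩
    ⟨a, ha, rfl⟩
  · exact fac_map (QuotientGroup.mk'_surjective N) fac
  · rintro _ ⟨u, hu, rfl⟩ _ ⟨v, hv, rfl⟩
    rw [← map_mul, comm u hu v hv, map_mul]
  · refine dih.map _ hx₀ (by simpa using hx₀N) fun y hy hyX hc => ?_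
    rw [QuotientGroup.mk'_apply, QuotientGroup.eq_one_iff] at hc
    exact hyX (hNX' y hc hy)
  · rintro _ ⟨u, hu, rfl⟩ ⟨b, hb, e⟩
    rw [← e, mem_map_of_quotient dih.le hNX' hb]
    rw [QuotientGroup.mk'_apply, QuotientGroup.mk'_apply, eq_comm, QuotientGroup.eq] at e
    have := hNX u hu _ e (by simpa using hb)
    simpa using this
  · intro M hM hMb
    by_contra! hcon
    apply hMb
    have hle := hmax (M.comap (QuotientGroup.mk' N)) (hM.comap _) (fun n hn => by
      rw [Subgroup.mem_comap, QuotientGroup.mk'_apply, (QuotientGroup.eq_one_iff n).2 hn]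
      exact M.one_mem) (fun n hn _ _ a ha hB => by
        have := hcon _ ⟨a, ha, rfl⟩ _ hn (by rw [← map_mul]; exact ⟨_, hB, rfl⟩)
        rwa [← map_mul, mem_map_of_quotient dih.le hNX' hB] at this)
    rw [Subgroup.eq_bot_iff_forall]
    intro m hm
    obtain ⟨g, rfl⟩ := QuotientGroup.mk'_surjective N m
    rw [QuotientGroup.mk'_apply, QuotientGroup.eq_one_iff]
    exact hle hm

end Quotient

/-! ### The product subgroup and the exchange of the two factors -/

section Product

variable {G : Type*} [Group G]

/-- The product `AX` as a subgroup, provided that it contains `XA`. -/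
def prodSubgroup (A X : Subgroup G) (h : ∀ x ∈ X, ∀ a ∈ A, Good A X (x * a)) : Subgroup G where
  carrier := {g | Good A X g}
  one_mem' := ⟨1, A.one_mem, 1, X.one_mem, by simp⟩
  mul_mem' := by
    rintro _ _ ⟨a, ha, x, hx, rfl⟩ ⟨a', ha', x', hx', rfl⟩
    obtain ⟨a'', ha'', x'', hx'', e⟩ := h x hx a' ha'
    refine ⟨a * a'', A.mul_mem ha ha'', x'' * x', X.mul_mem hx'' hx', ?_⟩
    calc a * x * (a' * x') = a * (x * a') * x' := by group
      _ = _ := by rw [e]; group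
  inv_mem' := by
    rintro _ ⟨a, ha, x, hx, rfl⟩
    obtain ⟨a'', ha'', x'', hx'', e⟩ := h x⁻¹ (X.inv_mem hx) a⁻¹ (A.inv_mem ha)
    exact ⟨a'', ha'', x'', hx'', by rw [mul_inv_rev, e]⟩

theorem mem_prodSubgroup {A X : Subgroup G} {h : ∀ x ∈ X, ∀ a ∈ A, Good A X (x * a)} {g : G} :
    g ∈ prodSubgroup A X h ↔ Good A X g := Iff.rfl

theorem le_prodSubgroup_left {A X : Subgroup G} (h : ∀ x ∈ X, ∀ a ∈ A, Good A X (x * a)) :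
    A ≤ prodSubgroup A X h := fun a ha => ⟨a, ha, 1, X.one_mem, by simp⟩

theorem le_prodSubgroup_right {A X : Subgroup G} (h : ∀ x ∈ X, ∀ a ∈ A, Good A X (x * a)) :
    X ≤ prodSubgroup A X h := fun x hx => ⟨1, A.one_mem, x, hx, by simp⟩

/-- `A` meets `B \ X`, or `XA ⊆ AX`. -/
def GoodPair (A B X : Subgroup G) : Prop :=
  (∃ a ∈ A, a ∈ B ∧ a ∉ X) ∨ ∀ x ∈ X, ∀ a ∈ A, Good A X (x * a)

variable {A B X Y : Subgroup G}

/-- `good_of_abelian` inside the product set of `A` and `B`, if that is a subgroup. -/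
theorem goodPair_of_abelian_of_le {H : Subgroup G} (hA : A ≤ H) (hB : B ≤ H)
    (fac : ∀ g ∈ H, ∃ a ∈ A, ∃ b ∈ B, g = a * b)
    (comm : ∀ x ∈ A, ∀ y ∈ A, x * y = y * x) (dih : DihLike B X) : GoodPair A B X := by
  rcases good_of_abelian (A := A.subgroupOf H) (B := B.subgroupOf H) (X := X.subgroupOf H)
    (fun g => by
      obtain ⟨a, ha, b, hb, e⟩ := fac g g.2
      exact ⟨⟨a, hA ha⟩, ha, ⟨b, hB hb⟩, hb, Subtype.ext e⟩)
    (fun x hx y hy => Subtype.ext (comm x hx y hy)) (dih.subgroupOf hB) with h | h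
  · obtain ⟨a, ha, haB, haX⟩ := h
    exact Or.inl ⟨a, ha, haB, haX⟩
  · right
    intro x hx a ha
    obtain ⟨a', ha', x', hx', e⟩ := h ⟨x, hB (dih.le hx)⟩ hx ⟨a, hA ha⟩ ha
    exact ⟨a', ha', x', hx', congrArg Subtype.val e⟩

/-- If `A ∩ B` meets `A \ Y`, then `G = YB` with `Y` abelian, and `A` differs from `Y` only by an
element of `B`, which normalizes `X`. Otherwise `H = YB` is a subgroup, normalized by `A`; the
abelian case gives the subgroup `K = YX`, which contains the squares of `H`. -/
theorem GoodPair.swap (fac : ∀ g : G, ∃ a ∈ A, ∃ b ∈ B, g = a * b) (dA : DihLike A Y)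
    (dB : DihLike B X) (h : GoodPair B A Y) : GoodPair A B X := by
  rcases h with ⟨b, hb, hbA, hbY⟩ | h
  · have hY : GoodPair Y B X := by
      refine good_of_abelian (fun g => ?_) dA.quasi.comm dB
      obtain ⟨a, ha, b', hb', rfl⟩ := fac g
      by_cases haY : a ∈ Y
      · exact ⟨a, haY, b', hb', rfl⟩
      · exact ⟨a * b⁻¹, dA.mul_mem a ha haY _ (A.inv_mem hbA) (inv_notMem hbY), b * b',
          B.mul_mem hb hb', by group⟩
    rcases hY with ⟨a, ha, h1⟩ | hY
    · exact Or.inl ⟨a, dA.le ha, h1⟩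
    right
    intro x hx a ha
    by_cases haY : a ∈ Y
    · obtain ⟨y, hy, x', hx', e⟩ := hY x hx a haY
      exact ⟨y, dA.le hy, x', hx', e⟩
    · obtain ⟨y, hy, x', hx', e⟩ := hY x hx (a * b⁻¹)
        (dA.mul_mem a ha haY _ (A.inv_mem hbA) (inv_notMem hbY))
      refine ⟨y * b, A.mul_mem (dA.le hy) hbA, b⁻¹ * x' * b⁻¹⁻¹, dB.conj_mem (B.inv_mem hb) hx', ?_⟩
      calc x * a = x * (a * b⁻¹) * b := by group
        _ = _ := by rw [e]; group
  · set H := prodSubgroup B Y h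
    have hBH : B ≤ H := le_prodSubgroup_left h
    have hYH : Y ≤ H := le_prodSubgroup_right h
    have facH : ∀ g ∈ H, ∃ y ∈ Y, ∃ b ∈ B, g = y * b := by
      intro g hg
      obtain ⟨b, hb, y, hy, e⟩ := mem_prodSubgroup.1 (H.inv_mem hg)
      exact ⟨y⁻¹, Y.inv_mem hy, b⁻¹, B.inv_mem hb, by rw [← mul_inv_rev, ← e, inv_inv]⟩
    rcases goodPair_of_abelian_of_le hYH hBH facH dA.quasi.comm dB with ⟨a, ha, h1⟩ | hY
    · exact Or.inl ⟨a, dA.le ha, h1⟩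
    right
    set K := prodSubgroup Y X hY
    have hXK : X ≤ K := le_prodSubgroup_right hY
    have hYK : Y ≤ K := le_prodSubgroup_left hY
    have hsq : ∀ g ∈ H, g * g ∈ K := by
      intro g hg
      by_contra hgg
      have hgK : g ∉ K := fun hc => hgg (K.mul_mem hc hc)
      have key : ∀ g' ∈ H, g' ∉ K → g' * g⁻¹ ∈ K := by
        intro g' hg' hgK'
        obtain ⟨y, hy, b, hb, rfl⟩ := facH g hg
        obtain ⟨y', hy', b', hb', rfl⟩ := facH g' hg'
        have hbX : b ∉ X := fun hc => hgK (K.mul_mem (hYK hy) (hXK hc))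
        have hbX' : b' ∉ X := fun hc => hgK' (K.mul_mem (hYK hy') (hXK hc))
        have : y' * b' * (y * b)⁻¹ = y' * (b' * b⁻¹) * y⁻¹ := by group
        rw [this]
        exact K.mul_mem (K.mul_mem (hYK hy')
          (hXK (dB.mul_mem b' hb' hbX' _ (B.inv_mem hb) (inv_notMem hbX)))) (K.inv_mem (hYK hy))
      have := key _ (H.mul_mem hg hg) hgg
      rw [mul_inv_cancel_right] at this
      exact hgK this
    intro x hx a ha
    by_cases haY : a ∈ Y
    · obtain ⟨y, hy, x', hx', e⟩ := hY x hx a haY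
      exact ⟨y, dA.le hy, x', hx', e⟩
    -- If the `A`-part `c` of the conjugate is not in `Y`, then `a * c ∈ Y`, which forces `g * a`,
    -- and so `a` itself, into `H`.
    have hnorm : ∀ g ∈ H, a⁻¹ * g * a ∈ H := by
      intro g hg
      by_cases haH : a ∈ H
      · exact H.mul_mem (H.mul_mem (H.inv_mem haH) hg) haH
      obtain ⟨c, hc, b, hb, e⟩ := fac (a⁻¹ * g * a)
      by_cases hcY : c ∈ Y
      · rw [e]; exact H.mul_mem (hYH hcY) (hBH hb)
      · exfalso
        apply haH
        have h1 : a * c * b ∈ H := H.mul_mem (hYH (dA.mul_mem a ha haY c hc hcY)) (hBH hb)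
        have h2 : a * c * b = g * a := by rw [mul_assoc, ← e]; group
        rw [h2] at h1
        exact (H.mul_mem_cancel_left hg).1 h1
    -- Divisibility writes `x` as a square, so its conjugate by `a` is the square of an element of
    -- `H`.
    obtain ⟨u, hu, rfl⟩ := dB.quasi.exists_pow_eq (n := 2) (by norm_num) hx
    obtain ⟨y, hy, x', hx', e⟩ := mem_prodSubgroup.1 (hsq _ (hnorm u (hBH (dB.le hu))))
    refine ⟨a * y, A.mul_mem ha (dA.le hy), x', hx', ?_⟩
    calc u ^ 2 * a = a * ((a⁻¹ * u * a) * (a⁻¹ * u * a)) := by rw [pow_two]; group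
      _ = _ := by rw [e]; group

end Product

/-! ### The reduced situation with two nonabelian factors -/

theorem normalClosure_singleton_comm {G : Type*} [Group G] {w : G}
    (h : ∀ g : G, Commute (g * w * g⁻¹) w) :
    ∀ m ∈ Subgroup.normalClosure {w}, ∀ n ∈ Subgroup.normalClosure {w}, Commute m n := by
  have h1 : ∀ m ∈ Subgroup.normalClosure {w}, ∀ g : G, Commute m (g * w * g⁻¹) := by
    intro m hm
    refine mem_normalClosure_induction (p := fun m => ∀ g : G, Commute m (g * w * g⁻¹)) ?_ ?_ ?_ ?_
      hm
    · intro s hs k g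
      rw [Set.mem_singleton_iff.1 hs]
      have := (h (g⁻¹ * k)).eq
      rw [commute_iff_eq]
      calc k * w * k⁻¹ * (g * w * g⁻¹) = g * ((g⁻¹ * k) * w * (g⁻¹ * k)⁻¹ * w) * g⁻¹ := by group
        _ = _ := by rw [this]; group
    · exact fun g => Commute.one_left _
    · exact fun n _ m _ hn hm g => (hn g).mul_left (hm g)
    · exact fun n _ hn g => (hn g).inv_left
  intro m hm n hn
  refine mem_normalClosure_induction (p := fun n => Commute m n) ?_ (Commute.one_right _)
    (fun n _ m _ hn hm => hn.mul_right hm) (fun n _ hn => hn.inv_right) hn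
  intro s hs g
  rw [Set.mem_singleton_iff.1 hs]
  exact h1 m hm g

theorem normalClosure_singleton_pow {G : Type*} [Group G] {w : G}
    (hc : ∀ m ∈ Subgroup.normalClosure {w}, ∀ n ∈ Subgroup.normalClosure {w}, Commute m n) {m : G}
    (hm : m ∈ Subgroup.normalClosure {w}) : m ^ orderOf w = 1 := by
  refine mem_normalClosure_induction (n := m) (p := fun m => m ^ orderOf w = 1) ?_ (by simp)
    ?_ ?_ hm
  · intro s hs g
    rw [Set.mem_singleton_iff.1 hs, conj_pow, pow_orderOf_eq_one]
    simp
  · intro n hn m hm e1 e2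
    rw [(hc n hn m hm).mul_pow, e1, e2, one_mul]
  · intro n _ e
    rw [inv_pow, e, inv_one]

/-- A factorization `G = AB` by two groups of dihedral type, in which every nontrivial normal
subgroup of `G` multiplied with `A` meets `B \ X`, and multiplied with `B` meets `A \ Y`. -/
structure DihedralCore {G : Type*} [Group G] (A Y B X : Subgroup G) : Prop where
  fac : ∀ g : G, ∃ a ∈ A, ∃ b ∈ B, g = a * b
  dA : DihLike A Y
  dB : DihLike B X
  disj : ∀ g ∈ A, g ∈ B → g = 1
  maxB : ∀ M : Subgroup G, M.Normal → M ≠ ⊥ → ∃ a ∈ A, ∃ m ∈ M, a * m ∈ B ∧ a * m ∉ X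
  maxA : ∀ M : Subgroup G, M.Normal → M ≠ ⊥ → ∃ b ∈ B, ∃ m ∈ M, b * m ∈ A ∧ b * m ∉ Y

namespace DihedralCore

variable {G : Type*} [Group G] {A Y B X : Subgroup G}

theorem symm (h : DihedralCore A Y B X) : DihedralCore B X A Y :=
  ⟨fac_swap h.fac, h.dB, h.dA, fun g hB hA => h.disj g hA hB, h.maxA, h.maxB⟩

theorem not_normalize (h : DihedralCore A Y B X) {w : G} (hw : w ∈ X) (hw1 : w ≠ 1) :
    ¬ ∀ a ∈ A, a * w * a⁻¹ ∈ Subgroup.zpowers w := by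
  intro hA
  have hle : Subgroup.zpowers w ≤ X := Subgroup.zpowers_le.2 hw
  have hn : (Subgroup.zpowers w).Normal := h.dB.normal_of_conj_mem h.fac hle
    fun a ha x hx => normalizes_zpowers (hA a ha) hx
  obtain ⟨a, ha, m, hm, hB, hX⟩ := h.maxB _ hn (by simpa using hw1)
  have haB : a ∈ B := (B.mul_mem_cancel_right (h.dB.le (hle hm))).1 hB
  apply hX
  rw [h.disj a ha haB, one_mul]
  exact hle hm

/-- If an element of `A \ Y` normalizes `⟨w⟩`, then `Y` does not. -/
theorem exists_not_normalize (h : DihedralCore A Y B X) {w : G} (hw : w ∈ X) (hw1 : w ≠ 1)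
    {a : G} (ha : a ∈ A) (haY : a ∉ Y) (haw : a * w * a⁻¹ ∈ Subgroup.zpowers w) :
    ∃ y ∈ Y, y * w * y⁻¹ ∉ Subgroup.zpowers w := by
  by_contra! hc
  apply h.not_normalize hw hw1
  intro c hcA
  by_cases hcY : c ∈ Y
  · exact hc c hcY
  · have h1 := hc _ (h.dA.mul_mem c hcA hcY _ (A.inv_mem ha) (inv_notMem haY))
    have hfin := h.dB.quasi.tors w hw
    have h2 := (zpowersNormalizer w hfin).mul_mem ((mem_zpowersNormalizer hfin).2 h1)
      ((mem_zpowersNormalizer hfin).2 haw)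
    rw [inv_mul_cancel_right] at h2
    exact h2

/-- A subgroup meeting `Y` in a finite set meets `A` in a finite set. -/
theorem finite_inf (dA : DihLike A Y) {H : Subgroup G}
    (hY : ((Y ⊓ H : Subgroup G) : Set G).Finite) : {a | a ∈ A ∧ a ∈ H}.Finite := by
  by_cases hex : ∃ c ∈ A, c ∈ H ∧ c ∉ Y
  · obtain ⟨c, hc, hcH, hcY⟩ := hex
    refine (hY.union (hY.image (fun y => y * c))).subset ?_
    rintro a ⟨ha, haH⟩
    by_cases haY : a ∈ Y
    · exact Or.inl ⟨haY, haH⟩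
    · exact Or.inr ⟨a * c⁻¹, ⟨dA.mul_mem a ha haY _ (A.inv_mem hc) (inv_notMem hcY),
        H.mul_mem haH (H.inv_mem hcH)⟩, by simp⟩
  · push Not at hex
    exact hY.subset fun a ha => ⟨hex a ha.1 ha.2, ha.2⟩

/-- A subgroup `M ≤ H`, with `B ≤ H` and finite intersections `A ∩ H`, `M ∩ B`, is finite. -/
theorem finite_of_finite_inter (fac : ∀ g : G, ∃ a ∈ A, ∃ b ∈ B, g = a * b) {M H : Subgroup G}
    (hMH : M ≤ H) (hBH : B ≤ H) (hA : {a | a ∈ A ∧ a ∈ H}.Finite)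
    (hB : {m | m ∈ M ∧ m ∈ B}.Finite) : (M : Set G).Finite := by
  have hex : ∀ m : G, ∃ a ∈ A, ∃ b ∈ B, m = a * b := fac
  choose α hα β hβ e using hex
  refine Set.Finite.of_finite_fibers α (hA.subset ?_) ?_
  · rintro _ ⟨m, hm, rfl⟩
    refine ⟨hα m, (H.mul_mem_cancel_right (hBH (hβ m))).1 ?_⟩
    rw [← e]; exact hMH hm
  · rintro _ ⟨m, hm, rfl⟩
    refine (hB.image (fun t => m * t)).subset ?_
    rintro n ⟨hn, hnm⟩
    have hnm : α n = α m := hnm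
    refine ⟨m⁻¹ * n, ⟨M.mul_mem (M.inv_mem hm) hn, ?_⟩, by simp⟩
    have : m⁻¹ * n = (β m)⁻¹ * β n := by
      conv_lhs => rw [e m, e n, hnm]
      group
    rw [this]
    exact B.mul_mem (B.inv_mem (hβ m)) (hβ n)

/-- `Y` centralizes `w`: either `Y ≤ BM`, where squares centralize `w`, or `Y ∩ BM` is finite, which
makes `M` finite. But `BM` contains an element of `A \ Y` normalizing `⟨w⟩`, so all of `A` would
normalize `⟨w⟩`. -/
theorem false_of_comm (h : DihedralCore A Y B X) {w : G} (hw : w ∈ X) (hwp : (orderOf w).Prime)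
    (hc : ∀ m ∈ Subgroup.normalClosure {w}, ∀ n ∈ Subgroup.normalClosure {w}, Commute m n) :
    False := by
  have hw1 := ne_one_of_orderOf_prime hwp
  set M := Subgroup.normalClosure {w} with hM
  have hMn : M.Normal := Subgroup.normalClosure_normal
  have hwM : w ∈ M := Subgroup.subset_normalClosure (Set.mem_singleton w)
  have hMbot : M ≠ ⊥ := fun hb => hw1 (by rwa [hb, Subgroup.mem_bot] at hwM)
  have hexp : ∀ m ∈ M, m ^ orderOf w = 1 := fun m hm => normalClosure_singleton_pow hc hm
  have hMB : ∀ m ∈ M, m ∈ B → m ∈ X := by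
    intro m hm hmB
    by_contra hmX
    have hBM := h.dB.le_of_mem_normal hMn hmB hmX hm
    exact h.dB.not_comm fun x hx y hy => hc x (hBM hx) y (hBM hy)
  have hYw : ∀ y ∈ Y, Commute y w := by
    by_cases hYM : Y ≤ B ⊔ M
    · intro y hy
      obtain ⟨u, hu, rfl⟩ := h.dA.quasi.exists_pow_eq (n := 2) (by norm_num) hy
      obtain ⟨b, hb, m, hm, rfl⟩ := Subgroup.mem_sup_of_normal_right.1 (hYM hu)
      have hbb : b * b ∈ X := by
        by_cases hbX : b ∈ X
        · exact X.mul_mem hbX hbX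
        · exact h.dB.mul_mem b hb hbX b hb hbX
      have e : (b * m) ^ 2 = (b * b) * ((b⁻¹ * m * b⁻¹⁻¹) * m) := by rw [pow_two]; group
      rw [e]
      exact Commute.mul_left (h.dB.quasi.comm _ hbb _ hw)
        (hc _ (M.mul_mem (hMn.conj_mem m hm b⁻¹) hm) w hwM)
    · obtain ⟨y, hy, hyM⟩ := SetLike.not_le_iff_exists.1 hYM
      have hfin := finite_inf (A := A) h.dA (h.dA.quasi.finite_of_not_mem
        (H := Y ⊓ (B ⊔ M)) inf_le_left hy fun hc => hyM hc.2)
      have hMfin := finite_of_finite_inter h.fac (M := M) le_sup_right le_sup_left hfin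
        ((h.dB.quasi.finite_torsion hwp.pos).subset fun m hm => ⟨hMB m hm.1 hm.2, hexp m hm.1⟩)
      exact fun y hy => h.dA.quasi.commute_of_finite_normal hMfin hy hwM
  obtain ⟨b, hb, m, hm, hA, hbY⟩ := h.maxA M hMn hMbot
  obtain ⟨y, hy, hyw⟩ := h.exists_not_normalize hw hw1 hA hbY (by
    have e : b * m * w * (b * m)⁻¹ = b * (m * w * m⁻¹) * b⁻¹ := by group
    rw [e, (hc m hm w hwM).eq, mul_inv_cancel_right]
    exact h.dB.conj_mem_zpowers hb hw)
  apply hyw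
  rw [(hYw y hy).eq, mul_inv_cancel_right]
  exact Subgroup.mem_zpowers w

/-- If `d` normalizes `⟨w⟩`, so does its normal closure `N`. If `w ∈ N`, then `w` commutes with its
conjugates. Otherwise `N ∩ B = 1`, `N` is finite, and `d` commutes with its conjugates. Both
contradict `false_of_comm`, the second time with the factors exchanged. -/
theorem not_normalize_minimal (h : DihedralCore A Y B X) {w d : G} (hw : w ∈ X)
    (hwp : (orderOf w).Prime) (hwm : ∀ x ∈ X, x ≠ 1 → w ∈ Subgroup.zpowers x)
    (hd : d ∈ Y) (hdp : (orderOf d).Prime) : d * w * d⁻¹ ∉ Subgroup.zpowers w := by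
  intro hdw
  have hw1 := ne_one_of_orderOf_prime hwp
  have hd1 := ne_one_of_orderOf_prime hdp
  have hwf := h.dB.quasi.tors w hw
  set L := zpowersNormalizer w hwf with hL
  have hBL : B ≤ L := fun b hb => h.dB.conj_mem_zpowers hb hw
  set N := Subgroup.normalClosure {d} with hN
  have hNn : N.Normal := Subgroup.normalClosure_normal
  have hdN : d ∈ N := Subgroup.subset_normalClosure (Set.mem_singleton d)
  have hNL : ∀ n ∈ N, n ∈ L := by
    intro n hn
    refine mem_normalClosure_induction (p := fun n => n ∈ L) ?_ (Subgroup.one_mem _)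
        (fun _ _ _ _ => Subgroup.mul_mem _) (fun _ _ => Subgroup.inv_mem _) hn
    intro s hs g
    rw [Set.mem_singleton_iff.1 hs]
    obtain ⟨b, hb, a, ha, rfl⟩ := fac_swap h.fac g
    have e : b * a * d * (b * a)⁻¹ = b * (a * d * a⁻¹) * b⁻¹ := by group
    rw [e]
    refine L.mul_mem (L.mul_mem (hBL hb) ?_) (L.inv_mem (hBL hb))
    exact (Subgroup.zpowers_le.2 (show d ∈ L from hdw)) (h.dA.conj_mem_zpowers ha hd)
  by_cases hwN : w ∈ N
  · refine h.false_of_comm hw hwp (normalClosure_singleton_comm fun g => ?_)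
    have ho : orderOf (g * w * g⁻¹) = orderOf w := by simpa using (MulAut.conj g).orderOf_eq w
    refine commute_of_normalize (ho ▸ hwp) (hNL _ (hNn.conj_mem w hwN g)) ?_
    obtain ⟨k, hk⟩ := (mem_zpowersNormalizer hwf).1 (hNL _ (hNn.conj_mem w hwN g⁻¹))
    simp only [inv_inv] at hk
    refine ⟨k, ?_⟩
    simp only
    rw [conj_zpow, hk]
    group
  · have hNB : ∀ n ∈ N, n ∈ B → n = 1 := by
      intro n hn hnB
      by_contra hn1
      by_cases hnX : n ∈ X
      · exact hwN ((Subgroup.zpowers_le.2 hn) (hwm n hnX hn1))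
      · exact hwN (h.dB.le_of_mem_normal hNn hnB hnX hn (h.dB.le hw))
    obtain ⟨b, hb, n, hn, hA, hbY⟩ := h.maxA N hNn fun hb => hd1 (by
      rwa [hb, Subgroup.mem_bot] at hdN)
    obtain ⟨y, hy, hyw⟩ := h.exists_not_normalize hw hw1 hA hbY
      (L.mul_mem (hBL hb) (hNL n hn))
    have hfin := finite_inf (A := A) h.dA (h.dA.quasi.finite_of_not_mem
        (H := Y ⊓ L) inf_le_left hy fun hc => hyw hc.2)
    have hNfin := finite_of_finite_inter h.fac (M := N) hNL hBL hfin
      ((Set.finite_singleton (1 : G)).subset fun m hm => hNB m hm.1 hm.2)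
    exact h.symm.false_of_comm hd hdp (normalClosure_singleton_comm fun g =>
      (h.dA.quasi.commute_of_finite_normal hNfin hd (hNn.conj_mem d hdN g)).symm)

theorem eq_one_of_normalize (h : DihedralCore A Y B X) {w : G} (hw : w ∈ X)
    (hwp : (orderOf w).Prime) (hwm : ∀ x ∈ X, x ≠ 1 → w ∈ Subgroup.zpowers x) {k : G}
    (hk : k ∈ Y) (hkw : k * w * k⁻¹ ∈ Subgroup.zpowers w) : k = 1 := by
  by_contra hk1
  obtain ⟨d, hd, hdp, hdm⟩ := h.dA.quasi.exists_minimal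
  refine h.not_normalize_minimal hw hwp hwm hd hdp ?_
  exact (Subgroup.zpowers_le.2 (show k ∈ zpowersNormalizer w (h.dB.quasi.tors w hw) from hkw))
    (hdm k hk hk1)

theorem good_of_dihedral (h : DihedralCore A Y B X) (hsq : ∀ y ∈ B, y ∉ X → y * y = 1) {x a : G}
    (hx : x ∈ X) (ha : a ∈ A) : Good A X (x * a) := by
  obtain ⟨w, hw, hwp, hwm⟩ := h.dB.quasi.exists_minimal
  have hY := fun k hk hkw => h.eq_one_of_normalize hw hwp hwm (k := k) hk hkw
  refine (DihedralFactorization.of_normalizer (Y := Y) h.fac h.disj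
    (h.dA.quasi.inf.mono h.dA.le) h.dB hsq h.dA.mul_mem (fun a ha => h.dA.act ha) hw hY ?_).good
    hx ha
  refine finite_inf (H := zpowersNormalizer w (h.dB.quasi.tors w hw)) h.dA
    ((Set.finite_singleton (1 : G)).subset ?_)
  rintro k ⟨hk, hkw⟩
  exact hY k hk hkw

theorem eq_one_of_commute (h : DihedralCore A Y B X) {z : G} (hz : z ∈ X) (hz1 : z ≠ 1)
    (hA : ∀ y ∈ A, y ∉ Y → y * y ≠ 1) {a : G} (ha : a ∈ A) (haz : Commute a z) : a = 1 := by
  obtain ⟨w, hw, hwp, hwm⟩ := h.dB.quasi.exists_minimal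
  have key : ∀ k ∈ Y, Commute k z → k = 1 := by
    intro k hk hkz
    apply h.eq_one_of_normalize hw hwp hwm hk
    obtain ⟨i, rfl⟩ := hwm z hz hz1
    simp only
    rw [(hkz.zpow_right i).eq, mul_inv_cancel_right]
    exact Subgroup.mem_zpowers _
  by_cases haY : a ∈ Y
  · exact key a haY haz
  · exact absurd (key _ (h.dA.mul_mem a ha haY a ha haY) (haz.mul_left haz)) (hA a ha haY)

/-- The central involutions `i` of `A` and `z` of `B` generate a dihedral group with rotation `r = i
* z` of finite order. For even order, the involution in `⟨r⟩` centralizes both generators, which is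
impossible. For odd order, `i` and `z` are conjugate, and factoring the conjugating element gives `i
= z`. -/
theorem false_of_quaternion (h : DihedralCore A Y B X) {i z : G} (hi : i ≠ 1) (hz : z ≠ 1)
    (hsqA : ∀ y ∈ A, y ∉ Y → y * y = i) (hsqB : ∀ y ∈ B, y ∉ X → y * y = z)
    (hiY : i ∈ Y) (hzX : z ∈ X) (hi2 : i * i = 1) (hz2 : z * z = 1) : False := by
  have hii : i⁻¹ = i := inv_eq_of_mul_eq_one_left hi2
  have hzi : z⁻¹ = z := inv_eq_of_mul_eq_one_left hz2
  have central : ∀ {C W : Subgroup G} {t : G}, DihLike C W → t ∈ W → t⁻¹ = t →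
      ∀ c ∈ C, Commute c t := by
    intro C W t hC ht hti c hc
    rcases hC.act hc with h1 | h1
    · exact mul_inv_eq_iff_eq_mul.1 (h1 t ht)
    · have h2 := h1 t ht
      rw [hti] at h2
      exact mul_inv_eq_iff_eq_mul.1 h2
  have hcA := central h.dA hiY hii
  have hcB := central h.dB hzX hzi
  have hCA : ∀ a ∈ A, Commute a z → a = 1 := fun a ha =>
    h.eq_one_of_commute hzX hz (fun y hy hyY => (hsqA y hy hyY).symm ▸ hi) ha
  have hCB : ∀ b ∈ B, Commute b i → b = 1 := fun b hb =>
    h.symm.eq_one_of_commute hiY hi (fun y hy hyX => (hsqB y hy hyX).symm ▸ hz) hb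
  set r := i * z with hr
  have hrinv : r⁻¹ = z * i := by rw [hr, mul_inv_rev, hii, hzi]
  have hir : i * r * i⁻¹ = r⁻¹ := by
    rw [hrinv, hii, hr, ← mul_assoc, hi2, one_mul]
  have hzr : z * r * z⁻¹ = r⁻¹ := by
    rw [hrinv, hzi, hr, mul_assoc, mul_assoc, hz2, mul_one]
  -- With `r = b * a`, conjugation by `b` sends `i` to `r * i * r⁻¹` and fixes `z`, so it cubes `r`.
  -- As `b` has some finite order `n`, it follows that `r ^ (3 ^ n) = r`.
  have hfin : IsOfFinOrder r := by
    obtain ⟨b, hb, a, ha, e⟩ := fac_swap h.fac r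
    have e1 : b * i * b⁻¹ = r * i * r⁻¹ := by
      rw [e]
      calc b * i * b⁻¹ = b * (i * a) * a⁻¹ * b⁻¹ := by group
        _ = b * (a * i) * a⁻¹ * b⁻¹ := by rw [(hcA a ha).eq]
        _ = _ := by group
    have e2 : b * r * b⁻¹ = r ^ 3 := by
      calc b * r * b⁻¹ = (b * i * b⁻¹) * (b * z * b⁻¹) := by rw [hr]; group
        _ = (r * i * r⁻¹) * z := by rw [e1, (hcB b hb).eq, mul_inv_cancel_right]
        _ = r ^ 3 := by rw [hrinv, pow_succ, pow_two, hr]; simp only [mul_assoc]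
    have e3 : ∀ n : ℕ, b ^ n * r * (b ^ n)⁻¹ = r ^ 3 ^ n := by
      intro n
      induction n with
      | zero => simp
      | succ n ih =>
        calc b ^ (n + 1) * r * (b ^ (n + 1))⁻¹ = b ^ n * (b * r * b⁻¹) * (b ^ n)⁻¹ := by
              rw [pow_succ]; group
          _ = (b ^ n * r * (b ^ n)⁻¹) ^ 3 := by rw [e2, conj_pow]
          _ = r ^ 3 ^ (n + 1) := by rw [ih, ← pow_mul, pow_succ]
    have hbf : IsOfFinOrder b := by
      by_cases hbX : b ∈ X
      · exact h.dB.quasi.tors b hbX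
      · refine isOfFinOrder_iff_pow_eq_one.2 ⟨4, by norm_num, ?_⟩
        have : b ^ 4 = (b * b) * (b * b) := by rw [pow_succ, pow_succ, pow_two]; group
        rw [this, hsqB b hb hbX, hz2]
    obtain ⟨n, hn, hbn⟩ := isOfFinOrder_iff_pow_eq_one.1 hbf
    have e4 := e3 n
    rw [hbn, inv_one, mul_one, one_mul] at e4
    have h3 : 1 < 3 ^ n := Nat.one_lt_pow hn.ne' (by norm_num)
    refine isOfFinOrder_iff_pow_eq_one.2 ⟨3 ^ n - 1, by omega, ?_⟩
    have : r ^ (3 ^ n - 1) * r = r := by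
      rw [← pow_succ, Nat.sub_add_cancel h3.le]; exact e4.symm
    exact mul_eq_right.1 this
  rcases Nat.even_or_odd' (orderOf r) with ⟨k, hk | hk⟩
  · have hkpos : 0 < k := by have := hfin.orderOf_pos; omega
    have hk2 : (r ^ k)⁻¹ = r ^ k := by
      apply inv_eq_of_mul_eq_one_left
      rw [← pow_add, ← two_mul, ← hk, pow_orderOf_eq_one]
    have hne : r ^ k ≠ 1 := fun hc => by
      have := orderOf_le_of_pow_eq_one hkpos hc
      omega
    have hci : Commute (r ^ k) i := by
      have : i * r ^ k * i⁻¹ = r ^ k := by rw [← conj_pow, hir, inv_pow, hk2]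
      exact (mul_inv_eq_iff_eq_mul.1 this).symm
    have hcz : Commute (r ^ k) z := by
      have : z * r ^ k * z⁻¹ = r ^ k := by rw [← conj_pow, hzr, inv_pow, hk2]
      exact (mul_inv_eq_iff_eq_mul.1 this).symm
    obtain ⟨a, ha, b, hb, e⟩ := h.fac (r ^ k)
    have ha1 : a = 1 := hCA a ha (by
      have := hcz.mul_left (hcB b hb).inv_left
      rwa [e, mul_inv_cancel_right] at this)
    rw [ha1, one_mul] at e
    exact hne (hCB _ (e ▸ hb) hci)
  · have h1 : r ^ (2 * k) = r⁻¹ := by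
      apply eq_inv_of_mul_eq_one_left
      rw [← pow_succ, ← hk, pow_orderOf_eq_one]
    have h2 : (r ^ k)⁻¹ * i = i * r ^ k := by
      have : i * r ^ k * i⁻¹ = (r ^ k)⁻¹ := by rw [← conj_pow, hir, inv_pow]
      exact (mul_inv_eq_iff_eq_mul.1 this).symm
    have h3 : (r ^ k)⁻¹ * i * r ^ k = i * z * i := by
      rw [h2, mul_assoc, ← pow_add, ← two_mul, h1, hrinv, mul_assoc]
    have h4 : z = (i * (r ^ k)⁻¹) * i * (i * (r ^ k)⁻¹)⁻¹ := by
      have : (i * (r ^ k)⁻¹) * i * (i * (r ^ k)⁻¹)⁻¹ = i * ((r ^ k)⁻¹ * i * r ^ k) * i⁻¹ := by group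
      rw [this, h3, hii]
      calc z = (i * i) * z * (i * i) := by rw [hi2]; group
        _ = _ := by group
    obtain ⟨b, hb, a, ha, e⟩ := fac_swap h.fac (i * (r ^ k)⁻¹)
    rw [e] at h4
    have h5 : z = b * i * b⁻¹ := by
      calc z = b * (a * i) * a⁻¹ * b⁻¹ := by rw [h4]; group
        _ = b * (i * a) * a⁻¹ * b⁻¹ := by rw [(hcA a ha).eq]
        _ = _ := by group
    have h6 : i = z := by
      calc i = b⁻¹ * (b * i * b⁻¹) * b := by group
        _ = b⁻¹ * (z * b) := by rw [← h5]; group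
        _ = z := by rw [← (hcB b hb).eq, inv_mul_cancel_left]
    exact hi (h.disj i (h.dA.le hiY) (h6 ▸ h.dB.le hzX))

theorem goodPair (h : DihedralCore A Y B X) : GoodPair A B X := by
  obtain ⟨y, hy, hyX⟩ := h.dB.ne
  obtain ⟨a, ha, haY⟩ := h.dA.ne
  have hsqB : ∀ y' ∈ B, y' ∉ X → y' * y' = y * y := fun y' hy' hyX' =>
    h.dB.mul_self_eq hy' hyX' hy hyX
  have hsqA : ∀ a' ∈ A, a' ∉ Y → a' * a' = a * a := fun a' ha' haY' =>
    h.dA.mul_self_eq ha' haY' ha haY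
  by_cases hz : y * y = 1
  · exact Or.inr fun x hx a ha =>
      h.good_of_dihedral (fun y' hy' hyX' => (hsqB y' hy' hyX').trans hz) hx ha
  by_cases hi : a * a = 1
  · exact GoodPair.swap h.fac h.dA h.dB (Or.inr fun x hx b hb =>
      h.symm.good_of_dihedral (fun y' hy' hyX' => (hsqA y' hy' hyX').trans hi) hx hb)
  · exact (h.false_of_quaternion hi hz hsqA hsqB (h.dA.mul_mem a ha haY a ha haY)
      (h.dB.mul_mem y hy hyX y hy hyX) (h.dA.mul_self_mul_self ha haY)
      (h.dB.mul_self_mul_self hy hyX)).elim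

end DihedralCore

/-! ### Reduction to the core for two nonabelian factors -/

section Reduction

variable {G : Type*} [Group G] {A Y B X : Subgroup G}

/-- A failing pair still fails modulo `N`. There `A` cannot become abelian, by the abelian case, so
it keeps its type. By the swap, the intersection of the factors lies in both `X` and `Y`, so it is
normal and hence trivial; the quotient is then a `DihedralCore`. -/
theorem false_of_maximal (fac : ∀ g : G, ∃ a ∈ A, ∃ b ∈ B, g = a * b) (dA : DihLike A Y)
    (dB : DihLike B X) (hbad : ¬ GoodPair A B X) {N : Subgroup G} (hN : N.Normal)
    (hNX : ∀ a ∈ A, ∀ n ∈ N, a * n ∈ B → a * n ∈ X)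
    (hmax : ∀ M : Subgroup G, M.Normal → N ≤ M → (∀ n ∈ M, ∀ m ∈ M,
      (∀ a ∈ A, a * n ∈ B → a * n ∈ X) ∨ (∀ b ∈ B, b * m ∈ A → b * m ∈ Y)) → M ≤ N) : False := by
  have hNX' : ∀ n ∈ N, n ∈ B → n ∈ X := fun n hn hnB => by
    simpa using hNX 1 A.one_mem n hn (by simpa using hnB)
  by_cases hXN : X ≤ N
  · exact hbad (Or.inr fun x hx a ha => good_of_le hN fac hNX hXN hx ha)
  obtain ⟨x₀, hx₀, hx₀N⟩ := SetLike.not_le_iff_exists.1 hXN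
  set f := QuotientGroup.mk' N with hf
  have hf1 : ∀ g, f g = 1 ↔ g ∈ N := fun g => by
    rw [hf, QuotientGroup.mk'_apply, QuotientGroup.eq_one_iff]
  have facf := fac_map (QuotientGroup.mk'_surjective N) fac
  have dBf : DihLike (B.map f) (X.map f) :=
    dB.map f hx₀ (fun hc => hx₀N ((hf1 _).1 hc)) fun y hy hyX hc => hyX (hNX' y ((hf1 y).1 hc) hy)
  have hle : ∀ g ∈ A.map f, g ∈ B.map f → g ∈ X.map f := by
    rintro _ ⟨u, hu, rfl⟩ ⟨b, hb, e⟩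
    rw [← e]
    refine ⟨b, ?_, rfl⟩
    rw [hf, QuotientGroup.mk'_apply, QuotientGroup.mk'_apply, eq_comm, QuotientGroup.eq] at e
    have := hNX u hu _ e (by simpa using hb)
    simpa using this
  have hbadf : ¬ GoodPair (A.map f) (B.map f) (X.map f) := by
    rintro (⟨a, ha, haB, haX⟩ | h)
    · exact haX (hle a ha haB)
    · refine hbad (Or.inr fun x hx a ha => good_of_quotient (N := N) fac dB.le hNX ?_)
      rw [map_mul]
      exact h _ ⟨x, hx, rfl⟩ _ ⟨a, ha, rfl⟩
  have hAN : ∀ a ∈ A, a ∉ Y → f a ≠ 1 := by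
    intro a ha haY hc
    have hA := dA.le_of_mem_normal hN ha haY ((hf1 a).1 hc)
    refine hbadf (good_of_abelian facf ?_ dBf)
    rintro _ ⟨u, hu, rfl⟩ _ ⟨v, hv, rfl⟩
    rw [(hf1 u).2 (hA hu), (hf1 v).2 (hA hv)]
  have hYN : ∃ y ∈ Y, f y ≠ 1 := by
    by_contra! hc
    refine hbadf (good_of_abelian facf ?_ dBf)
    rintro _ ⟨u, hu, rfl⟩ _ ⟨v, hv, rfl⟩
    by_cases huY : u ∈ Y
    · rw [hc u huY, one_mul, mul_one]
    by_cases hvY : v ∈ Y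
    · rw [hc v hvY, one_mul, mul_one]
    have := hc _ (dA.mul_mem u hu huY _ (A.inv_mem hv) (inv_notMem hvY))
    rw [map_mul, map_inv, mul_inv_eq_one] at this
    rw [this]
  obtain ⟨y₀, hy₀, hy₀N⟩ := hYN
  have dAf : DihLike (A.map f) (Y.map f) := dA.map f hy₀ hy₀N hAN
  have hNY : ∀ n ∈ N, n ∈ A → n ∈ Y := fun n hn hnA => by
    by_contra hnY
    exact hAN n hnA hnY ((hf1 n).2 hn)
  have hle' : ∀ g ∈ A.map f, g ∈ B.map f → g ∈ Y.map f := by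
    intro g hgA hgB
    by_contra hgY
    exact hbadf (GoodPair.swap facf dAf dBf (Or.inl ⟨g, hgB, hgA, hgY⟩))
  have hmaxf : ∀ M : Subgroup (G ⧸ N), M.Normal → M ≠ ⊥ →
      (∃ a ∈ A.map f, ∃ m ∈ M, a * m ∈ B.map f ∧ a * m ∉ X.map f) ∧
      (∃ b ∈ B.map f, ∃ m ∈ M, b * m ∈ A.map f ∧ b * m ∉ Y.map f) := by
    intro M hM hMb
    by_contra hcon
    apply hMb
    have hle := hmax (M.comap f) (hM.comap _) (fun n hn => by
      rw [Subgroup.mem_comap, (hf1 n).2 hn]; exact M.one_mem) (fun n hn m hm => by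
        by_contra! hnm
        obtain ⟨⟨a, ha, h1, h2⟩, ⟨b, hb, h3, h4⟩⟩ := hnm
        refine hcon ⟨⟨f a, ⟨a, ha, rfl⟩, f n, hn, ?_⟩, ⟨f b, ⟨b, hb, rfl⟩, f m, hm, ?_⟩⟩
        · rw [← map_mul]
          exact ⟨⟨_, h1, rfl⟩, fun hc => h2 ((mem_map_of_quotient dB.le hNX' h1).1 hc)⟩
        · rw [← map_mul]
          exact ⟨⟨_, h3, rfl⟩, fun hc => h4 ((mem_map_of_quotient dA.le hNY h3).1 hc)⟩)
    rw [Subgroup.eq_bot_iff_forall]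
    intro m hm
    obtain ⟨g, rfl⟩ := QuotientGroup.mk'_surjective N m
    exact (hf1 g).2 (hle hm)
  have hdisj : ∀ g ∈ A.map f, g ∈ B.map f → g = 1 := by
    have hn : (A.map f ⊓ B.map f).Normal := dBf.normal_of_conj_mem facf
      (fun g hg => hle g hg.1 hg.2) fun a ha x hx =>
        dAf.conj_mem_of_le (H := A.map f ⊓ B.map f) (fun g hg => hle' g hg.1 hg.2) ha hx
    intro g hgA hgB
    by_contra hg
    obtain ⟨⟨a, ha, m, hm, hB, hX⟩, -⟩ := hmaxf _ hn fun hb => hg (by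
      have : g ∈ A.map f ⊓ B.map f := ⟨hgA, hgB⟩
      rwa [hb, Subgroup.mem_bot] at this)
    exact hX (hle _ (Subgroup.mul_mem _ ha hm.1) hB)
  exact hbadf (DihedralCore.goodPair
    ⟨facf, dAf, dBf, hdisj, fun M h1 h2 => (hmaxf M h1 h2).1, fun M h1 h2 => (hmaxf M h1 h2).2⟩)

theorem goodPair_of_dihLike (fac : ∀ g : G, ∃ a ∈ A, ∃ b ∈ B, g = a * b) (dA : DihLike A Y)
    (dB : DihLike B X) : GoodPair A B X := by
  by_contra hbad
  have hbad' : ¬ GoodPair B A Y := fun h => hbad (GoodPair.swap fac dA dB h)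
  -- Quantifying the disjunction over independent `n` and `m` says that one alternative holds on all
  -- of `N`, in a form stable under unions of chains. The symmetric choice allows the swap in either
  -- case.
  obtain ⟨N, hN, hR, hmax⟩ := exists_maximal_normal
    (fun n m : G => (∀ a ∈ A, a * n ∈ B → a * n ∈ X) ∨ (∀ b ∈ B, b * m ∈ A → b * m ∈ Y)) (by
      left
      intro a ha haB
      rw [mul_one] at haB ⊢
      by_contra haX
      exact hbad (Or.inl ⟨a, ha, haB, haX⟩))
  by_cases h1 : ∀ a ∈ A, ∀ n ∈ N, a * n ∈ B → a * n ∈ X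
  · exact false_of_maximal fac dA dB hbad hN h1 hmax
  · push Not at h1
    obtain ⟨a, ha, n, hn, hB, hX⟩ := h1
    refine false_of_maximal (fac_swap fac) dB dA hbad' hN (fun b hb m hm => ?_)
      (fun M hM hle h => hmax M hM hle fun n hn m hm => (h m hm n hn).symm)
    rcases hR n hn m hm with h2 | h2
    · exact absurd (h2 a ha hB) hX
    · exact h2 b hb

end Reduction

/-! ### Itô's theorem -/

section Metabelian

variable {G : Type*} [Group G] {A B X Y : Subgroup G}

theorem derivedSeries_two_eq_bot (N : Subgroup G) (h1 : ∀ g h : G, g * h * g⁻¹ * h⁻¹ ∈ N)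
    (h2 : ∀ s ∈ N, ∀ t ∈ N, s * t = t * s) : derivedSeries G 2 = ⊥ := by
  have hle : derivedSeries G 1 ≤ N := by
    rw [derivedSeries_succ, derivedSeries_zero, Subgroup.commutator_le]
    exact fun g _ h _ => h1 g h
  rw [derivedSeries_succ, Subgroup.commutator_eq_bot_iff_le_centralizer]
  intro s hs
  rw [Subgroup.mem_centralizer_iff]
  exact fun t ht => h2 t (hle ht) s (hle hs)

/-- Itô's theorem: the commutators of a product of two abelian groups lie in an abelian normal
subgroup. -/
theorem exists_abelian_of_fac (fac : ∀ g : G, ∃ a ∈ A, ∃ b ∈ B, g = a * b)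
    (hA : ∀ x ∈ A, ∀ y ∈ A, x * y = y * x) (hB : ∀ x ∈ B, ∀ y ∈ B, x * y = y * x) :
    ∃ N : Subgroup G, N.Normal ∧ (∀ g h : G, g * h * g⁻¹ * h⁻¹ ∈ N) ∧
      ∀ s ∈ N, ∀ t ∈ N, s * t = t * s := by
  set T : Set G := {t | ∃ a ∈ A, ∃ x ∈ B, t = a⁻¹ * x⁻¹ * a * x} with hT
  set N := Subgroup.closure T with hN
  have hTA : ∀ c ∈ A, ∀ t ∈ T, c * t * c⁻¹ ∈ T := by
    rintro c hc _ ⟨a, ha, x, hx, rfl⟩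
    obtain ⟨c₁, hc₁, x₁, hx₁, e⟩ := fac (x * c⁻¹)
    exact ⟨a, ha, x₁, hx₁, conj_commutator_left hA ha hc hc₁ e⟩
  have hTB : ∀ w ∈ B, ∀ t ∈ T, w * t * w⁻¹ ∈ T := by
    rintro w hw _ ⟨a, ha, x, hx, rfl⟩
    obtain ⟨a₁, ha₁, w₁, hw₁, e⟩ := fac (w * a⁻¹)
    refine ⟨a₁⁻¹, A.inv_mem ha₁, x, hx, ?_⟩
    rw [conj_commutator_right hB hx hw hw₁ e, inv_inv]
  have hNn : N.Normal := by
    refine ⟨fun n hn g => ?_⟩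
    induction hn using Subgroup.closure_induction with
    | mem t ht =>
      obtain ⟨a, ha, b, hb, rfl⟩ := fac g
      have : a * b * t * (a * b)⁻¹ = a * (b * t * b⁻¹) * a⁻¹ := by group
      rw [this]
      exact Subgroup.subset_closure (hTA a ha _ (hTB b hb t ht))
    | one => simp
    | mul x y _ _ hx hy =>
      have : g * (x * y) * g⁻¹ = (g * x * g⁻¹) * (g * y * g⁻¹) := by group
      rw [this]; exact N.mul_mem hx hy
    | inv x _ hx =>
      have : g * x⁻¹ * g⁻¹ = (g * x * g⁻¹)⁻¹ := by group
      rw [this]; exact N.inv_mem hx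
  have hTc : ∀ s ∈ T, ∀ t ∈ T, s * t = t * s := by
    rintro _ ⟨a, ha, x, hx, rfl⟩ _ ⟨c, hc, w, hw, rfl⟩
    obtain ⟨c₁, hc₁, x₁, hx₁, e1⟩ := fac (x * c⁻¹)
    obtain ⟨a₁, ha₁, w₁, hw₁, e2⟩ := fac (w * a⁻¹)
    exact commutator_commute hA hB ha hc hx hw ha₁ hc₁ hx₁ hw₁ e1 e2
  refine ⟨N, hNn, ?_, closure_comm hTc⟩
  have hAB : ∀ a ∈ A, ∀ b ∈ B, (a : G ⧸ N) * b = b * a := by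
    intro a ha b hb
    rw [← QuotientGroup.mk_mul, ← QuotientGroup.mk_mul, eq_comm, QuotientGroup.eq]
    refine Subgroup.subset_closure ⟨a, ha, b, hb, ?_⟩
    group
  have hAA : ∀ a ∈ A, ∀ b ∈ A, (a : G ⧸ N) * b = b * a := by
    intro a ha b hb
    rw [← QuotientGroup.mk_mul, hA a ha b hb, QuotientGroup.mk_mul]
  have hBB : ∀ a ∈ B, ∀ b ∈ B, (a : G ⧸ N) * b = b * a := by
    intro a ha b hb
    rw [← QuotientGroup.mk_mul, hB a ha b hb, QuotientGroup.mk_mul]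
  have hall : ∀ g h : G, Commute (g : G ⧸ N) (h : G ⧸ N) := by
    intro g h
    obtain ⟨a, ha, b, hb, rfl⟩ := fac g
    obtain ⟨a', ha', b', hb', rfl⟩ := fac h
    rw [QuotientGroup.mk_mul, QuotientGroup.mk_mul]
    exact Commute.mul_left (Commute.mul_right (hAA a ha a' ha') (hAB a ha b' hb'))
      (Commute.mul_right (hAB a' ha' b hb).symm (hBB b hb b' hb'))
  intro g h
  rw [← QuotientGroup.eq_one_iff]
  simp only [QuotientGroup.mk_mul, QuotientGroup.mk_inv]
  rw [(hall g h).eq]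
  group

end Metabelian

/-! ### Products of two quasicyclic groups -/

section QuasiProduct

variable {G : Type*} [Group G] {X Y : Subgroup G}

theorem commute_of_fac (fac : ∀ g : G, ∃ x ∈ X, ∃ y ∈ Y, g = x * y) {w : G}
    (hX : ∀ x ∈ X, Commute w x) (hY : ∀ y ∈ Y, Commute w y) (g : G) : Commute w g := by
  obtain ⟨x, hx, y, hy, rfl⟩ := fac g
  exact (hX x hx).mul_right (hY y hy)

/-- An element of finite order which centralizes a quasicyclic group `Y` modulo central elements
centralizes `Y`. -/
theorem Quasi.commute_of_central (hY : Quasi Y) {w : G} (hw : IsOfFinOrder w)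
    (hc : ∀ y ∈ Y, ∀ g : G, Commute (w * y * w⁻¹ * y⁻¹) g) {y : G} (hy : y ∈ Y) : Commute w y := by
  obtain ⟨n, hn, hwn⟩ := isOfFinOrder_iff_pow_eq_one.1 hw
  obtain ⟨u, hu, rfl⟩ := hY.exists_pow_eq hn hy
  set c := w * u * w⁻¹ * u⁻¹ with hcdef
  have hcg : ∀ g, Commute c g := hc u hu
  have e1 : w * u * w⁻¹ = c * u := by rw [hcdef]; group
  have e2 : ∀ k : ℕ, w ^ k * u * (w ^ k)⁻¹ = c ^ k * u := by
    intro k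
    induction k with
    | zero => simp
    | succ k ih =>
      calc w ^ (k + 1) * u * (w ^ (k + 1))⁻¹ = w * (w ^ k * u * (w ^ k)⁻¹) * w⁻¹ := by
            rw [pow_succ']; group
        _ = (w * c ^ k) * u * w⁻¹ := by rw [ih]; group
        _ = (c ^ k * w) * u * w⁻¹ := by rw [((hcg w).pow_left k).eq]
        _ = c ^ k * (w * u * w⁻¹) := by group
        _ = c ^ (k + 1) * u := by rw [e1, pow_succ]; group
  have e3 := e2 n
  rw [hwn, inv_one, mul_one, one_mul] at e3
  have hcn : c ^ n = 1 := mul_eq_right.1 e3.symm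
  have e4 : w * u ^ n * w⁻¹ = u ^ n := by
    rw [← conj_pow, e1, (hcg u).mul_pow, hcn, one_mul]
  exact mul_inv_eq_iff_eq_mul.1 e4

/-- In a product `G = XY` of quasicyclic groups, an element of prime order of `X` lying in an
abelian normal subgroup is central. -/
theorem central_of_mem_abelian (fac : ∀ g : G, ∃ x ∈ X, ∃ y ∈ Y, g = x * y) (hX : Quasi X)
    (hY : Quasi Y) {T : Subgroup G} (hTn : T.Normal) (hT : ∀ s ∈ T, ∀ t ∈ T, s * t = t * s) {w : G}
    (hw : w ∈ X) (hwp : (orderOf w).Prime) (hwT : w ∈ T) (g : G) : Commute w g := by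
  refine commute_of_fac fac (fun x hx => hX.comm w hw x hx) (fun y hy => ?_) g
  set M := Subgroup.normalClosure {w} with hM
  have hMn : M.Normal := Subgroup.normalClosure_normal
  have hwM : w ∈ M := Subgroup.subset_normalClosure (Set.mem_singleton w)
  have hMT : M ≤ T := Subgroup.normalClosure_le_normal (by simpa using hwT)
  have hc : ∀ m ∈ M, ∀ n ∈ M, Commute m n := fun m hm n hn => hT m (hMT hm) n (hMT hn)
  by_cases hYM : Y ≤ X ⊔ M
  · obtain ⟨x, hx, m, hm, rfl⟩ := Subgroup.mem_sup_of_normal_right.1 (hYM hy)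
    exact Commute.mul_right (hX.comm w hw x hx) (hc w hwM m hm)
  · obtain ⟨y₀, hy₀, hyM⟩ := SetLike.not_le_iff_exists.1 hYM
    have hfin : ((Y ⊓ (X ⊔ M) : Subgroup G) : Set G).Finite :=
      hY.finite_of_not_mem inf_le_left hy₀ fun hc => hyM hc.2
    have hMfin := DihedralCore.finite_of_finite_inter (fac_swap fac) (M := M) le_sup_right
      le_sup_left hfin ((hX.finite_torsion hwp.pos).subset
        fun m hm => ⟨hm.2, normalClosure_singleton_pow hc hm.1⟩)
    exact (hY.commute_of_finite_normal hMfin hy hwM).symm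

/-- In a product of quasicyclic groups, `X` is central if a finite normal subgroup contains
the commutators. -/
theorem central_of_finite (fac : ∀ g : G, ∃ x ∈ X, ∃ y ∈ Y, g = x * y) (hX : Quasi X)
    (hY : Quasi Y) {T : Subgroup G} (hTn : T.Normal) (hTc : ∀ g h : G, g * h * g⁻¹ * h⁻¹ ∈ T)
    (hfin : (T : Set G).Finite) {w : G} (hw : w ∈ X) (g : G) : Commute w g := by
  refine commute_of_fac fac (fun x hx => hX.comm w hw x hx) (fun y hy => ?_) g
  refine hY.commute_of_central (hX.tors w hw) (fun y hy g => ?_) hy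
  exact commute_of_fac fac (fun x hx => (hX.commute_of_finite_normal hfin hx (hTc w y)).symm)
    (fun y' hy' => (hY.commute_of_finite_normal hfin hy' (hTc w y)).symm) g

/-- Either `Y ≤ XV`, whence `G = XV` and `T ∩ X = 1` gives `T ≤ V`, or `Y ∩ XV` is finite, and then
so is `V`. -/
theorem normal_finite_or_ge (fac : ∀ g : G, ∃ x ∈ X, ∃ y ∈ Y, g = x * y)
    (hY : Quasi Y) {T V : Subgroup G} (hTX : ∀ x ∈ X, x ∈ T → x = 1) (hVn : V.Normal)
    (hVT : V ≤ T) : (V : Set G).Finite ∨ T ≤ V := by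
  by_cases hYV : Y ≤ X ⊔ V
  · right
    intro t ht
    obtain ⟨x, hx, y, hy, rfl⟩ := fac t
    obtain ⟨x', hx', v, hv, rfl⟩ := Subgroup.mem_sup_of_normal_right.1 (hYV hy)
    rw [← mul_assoc] at ht ⊢
    rw [hTX _ (X.mul_mem hx hx') ((T.mul_mem_cancel_right (hVT hv)).1 ht), one_mul]
    exact hv
  · left
    obtain ⟨y₀, hy₀, hyV⟩ := SetLike.not_le_iff_exists.1 hYV
    have hfin : ((Y ⊓ (X ⊔ V) : Subgroup G) : Set G).Finite :=
      hY.finite_of_not_mem inf_le_left hy₀ fun hc => hyV hc.2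
    exact DihedralCore.finite_of_finite_inter (fac_swap fac) (M := V) le_sup_right
      le_sup_left hfin ((Set.finite_singleton (1 : G)).subset
        fun m hm => hTX m hm.2 (hVT hm.1))

/-- Let `T` be Itô's abelian normal subgroup. After the easy cases `T` is infinite and meets `X` and
`Y` trivially, and its infinite `G`-normal subgroups equal `T`. Apply this to the kernel and image
of the commutator map with `w`: an infinite kernel makes `w` central, and an infinite image makes
`w` conjugate into `Y`. -/
theorem exists_central (fac : ∀ g : G, ∃ x ∈ X, ∃ y ∈ Y, g = x * y) (hX : Quasi X)
    (hY : Quasi Y) : ∃ g : G, g ≠ 1 ∧ (g ∈ X ∨ g ∈ Y) ∧ ∀ h : G, Commute g h := by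
  obtain ⟨T, hTn, hTg, hTc⟩ := exists_abelian_of_fac fac hX.comm hY.comm
  obtain ⟨w, hw, hwp, hwm⟩ := hX.exists_minimal
  obtain ⟨d, hd, hdp, hdm⟩ := hY.exists_minimal
  have hw1 := ne_one_of_orderOf_prime hwp
  by_cases hwT : w ∈ T
  · exact ⟨w, hw1, Or.inl hw, central_of_mem_abelian fac hX hY hTn hTc hw hwp hwT⟩
  by_cases hdT : d ∈ T
  · exact ⟨d, ne_one_of_orderOf_prime hdp, Or.inr hd,
      central_of_mem_abelian (fac_swap fac) hY hX hTn hTc hd hdp hdT⟩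
  by_cases hTfin : (T : Set G).Finite
  · exact ⟨w, hw1, Or.inl hw, central_of_finite fac hX hY hTn hTg hTfin hw⟩
  by_cases hwY : w ∈ Y
  · exact ⟨w, hw1, Or.inl hw, commute_of_fac fac (fun x hx => hX.comm w hw x hx)
      fun y hy => hY.comm w hwY y hy⟩
  have hTX : ∀ x ∈ X, x ∈ T → x = 1 := by
    intro x hx hxT
    by_contra hx1
    exact hwT ((Subgroup.zpowers_le.2 hxT) (hwm x hx hx1))
  have hTY : ∀ y ∈ Y, y ∈ T → y = 1 := by
    intro y hy hyT
    by_contra hy1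
    exact hdT ((Subgroup.zpowers_le.2 hyT) (hdm y hy hy1))
  have hinf : ∀ {V : Subgroup G}, V.Normal → V ≤ T → (V : Set G).Infinite → T ≤ V :=
    fun hV hVT hVi => (normal_finite_or_ge fac hY hTX hV hVT).resolve_left hVi
  have hXT : X ≤ Y ⊔ T := by
    by_contra hc
    obtain ⟨x₀, hx₀, hxT⟩ := SetLike.not_le_iff_exists.1 hc
    have hfin : ((X ⊓ (Y ⊔ T) : Subgroup G) : Set G).Finite :=
      hX.finite_of_not_mem inf_le_left hx₀ fun hc => hxT hc.2
    exact hTfin (DihedralCore.finite_of_finite_inter fac (M := T) le_sup_right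
      le_sup_left hfin ((Set.finite_singleton (1 : G)).subset fun m hm => hTY m hm.2 hm.1))
  have hYT : Y ≤ X ⊔ T := by
    by_contra hc
    obtain ⟨y₀, hy₀, hyT⟩ := SetLike.not_le_iff_exists.1 hc
    have hfin : ((Y ⊓ (X ⊔ T) : Subgroup G) : Set G).Finite :=
      hY.finite_of_not_mem inf_le_left hy₀ fun hc => hyT hc.2
    exact hTfin (DihedralCore.finite_of_finite_inter (fac_swap fac) (M := T) le_sup_right
      le_sup_left hfin ((Set.finite_singleton (1 : G)).subset fun m hm => hTX m hm.2 hm.1))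
  have facT : ∀ g : G, ∃ x ∈ X, ∃ t ∈ T, g = x * t := by
    intro g
    obtain ⟨x, hx, y, hy, rfl⟩ := fac g
    obtain ⟨x', hx', t, ht, rfl⟩ := Subgroup.mem_sup_of_normal_right.1 (hYT hy)
    exact ⟨x * x', X.mul_mem hx hx', t, ht, by rw [mul_assoc]⟩
  -- `t ↦ [w, t]` is an endomorphism of `T` commuting with the action of `X`
  set φ : G → G := fun t => w⁻¹ * t⁻¹ * w * t with hφ
  have hφT : ∀ t ∈ T, φ t ∈ T := fun t ht => by
    have := hTn.conj_mem _ (T.inv_mem ht) w⁻¹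
    rw [inv_inv] at this
    exact T.mul_mem this ht
  have hφmul : ∀ s ∈ T, ∀ t ∈ T, φ (s * t) = φ s * φ t := by
    intro s hs t ht
    have h1 : w⁻¹ * s⁻¹ * w ∈ T := by
      simpa using hTn.conj_mem _ (T.inv_mem hs) w⁻¹
    calc φ (s * t) = (w⁻¹ * t⁻¹ * w) * ((w⁻¹ * s⁻¹ * w) * s) * t := by rw [hφ]; group
      _ = ((w⁻¹ * s⁻¹ * w) * s) * (w⁻¹ * t⁻¹ * w) * t := by
          rw [hTc (w⁻¹ * t⁻¹ * w) (by simpa using hTn.conj_mem _ (T.inv_mem ht) w⁻¹) _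
            (T.mul_mem h1 hs)]
      _ = φ s * φ t := by rw [hφ]; group
  have hφconj : ∀ x ∈ X, ∀ t : G, φ (x * t * x⁻¹) = x * φ t * x⁻¹ := by
    intro x hx t
    have hc : Commute x w := hX.comm x hx w hw
    have h1 : x⁻¹ * w * x = w := by rw [mul_assoc, ← hc.eq, inv_mul_cancel_left]
    have h2 : w⁻¹ * x = x * w⁻¹ := (hc.inv_right.eq).symm
    calc φ (x * t * x⁻¹) = (w⁻¹ * x) * t⁻¹ * (x⁻¹ * w * x) * t * x⁻¹ := by rw [hφ]; group
      _ = _ := by rw [h1, h2, hφ]; group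
  let I : Subgroup G :=
    { carrier := {g | ∃ t ∈ T, φ t = g}
      one_mem' := ⟨1, T.one_mem, by simp [hφ]⟩
      mul_mem' := by
        rintro _ _ ⟨s, hs, rfl⟩ ⟨t, ht, rfl⟩
        exact ⟨s * t, T.mul_mem hs ht, hφmul s hs t ht⟩
      inv_mem' := by
        rintro _ ⟨t, ht, rfl⟩
        refine ⟨t⁻¹, T.inv_mem ht, ?_⟩
        apply eq_inv_of_mul_eq_one_left
        rw [← hφmul _ (T.inv_mem ht) t ht]
        simp [hφ] }
  have hIT : I ≤ T := by
    rintro _ ⟨t, ht, rfl⟩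
    exact hφT t ht
  have normal_of : ∀ V : Subgroup G, V ≤ T → (∀ x ∈ X, ∀ v ∈ V, x * v * x⁻¹ ∈ V) → V.Normal := by
    intro V hVT hV
    refine ⟨fun v hv g => ?_⟩
    obtain ⟨x, hx, t, ht, rfl⟩ := facT g
    have e : x * t * v * (x * t)⁻¹ = x * (t * v * t⁻¹) * x⁻¹ := by group
    rw [e, hTc t ht v (hVT hv), mul_inv_cancel_right]
    exact hV x hx v hv
  have hIn : I.Normal := by
    refine normal_of I hIT ?_
    rintro x hx _ ⟨t, ht, rfl⟩
    exact ⟨x * t * x⁻¹, hTn.conj_mem t ht x, hφconj x hx t⟩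
  let K : Subgroup G := T ⊓ Subgroup.centralizer {w}
  have hK : ∀ {t : G}, t ∈ K ↔ t ∈ T ∧ Commute t w := by
    intro t
    rw [Subgroup.mem_inf, Subgroup.mem_centralizer_singleton_iff]
    exact ⟨fun h => ⟨h.1, h.2⟩, fun h => ⟨h.1, h.2⟩⟩
  have hKn : K.Normal := by
    refine normal_of K inf_le_left ?_
    intro x hx v hv
    obtain ⟨hvT, hvw⟩ := hK.1 hv
    have hc : Commute x w := hX.comm x hx w hw
    exact hK.2 ⟨hTn.conj_mem v hvT x, (hc.mul_left hvw).mul_left hc.inv_left⟩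
  by_cases hKfin : (K : Set G).Finite
  · exfalso
    have hIinf : (I : Set G).Infinite := by
      intro hIfin
      refine hTfin (Set.Finite.of_finite_fibers φ (hIfin.subset ?_) ?_)
      · rintro _ ⟨t, ht, rfl⟩
        exact ⟨t, ht, rfl⟩
      · rintro _ ⟨t, ht, rfl⟩
        refine (hKfin.image (fun k => k * t)).subset ?_
        rintro s ⟨hs, hst⟩
        have hst : φ s = φ t := hst
        refine ⟨s * t⁻¹, hK.2 ⟨T.mul_mem hs (T.inv_mem ht), ?_⟩, by simp⟩
        have h1 : φ (s * t⁻¹) = 1 := by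
          have := hφmul (s * t⁻¹) (T.mul_mem hs (T.inv_mem ht)) t ht
          rw [inv_mul_cancel_right, hst] at this
          exact mul_eq_right.1 this.symm
        have h2 : w * (s * t⁻¹) = (s * t⁻¹) * w := by
          calc w * (s * t⁻¹) = (s * t⁻¹) * w * φ (s * t⁻¹) := by rw [hφ]; group
            _ = _ := by rw [h1, mul_one]
        exact h2.symm
    obtain ⟨y, hy, t, ht, e⟩ := Subgroup.mem_sup_of_normal_right.1 (hXT hw)
    obtain ⟨u, hu, hut⟩ := hinf hIn hIT hIinf (T.inv_mem ht)
    have e1 : y = u⁻¹ * w * u := by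
      have : y = w * t⁻¹ := by rw [← e]; group
      rw [this, ← hut, hφ]
      group
    obtain ⟨x, hx, y', hy', rfl⟩ := fac u
    have hc : Commute x w := hX.comm x hx w hw
    have e2 : y = y'⁻¹ * w * y' := by
      calc y = y'⁻¹ * (x⁻¹ * (w * x)) * y' := by rw [e1]; group
        _ = _ := by rw [← hc.eq, inv_mul_cancel_left]
    apply hwY
    have e3 : w = y' * y * y'⁻¹ := by rw [e2]; group
    rw [e3]
    exact Y.mul_mem (Y.mul_mem hy' hy) (Y.inv_mem hy')
  · refine ⟨w, hw1, Or.inl hw, fun g => ?_⟩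
    obtain ⟨x, hx, t, ht, rfl⟩ := facT g
    have := (hK.1 (hinf hKn inf_le_left hKfin ht)).2
    exact Commute.mul_right (hX.comm w hw x hx) this.symm

/-- A product of two quasicyclic groups is abelian. -/
theorem Quasi.commute_of_fac (fac : ∀ g : G, ∃ x ∈ X, ∃ y ∈ Y, g = x * y) (hX : Quasi X)
    (hY : Quasi Y) {x y : G} (hx : x ∈ X) (hy : y ∈ Y) : Commute x y := by
  by_contra hxy
  -- Modulo the center there is a nontrivial central element coming from `X` or `Y`. By
  -- `Quasi.commute_of_central` its preimage is already central, a contradiction.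
  set Z := Subgroup.center G with hZ
  have hmem : ∀ {g : G}, g ∈ Z ↔ ∀ h, Commute g h := by
    intro g
    rw [hZ, Subgroup.mem_center_iff]
    exact ⟨fun h k => (h k).symm, fun h k => (h k).symm⟩
  set f := QuotientGroup.mk' Z with hf
  have hf1 : ∀ g, f g = 1 ↔ g ∈ Z := fun g => by
    rw [hf, QuotientGroup.mk'_apply, QuotientGroup.eq_one_iff]
  have hxZ : f x ≠ 1 := fun hc => hxy (hmem.1 ((hf1 x).1 hc) y)
  have hyZ : f y ≠ 1 := fun hc => hxy (hmem.1 ((hf1 y).1 hc) x).symm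
  obtain ⟨g, hg1, hg, hgc⟩ := exists_central
    (fac_map (f := f) (QuotientGroup.mk'_surjective Z) fac) (hX.map f hx hxZ) (hY.map f hy hyZ)
  have hlift : ∀ u v : G, Commute (f u) (f v) → ∀ k, Commute (u * v * u⁻¹ * v⁻¹) k := by
    intro u v huv
    rw [← hmem, ← hf1, map_mul, map_mul, map_mul, map_inv, map_inv, huv.eq]
    group
  rcases hg with ⟨u, hu, rfl⟩ | ⟨u, hu, rfl⟩
  · refine hg1 ((hf1 u).2 (hmem.2 (_root_.commute_of_fac fac (fun x hx => hX.comm u hu x hx)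
      fun y hy => hY.commute_of_central (hX.tors u hu) (fun y _ => hlift u y (hgc _)) hy)))
  · refine hg1 ((hf1 u).2 (hmem.2 (_root_.commute_of_fac fac
      (fun x hx => hX.commute_of_central (hY.tors u hu) (fun y _ => hlift u y (hgc _)) hx)
      fun y hy => hY.comm u hu y hy)))

end QuasiProduct

/-! ### Assembly of the main theorem -/

section Main

variable {G : Type*} [Group G] {A B X Y : Subgroup G}

theorem commutator_mem_of_mul_mem {H L : Subgroup G}
    (h : ∀ g ∈ H, g ∉ L → ∀ k ∈ H, k ∉ L → g * k ∈ L) {g k : G} (hg : g ∈ H) (hk : k ∈ H) :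
    g * k * g⁻¹ * k⁻¹ ∈ L := by
  have hgi := H.inv_mem hg
  have hki := H.inv_mem hk
  by_cases hgL : g ∈ L <;> by_cases hkL : k ∈ L
  · exact L.mul_mem (L.mul_mem (L.mul_mem hgL hkL) (L.inv_mem hgL)) (L.inv_mem hkL)
  · have e : g * k * g⁻¹ * k⁻¹ = g * ((k * g⁻¹) * k⁻¹) := by group
    rw [e]
    exact L.mul_mem hgL (h _ (H.mul_mem hk hgi) (mul_notMem_right (L.inv_mem hgL) hkL) _ hki
      (inv_notMem hkL))
  · exact L.mul_mem (h _ (H.mul_mem hg hk) (mul_notMem_right hkL hgL) _ hgi (inv_notMem hgL))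
      (L.inv_mem hkL)
  · rw [mul_assoc]
    exact L.mul_mem (h g hg hgL k hk hkL) (h _ hgi (inv_notMem hgL) _ hki (inv_notMem hkL))

theorem derivedSeries_two_subgroup {H : Subgroup G} (L : Subgroup G)
    (h1 : ∀ g ∈ H, ∀ k ∈ H, g * k * g⁻¹ * k⁻¹ ∈ L)
    (h2 : ∀ s ∈ L, ∀ t ∈ L, s * t = t * s) : derivedSeries H 2 = ⊥ :=
  derivedSeries_two_eq_bot (L.subgroupOf H) (fun g k => h1 g g.2 k k.2)
    fun s hs t ht => Subtype.ext (h2 s hs t ht)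

theorem Quasi.commute_of_fac_subgroup {H : Subgroup G} (hXH : X ≤ H) (hYH : Y ≤ H)
    (fac : ∀ g ∈ H, ∃ x ∈ X, ∃ y ∈ Y, g = x * y) (hX : Quasi X) (hY : Quasi Y) :
    ∀ s ∈ H, ∀ t ∈ H, s * t = t * s := by
  have hc : ∀ x ∈ X, ∀ y ∈ Y, Commute x y := by
    intro x hx y hy
    have := Quasi.commute_of_fac (X := X.subgroupOf H) (Y := Y.subgroupOf H) (fun g => by
      obtain ⟨a, ha, b, hb, e⟩ := fac g g.2
      exact ⟨⟨a, hXH ha⟩, ha, ⟨b, hYH hb⟩, hb, Subtype.ext e⟩) (hX.subgroupOf hXH)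
      (hY.subgroupOf hYH) (x := ⟨x, hXH hx⟩) (y := ⟨y, hYH hy⟩) hx hy
    exact congrArg Subtype.val this.eq
  intro s hs t ht
  obtain ⟨x, hx, y, hy, rfl⟩ := fac s hs
  obtain ⟨x', hx', y', hy', rfl⟩ := fac t ht
  exact Commute.mul_left (Commute.mul_right (hX.comm x hx x' hx') (hc x hx y' hy'))
      (Commute.mul_right (hc x' hx' y hy).symm (hY.comm y hy y' hy'))

theorem good_of_goodPair (fac : ∀ g : G, ∃ a ∈ A, ∃ b ∈ B, g = a * b) (dB : DihLike B X)
    (h : GoodPair A B X) : ∀ x ∈ X, ∀ a ∈ A, Good A X (x * a) := by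
  rcases h with ⟨c, hc, hcB, hcX⟩ | h
  · intro x _ a _
    obtain ⟨a', ha', b, hb, e⟩ := fac (x * a)
    by_cases hbX : b ∈ X
    · exact ⟨a', ha', b, hbX, e⟩
    · exact ⟨a' * c, A.mul_mem ha' hc, c⁻¹ * b,
        dB.mul_mem _ (B.inv_mem hcB) (inv_notMem hcX) b hb hbX, by rw [e]; group⟩
  · exact h

theorem fac_prodSubgroup_swap (h : ∀ x ∈ X, ∀ a ∈ A, Good A X (x * a)) {g : G}
    (hg : g ∈ prodSubgroup A X h) : ∃ x ∈ X, ∃ a ∈ A, g = x * a := by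
  obtain ⟨a, ha, x, hx, e⟩ := mem_prodSubgroup.1 (Subgroup.inv_mem _ hg)
  exact ⟨x⁻¹, X.inv_mem hx, a⁻¹, A.inv_mem ha, by rw [← mul_inv_rev, ← e, inv_inv]⟩

/-- For nonabelian `A`, the abelian case is applied to the product of `X` and `A`, with `A` in the
role of the nonabelian factor. Either `AX = YX`, or `XY` is a subgroup of index at most two in `AX`;
both are products of quasicyclic groups, hence abelian. -/
theorem metabelian_prodSubgroup (hA : (∀ x ∈ A, ∀ y ∈ A, x * y = y * x) ∨ ∃ Y, DihLike A Y)
    (hX : Quasi X) (h : ∀ x ∈ X, ∀ a ∈ A, Good A X (x * a)) :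
    derivedSeries (prodSubgroup A X h) 2 = ⊥ := by
  have hAM := le_prodSubgroup_left h
  have hXM := le_prodSubgroup_right h
  have hswap := fun g (hg : g ∈ prodSubgroup A X h) => fac_prodSubgroup_swap h hg
  set M := prodSubgroup A X h with hM
  rcases hA with hA | ⟨Y, dA⟩
  · obtain ⟨N, -, h1, h2⟩ := exists_abelian_of_fac (A := A.subgroupOf M) (B := X.subgroupOf M)
      (fun g => by
        obtain ⟨a, ha, x, hx, e⟩ := mem_prodSubgroup.1 g.2
        exact ⟨⟨a, hAM ha⟩, ha, ⟨x, hXM hx⟩, hx, Subtype.ext e⟩)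
      (fun x hx y hy => Subtype.ext (hA x hx y hy))
      (fun x hx y hy => Subtype.ext (hX.comm x hx y hy))
    exact derivedSeries_two_eq_bot N h1 h2
  · rcases goodPair_of_abelian_of_le hXM hAM hswap hX.comm dA with ⟨c, hc, hcA, hcY⟩ | hL
    · refine derivedSeries_two_subgroup M (fun g hg k hk => M.mul_mem (M.mul_mem (M.mul_mem hg hk)
        (M.inv_mem hg)) (M.inv_mem hk))
        (Quasi.commute_of_fac_subgroup (dA.le.trans hAM) hXM ?_ dA.quasi hX)
      intro g hg
      obtain ⟨a, ha, x, hx, e⟩ := mem_prodSubgroup.1 hg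
      by_cases haY : a ∈ Y
      · exact ⟨a, haY, x, hx, e⟩
      · exact ⟨a * c⁻¹, dA.mul_mem a ha haY _ (A.inv_mem hcA) (inv_notMem hcY), c * x,
          X.mul_mem hc hx, by rw [e]; group⟩
    · have hXL := le_prodSubgroup_left hL
      have hYL := le_prodSubgroup_right hL
      refine derivedSeries_two_subgroup (prodSubgroup X Y hL)
        (fun g hg k hk => commutator_mem_of_mul_mem (H := M) ?_ hg hk)
        (Quasi.commute_of_fac_subgroup hXL hYL (fun g hg => hg) hX dA.quasi)
      set L := prodSubgroup X Y hL with hLdef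
      intro g hg hgL k hk hkL
      obtain ⟨x, hx, a, ha, rfl⟩ := hswap g hg
      obtain ⟨a', ha', x', hx', rfl⟩ := mem_prodSubgroup.1 hk
      have haY : a ∉ Y := fun hc => hgL (L.mul_mem (hXL hx) (hYL hc))
      have haY' : a' ∉ Y := fun hc => hkL (L.mul_mem (hYL hc) (hXL hx'))
      have e : x * a * (a' * x') = x * (a * a') * x' := by group
      rw [e]
      exact L.mul_mem (L.mul_mem (hXL hx) (hYL (dA.mul_mem a ha haY a' ha' haY'))) (hXL hx')

theorem derivedSeries_succ_le_map {M : Subgroup G} (hM : derivedSeries G 1 ≤ M) (n : ℕ) :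
    derivedSeries G (n + 1) ≤ (derivedSeries M n).map M.subtype := by
  induction n with
  | zero => rwa [derivedSeries_zero M, ← MonoidHom.range_eq_map, Subgroup.range_subtype]
  | succ n ih =>
    rw [derivedSeries_succ, derivedSeries_succ M n, Subgroup.map_commutator]
    exact Subgroup.commutator_mono ih ih

/-- The conclusion of the main theorem for a factor `B` of dihedral type. -/
theorem exists_metabelian_prod (fac : ∀ g : G, ∃ a ∈ A, ∃ b ∈ B, g = a * b)
    (hA : (∀ x ∈ A, ∀ y ∈ A, x * y = y * x) ∨ ∃ Y, DihLike A Y) (dB : DihLike B X) :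
    ∃ M : Subgroup G, (∀ g, g ∈ M ↔ Good A X g) ∧ derivedSeries M 2 = ⊥ ∧
      (A ⊓ B ≤ X → M.index = 2) ∧ (¬ A ⊓ B ≤ X → M.index = 1) ∧ derivedSeries G 3 = ⊥ := by
  have h : ∀ x ∈ X, ∀ a ∈ A, Good A X (x * a) := by
    refine good_of_goodPair fac dB ?_
    rcases hA with hA | ⟨Y, dA⟩
    · exact good_of_abelian fac hA dB
    · exact goodPair_of_dihLike fac dA dB
  have hAM := le_prodSubgroup_left h
  have hXM := le_prodSubgroup_right h
  have hmet := metabelian_prodSubgroup hA dB.quasi h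
  refine ⟨prodSubgroup A X h, fun g => mem_prodSubgroup, hmet, fun hle => ?_, fun hle => ?_, ?_⟩
  · rw [Subgroup.index_eq_two_iff]
    obtain ⟨y, hy, hyX⟩ := dB.ne
    refine ⟨y, fun g => ?_⟩
    by_cases hg : g ∈ prodSubgroup A X h
    · refine Or.inr ⟨hg, fun hgy => ?_⟩
      obtain ⟨a, ha, x, hx, e⟩ := mem_prodSubgroup.1 ((Subgroup.mul_mem_cancel_left _ hg).1 hgy)
      have haB : a ∈ B := by
        rw [e] at hy
        exact (B.mul_mem_cancel_right (dB.le hx)).1 hy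
      exact hyX (e ▸ X.mul_mem (hle ⟨ha, haB⟩) hx)
    · refine Or.inl ⟨?_, hg⟩
      obtain ⟨a, ha, b, hb, rfl⟩ := fac g
      have hbX : b ∉ X := fun hc => hg ⟨a, ha, b, hc, rfl⟩
      exact ⟨a, ha, b * y, dB.mul_mem b hb hbX y hy hyX, by rw [mul_assoc]⟩
  · obtain ⟨c, ⟨hcA, hcB⟩, hcX⟩ := SetLike.not_le_iff_exists.1 hle
    rw [Subgroup.index_eq_one, Subgroup.eq_top_iff']
    intro g
    obtain ⟨a, ha, b, hb, rfl⟩ := fac g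
    by_cases hbX : b ∈ X
    · exact ⟨a, ha, b, hbX, rfl⟩
    · exact ⟨a * c, A.mul_mem ha hcA, c⁻¹ * b,
        dB.mul_mem _ (B.inv_mem hcB) (inv_notMem hcX) b hb hbX, by group⟩
  -- Two elements outside `M` have their product in `M`: write one as `a * b` and the other as `b' *
  -- a'`.
  · set M := prodSubgroup A X h with hM
    have hle : derivedSeries G 1 ≤ M := by
      rw [derivedSeries_succ, derivedSeries_zero, Subgroup.commutator_le]
      intro g _ k _
      refine commutator_mem_of_mul_mem (H := ⊤) (fun g _ hg k _ hk => ?_) (Subgroup.mem_top g)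
        (Subgroup.mem_top k)
      obtain ⟨a, ha, b, hb, rfl⟩ := fac g
      obtain ⟨b', hb', a', ha', rfl⟩ := fac_swap fac k
      have hbX : b ∉ X := fun hc => hg (M.mul_mem (hAM ha) (hXM hc))
      have hbX' : b' ∉ X := fun hc => hk (M.mul_mem (hXM hc) (hAM ha'))
      have e : a * b * (b' * a') = a * (b * b') * a' := by group
      rw [e]
      exact M.mul_mem (M.mul_mem (hAM ha) (hXM (dB.mul_mem b hb hbX b' hb' hbX'))) (hAM ha')
    have := derivedSeries_succ_le_map hle 2
    rw [hmet, Subgroup.map_bot] at this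
    exact le_bot_iff.1 this

theorem comm_or_dihLike (h : IsAbelianOrQuasicyclicIndexTwo A) :
    (∀ x ∈ A, ∀ y ∈ A, x * y = y * x) ∨ ∃ Y, DihLike A Y := by
  by_cases hc : IsMulCommutative A
  · exact Or.inl fun x hx y hy => congrArg Subtype.val (hc.is_comm.comm (⟨x, hx⟩ : A) ⟨y, hy⟩)
  · exact Or.inr (DihLike.of_index_two (h.resolve_left hc) hc)

end Main

theorem theorem1p1 {G : Type*} [Group G] (A B : Subgroup G)
    (hAB : (A : Set G) * (B : Set G) = Set.univ)
    (hA : IsAbelianOrQuasicyclicIndexTwo A) (hB : IsAbelianOrQuasicyclicIndexTwo B) :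
    (Group.IsSolvable G ∧ derivedSeries G 3 = ⊥) ∧
    (¬ IsMulCommutative B →
      ∀ X : Subgroup G, X ≤ B → IsQuasicyclic X →
        (A : Set G) * (X : Set G) = (X : Set G) * (A : Set G) ∧
        ∃ M : Subgroup G, (M : Set G) = (A : Set G) * (X : Set G) ∧
          IsMetabelian M ∧
          (A ⊓ B ≤ X → M.index = 2) ∧
          (¬ A ⊓ B ≤ X → M.index = 1)) := by
  have fac : ∀ g : G, ∃ a ∈ A, ∃ b ∈ B, g = a * b := by
    intro g
    obtain ⟨a, ha, b, hb, e⟩ := Set.mem_mul.1 (hAB ▸ Set.mem_univ g)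
    exact ⟨a, ha, b, hb, e.symm⟩
  have hA' := comm_or_dihLike hA
  have hB' := comm_or_dihLike hB
  have hder : derivedSeries G 3 = ⊥ := by
    rcases hB' with hBc | ⟨X, dB⟩
    · rcases hA' with hAc | ⟨Y, dA⟩
      · obtain ⟨N, -, h1, h2⟩ := exists_abelian_of_fac fac hAc hBc
        rw [derivedSeries_succ, derivedSeries_two_eq_bot N h1 h2, Subgroup.commutator_bot_left]
      · obtain ⟨M, -, -, -, -, h⟩ := exists_metabelian_prod (fac_swap fac) (Or.inl hBc) dA
        exact h
    · obtain ⟨M, -, -, -, -, h⟩ := exists_metabelian_prod fac hA' dB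
      exact h
  refine ⟨⟨⟨⟨3, hder⟩⟩, hder⟩, fun hBc X hXB hX => ?_⟩
  obtain ⟨X', dB⟩ := DihLike.of_index_two (hB.resolve_left hBc) hBc
  -- The given `X` is not assumed to have index two; uniqueness of the quasicyclic subgroup of `B`
  -- supplies this.
  obtain rfl := dB.eq_of_quasi hX.quasi hXB
  obtain ⟨M, hM, hmet, h2, h1, -⟩ := exists_metabelian_prod fac hA' dB
  have hMs : (M : Set G) = (A : Set G) * (X : Set G) := by
    ext g
    rw [SetLike.mem_coe, hM, Set.mem_mul]
    exact ⟨fun ⟨a, ha, x, hx, e⟩ => ⟨a, ha, x, hx, e.symm⟩,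
      fun ⟨a, ha, x, hx, e⟩ => ⟨a, ha, x, hx, e.symm⟩⟩
  refine ⟨?_, M, hMs, hmet, h2, h1⟩
  -- A subgroup is closed under inverses, and inverting the set `AX` gives `XA`.
  have := congrArg (·⁻¹) hMs
  simp only [mul_inv_rev, inv_coe_set] at this
  exact hMs.symm.trans this
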